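/- Let $g\ge 2$, let $K$ be an algebraically closed field whose characteristic does not divide $4g+2$, and let $\zeta\in K$ be a primitive $(4g+2)$-nd root of unity. Let $W_g$ be the Wiman curve, i.e. the smooth projective curve over $K$ with affine equation $y^2=x^{2g+1}-1$, and let $V=H^0(W_g,\omega^{2})$, with its natural action of $\operatorname{Aut}(W_g)$. 1. There is exactly one point of $W_g$ at infinity (the point $[1:0:0]$ of the curve $y^2=x^{2g+1}z-z^{2g+2}$ in $\mathbb P(1,g+1,1)$, a branch point of $x$), and every automorphism of $W_g$ fixes it. 2. There is an automorphism $\sigma$ with $\sigma(x)=\zeta^2x$ and $\sigma(y)=\zeta^{2g+1}y=-y$; it has order $4g+2$ and generates $\operatorname{Aut}(W_g)$. The forms $f\cdot(dx/y)^2$ with $$f\in\{1,x,\dots,x^{2g-2},\;y,yx,\dots,yx^{g-3}\}$$ (no $f$ involving $y$ if $g=2$) form a basis $B_2$ of $V$. They are eigenvectors of $\sigma$, with eigenvalues $\zeta^{2i+4}$ for $f=x^i$ and $\zeta^{2i+2g+5}$ for $f=yx^i$, and these eigenvalues are pairwise distinct. 3. Consequently the representation of $\operatorname{Aut}(W_g)$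 on $V$ is multiplicity free (it is completely reducible and each irreducible representation occurs at most once), and $B_2$ is the union of bases of its irreducible subrepresentations. If $g\ge3$, so that the bicanonical map embeds $W_g$, the bicanonical model is multiplicity free: the group of elements of $\operatorname{SL}(V)$ that preserve its homogeneous ideal $I\subset S=\operatorname{Sym}V$ is finite, its representation on $V$ is multiplicity free, and $B_2$ is the union of bases of the irreducible subrepresentations. 4. For $g\ge2$, let $I\subset S=\operatorname{Sym}V$ be the homogeneous ideal of the image of the bicanonical map. The basis $B_2$, equivalently the maximal torus $T\subset\operatorname{SL}(V)$ of elements diagonal in $B_2$, determines stability for the bicanonical model. That is, for every $m$ there is a finite subgroup $G$ of the stabilizer in $\operatorname{SL}(V)$ of the $m$-th Hilbert point $I_m\subset S_m$ such that $V$ is multiplicity free as a representation of $G$ and $B_2$ is the disjoint union of bases of the $G$-irreducible subrepresentations of $V$. -/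

import Mathlib

open scoped Pointwise TensorProduct

noncomputable section

/-! ## Representations: multiplicity freeness and adapted bases -/

section Representations

variable {K G V : Type*} [Field K] [Group G] [AddCommGroup V] [Module K V]

/-- A (completely reducible) representation is multiplicity free if every irreducible
representation occurs in it with multiplicity `0` or `1`, i.e. if two isomorphic irreducible
subrepresentations are always equal. -/
def IsMultiplicityFree (ρ : Representation K G V) : Prop :=
  ρ.IsSemisimpleRepresentation ∧
    ∀ U U' : Subrepresentation ρ,
      U.toRepresentation.IsIrreducible → U'.toRepresentation.IsIrreducible →
        Nonempty (U.toRepresentation.Equiv U'.toRepresentation) → U = U'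

/-- The basis `B` is the union of bases of the irreducible subrepresentations: every irreducible
subrepresentation is spanned by the members of `B` that it contains, and every member of `B` lies
in an irreducible subrepresentation. (Distinct irreducible subrepresentations meet in `0`, so the
union is automatically disjoint.) -/
def IsUnionOfIrreducibleBases {ι : Type*} (ρ : Representation K G V)
    (B : Module.Basis ι K V) : Prop :=
  (∀ U : Subrepresentation ρ, U.toRepresentation.IsIrreducible →
      Submodule.span K {v | v ∈ Set.range B ∧ v ∈ U} = U.toSubmodule) ∧
    ∀ i, ∃ U : Subrepresentation ρ, U.toRepresentation.IsIrreducible ∧ B i ∈ U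

end Representations

/-! ## Hilbert points and tori determining stability

`V` is the space of linear forms on a projective space, whose homogeneous coordinate ring is
`SymmetricAlgebra K V`. -/

section HilbertPoints

variable {K V : Type*} [Field K] [AddCommGroup V] [Module K V]

/-- The action on homogeneous polynomials of a linear change of coordinates. -/
def symMap (s : V →ₗ[K] V) : SymmetricAlgebra K V →ₐ[K] SymmetricAlgebra K V :=
  SymmetricAlgebra.lift (SymmetricAlgebra.ι K V ∘ₗ s)

lemma symMap_one : symMap (1 : V →ₗ[K] V) = AlgHom.id K _ := by
  apply SymmetricAlgebra.algHom_ext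
  ext v
  simp [symMap]

lemma symMap_mul (s t : V →ₗ[K] V) : symMap (s * t) = (symMap s).comp (symMap t) := by
  apply SymmetricAlgebra.algHom_ext
  ext v
  simp [symMap]

/-- The natural representation on `V` of a subgroup of `SL(V)`. -/
def slRepresentation (G : Subgroup (SpecialLinearGroup K V)) : Representation K G V where
  toFun s := ((s : SpecialLinearGroup K V) : V ≃ₗ[K] V)
  map_one' := rfl
  map_mul' _ _ := rfl

/-- The stabilizer in `SL(V)` of a subspace `w` of the homogeneous coordinate ring. -/
def slStabilizer (w : Submodule K (SymmetricAlgebra K V)) :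
    Subgroup (SpecialLinearGroup K V) where
  carrier := {s | ∀ p, symMap ((s : V ≃ₗ[K] V) : V →ₗ[K] V) p ∈ w ↔ p ∈ w}
  one_mem' p := by
    have h : (((1 : SpecialLinearGroup K V) : V ≃ₗ[K] V) : V →ₗ[K] V) = 1 := rfl
    rw [h, symMap_one]; rfl
  mul_mem' {s t} hs ht p := by
    have h : (((s * t : SpecialLinearGroup K V) : V ≃ₗ[K] V) : V →ₗ[K] V)
      = ((s : V ≃ₗ[K] V) : V →ₗ[K] V) * ((t : V ≃ₗ[K] V) : V →ₗ[K] V) := rfl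
    rw [h, symMap_mul]
    exact (hs _).trans (ht p)
  inv_mem' {s} hs p := by
    have h : symMap ((s : V ≃ₗ[K] V) : V →ₗ[K] V)
        (symMap (((s⁻¹ : SpecialLinearGroup K V) : V ≃ₗ[K] V) : V →ₗ[K] V) p) = p := by
      have h1 : ((s : V ≃ₗ[K] V) : V →ₗ[K] V)
          * (((s⁻¹ : SpecialLinearGroup K V) : V ≃ₗ[K] V) : V →ₗ[K] V) = 1 := by
        ext v
        exact (s : V ≃ₗ[K] V).apply_symm_apply v
      rw [← AlgHom.comp_apply, ← symMap_mul, h1, symMap_one]; rfl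
    have h2 := hs (symMap (((s⁻¹ : SpecialLinearGroup K V) : V ≃ₗ[K] V) : V →ₗ[K] V) p)
    rw [h] at h2
    exact h2.symm

/-- The `m`-th Hilbert point of a homogeneous ideal `I`: the subspace `I_m` of the space `S_m` of
forms of degree `m`, regarded as a point of the Grassmannian of `S_m`. -/
def hilbertPoint (I : Ideal (SymmetricAlgebra K V)) (m : ℕ) :
    Submodule K (SymmetricAlgebra K V) :=
  I.restrictScalars K ⊓ LinearMap.range (SymmetricAlgebra.ι K V) ^ m

/-- The group of linear automorphisms, with determinant one, of the subscheme with homogeneous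
ideal `I`. -/
def linearAut (I : Ideal (SymmetricAlgebra K V)) : Subgroup (SpecialLinearGroup K V) :=
  slStabilizer (I.restrictScalars K)

/-- The maximal torus of `SL(V)` of elements that are diagonal in the basis `B`. -/
def diagonalTorus {ι : Type*} (B : Module.Basis ι K V) : Subgroup (SpecialLinearGroup K V) where
  carrier := {s | ∀ i, ∃ c : Kˣ, (s : V ≃ₗ[K] V) (B i) = c • B i}
  one_mem' i := ⟨1, by rw [one_smul]; rfl⟩
  mul_mem' {s t} hs ht i := by
    obtain ⟨c, hc⟩ := hs i
    obtain ⟨d, hd⟩ := ht i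
    refine ⟨d * c, ?_⟩
    change (s : V ≃ₗ[K] V) ((t : V ≃ₗ[K] V) (B i)) = _
    rw [hd, Units.smul_def, map_smul, hc, mul_smul, Units.smul_def d]
  inv_mem' {s} hs i := by
    obtain ⟨c, hc⟩ := hs i
    refine ⟨c⁻¹, ?_⟩
    change (s : V ≃ₗ[K] V).symm (B i) = _
    rw [LinearEquiv.symm_apply_eq, Units.smul_def, map_smul, hc, ← Units.smul_def, inv_smul_smul]

/-- The basis `B` determines stability for the point `w`: there is a finite subgroup `G` of the
stabilizer of `w` in `SL(V)` such that `V` is multiplicity free as a representation of `G` and `B`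
is the disjoint union of bases of the `G`-irreducible subrepresentations of `V`. -/
def BasisDeterminesStability {ι : Type*} (B : Module.Basis ι K V)
    (w : Submodule K (SymmetricAlgebra K V)) : Prop :=
  ∃ G : Subgroup (SpecialLinearGroup K V), G ≤ slStabilizer w ∧ Finite G ∧
    IsMultiplicityFree (slRepresentation G) ∧
    IsUnionOfIrreducibleBases (slRepresentation G) B

/-- A torus determines stability for `w` if it is the diagonal torus of a basis that does. -/
def TorusDeterminesStability (T : Subgroup (SpecialLinearGroup K V))
    (w : Submodule K (SymmetricAlgebra K V)) : Prop :=
  ∃ (ι : Type) (B : Module.Basis ι K V), T = diagonalTorus B ∧ BasisDeterminesStability B w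

end HilbertPoints

/-! ## Smooth projective curves

A smooth projective curve over an algebraically closed field `K` is given by its function field
`F`. Its points are the valuation rings of `F` over `K` (the local rings of the curve), and its
automorphisms are the `K`-automorphisms of `F`. -/

section Curves

variable (K F : Type*) [Field K] [Field F] [Algebra K F]

/-- The (closed) points of the smooth projective curve with function field `F`. -/
structure CurvePoint where
  /-- the local ring of the curve at the point -/
  localRing : ValuationSubring F
  algebraMap_mem : ∀ c : K, algebraMap K F c ∈ localRing
  ne_top : localRing ≠ ⊤

/-- Rational quadratic differentials, `Ω_{F/K} ⊗ Ω_{F/K}`. -/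
abbrev QuadDiff := (Ω[F⁄K]) ⊗[F] (Ω[F⁄K])

/-- The image of `Ω_{O/K} ⊗ Ω_{O/K}` in the rational quadratic differentials, for a subring `O`. -/
def regularAt (O : ValuationSubring F) : AddSubgroup (QuadDiff K F) :=
  AddSubgroup.closure {η | ∃ c ∈ O, ∃ a ∈ O, ∃ b ∈ O,
    η = c • (KaehlerDifferential.D K F a ⊗ₜ[F] KaehlerDifferential.D K F b)}

/-- `H⁰(C, ω²)`: the rational quadratic differentials that are regular at every point. -/
def bicanonicalForms : Submodule K (QuadDiff K F) where
  carrier := {η | ∀ P : CurvePoint K F, η ∈ regularAt K F P.localRing}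
  zero_mem' _ := zero_mem _
  add_mem' h h' P := add_mem (h P) (h' P)
  smul_mem' c η h P := by
    have hη := h P
    clear h
    rw [regularAt] at hη ⊢
    induction hη using AddSubgroup.closure_induction with
    | mem x hx =>
      obtain ⟨e, he, a, ha, b, hb, rfl⟩ := hx
      refine AddSubgroup.subset_closure
        ⟨algebraMap K F c * e, mul_mem (P.algebraMap_mem c) he, a, ha, b, hb, ?_⟩
      rw [mul_smul, algebraMap_smul]
    | zero => rw [smul_zero]; exact zero_mem _
    | add x y _ _ hx hy => rw [smul_add]; exact add_mem hx hy
    | neg x _ hx => rw [smul_neg]; exact neg_mem hx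

variable {K F}

/-- `Ω_{F/K}` with `F` acting through the automorphism `φ`. -/
def TwistedDiff (_φ : F ≃ₐ[K] F) := Ω[F⁄K]

instance (φ : F ≃ₐ[K] F) : AddCommGroup (TwistedDiff φ) :=
  inferInstanceAs (AddCommGroup (Ω[F⁄K]))

instance (φ : F ≃ₐ[K] F) : Module K (TwistedDiff φ) :=
  inferInstanceAs (Module K (Ω[F⁄K]))

instance (φ : F ≃ₐ[K] F) : Module F (TwistedDiff φ) :=
  Module.compHom (Ω[F⁄K]) (φ : F →+* F)

instance (φ : F ≃ₐ[K] F) : IsScalarTower K F (TwistedDiff φ) where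
  smul_assoc c f η := by
    have key : ∀ ω : Ω[F⁄K], φ (c • f) • ω = c • (φ f • ω) := fun ω => by
      rw [map_smul, smul_assoc]
    exact key η

/-- The derivation `a ↦ d(φ a)`. -/
def twistedD (φ : F ≃ₐ[K] F) : Derivation K F (TwistedDiff φ) where
  toFun a := (KaehlerDifferential.D K F (φ a) : Ω[F⁄K])
  map_add' a b := by
    change KaehlerDifferential.D K F (φ (a + b)) = _
    rw [map_add, map_add]; rfl
  map_smul' c a := by
    change KaehlerDifferential.D K F (φ (c • a)) = _
    rw [map_smul, Derivation.map_smul]; rfl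
  map_one_eq_zero' := by
    change KaehlerDifferential.D K F (φ 1) = _
    rw [map_one, Derivation.map_one_eq_zero]; rfl
  leibniz' a b := by
    change KaehlerDifferential.D K F (φ (a * b)) = _
    rw [map_mul, Derivation.leibniz]; rfl

/-- The natural action of an automorphism on differentials, `a db ↦ φ(a) d(φ b)`. -/
def diffMap (φ : F ≃ₐ[K] F) : (Ω[F⁄K]) →ₛₗ[(φ : F →+* F)] (Ω[F⁄K]) where
  toFun := (twistedD φ).liftKaehlerDifferential
  map_add' := map_add (twistedD φ).liftKaehlerDifferential
  map_smul' := map_smul (twistedD φ).liftKaehlerDifferential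

lemma diffMap_D (φ : F ≃ₐ[K] F) (a : F) :
    diffMap φ (KaehlerDifferential.D K F a) = KaehlerDifferential.D K F (φ a) :=
  (twistedD φ).liftKaehlerDifferential_comp_D a

/-- The natural action of an automorphism on rational quadratic differentials,
`c da ⊗ db ↦ φ(c) d(φ a) ⊗ d(φ b)`. -/
def quadDiffMap (φ : F ≃ₐ[K] F) : QuadDiff K F →ₛₗ[(φ : F →+* F)] QuadDiff K F :=
  TensorProduct.map (diffMap φ) (diffMap φ)

lemma quadDiffMap_apply (φ : F ≃ₐ[K] F) (c a b : F) :
    quadDiffMap φ (c • (KaehlerDifferential.D K F a ⊗ₜ[F] KaehlerDifferential.D K F b))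
      = φ c • (KaehlerDifferential.D K F (φ a) ⊗ₜ[F] KaehlerDifferential.D K F (φ b)) := by
  rw [map_smulₛₗ, quadDiffMap, TensorProduct.map_tmul, diffMap_D, diffMap_D]; rfl

lemma quadDiff_induction {p : QuadDiff K F → Prop}
    (h : ∀ c a b : F,
      p (c • (KaehlerDifferential.D K F a ⊗ₜ[F] KaehlerDifferential.D K F b)))
    (hadd : ∀ x y, p x → p y → p (x + y)) (η : QuadDiff K F) : p η := by
  have h0 : p 0 := by simpa using h 0 0 0
  have hspan : ∀ x : Ω[F⁄K],
      x ∈ Submodule.span F (Set.range (KaehlerDifferential.D K F)) := fun x => by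
    rw [KaehlerDifferential.span_range_derivation]; trivial
  induction η using TensorProduct.induction_on with
  | zero => exact h0
  | add x y hx hy => exact hadd x y hx hy
  | tmul u v =>
    induction hspan u using Submodule.span_induction generalizing v with
    | zero => rw [TensorProduct.zero_tmul]; exact h0
    | add x y _ _ hx hy => rw [TensorProduct.add_tmul]; exact hadd _ _ (hx v) (hy v)
    | smul c x _ hx => rw [TensorProduct.smul_tmul]; exact hx _
    | mem x hx =>
      obtain ⟨a, rfl⟩ := hx
      induction hspan v using Submodule.closure_induction with
      | zero => rw [TensorProduct.tmul_zero]; exact h0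
      | add x y _ _ hx hy => rw [TensorProduct.tmul_add]; exact hadd _ _ hx hy
      | smul_mem c x hx =>
        obtain ⟨b, rfl⟩ := hx
        rw [TensorProduct.tmul_smul]; exact h c a b

lemma quadDiffMap_one (η : QuadDiff K F) : quadDiffMap (1 : F ≃ₐ[K] F) η = η := by
  induction η using quadDiff_induction with
  | h c a b => rw [quadDiffMap_apply]; rfl
  | hadd x y hx hy => rw [map_add, hx, hy]

lemma quadDiffMap_mul (φ ψ : F ≃ₐ[K] F) (η : QuadDiff K F) :
    quadDiffMap (φ * ψ) η = quadDiffMap φ (quadDiffMap ψ η) := by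
  induction η using quadDiff_induction with
  | h c a b => simp only [quadDiffMap_apply]; rfl
  | hadd x y hx hy => simp only [map_add, hx, hy]

lemma quadDiffMap_smul (φ : F ≃ₐ[K] F) (c : K) (η : QuadDiff K F) :
    quadDiffMap φ (c • η) = c • quadDiffMap φ η := by
  rw [← algebraMap_smul F c η, map_smulₛₗ, ← algebraMap_smul F c (quadDiffMap φ η)]
  congr 1
  exact φ.commutes c

lemma quadDiffMap_mem (φ : F ≃ₐ[K] F) {η : QuadDiff K F} (hη : η ∈ bicanonicalForms K F) :
    quadDiffMap φ η ∈ bicanonicalForms K F := by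
  intro P
  have mem_iff : ∀ a : F, φ a ∈ P.localRing ↔ a ∈ φ⁻¹ • P.localRing := fun a =>
    (ValuationSubring.mem_inv_pointwise_smul_iff (g := φ)).symm
  let Q : CurvePoint K F :=
    { localRing := φ⁻¹ • P.localRing
      algebraMap_mem := fun c => by
        rw [← mem_iff, φ.commutes]; exact P.algebraMap_mem c
      ne_top := fun h => P.ne_top <| by
        ext a
        have := mem_iff (φ.symm a)
        rw [φ.apply_symm_apply, h] at this
        simpa using this }
  have h := hη Q
  change η ∈ regularAt K F (φ⁻¹ • P.localRing) at h
  rw [regularAt] at h ⊢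
  clear hη
  induction h using AddSubgroup.closure_induction with
  | mem x hx =>
    obtain ⟨c, hc, a, ha, b, hb, rfl⟩ := hx
    rw [quadDiffMap_apply]
    exact AddSubgroup.subset_closure
      ⟨φ c, (mem_iff c).2 hc, φ a, (mem_iff a).2 ha, φ b, (mem_iff b).2 hb, rfl⟩
  | zero => rw [map_zero]; exact zero_mem _
  | add x y _ _ hx hy => rw [map_add]; exact add_mem hx hy
  | neg x _ hx => rw [map_neg]; exact neg_mem hx

variable (K F)

/-- The natural representation of the automorphism group of the curve on `H⁰(C, ω²)`. -/
def bicanonicalRepresentation : Representation K (F ≃ₐ[K] F) (bicanonicalForms K F) where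
  toFun φ :=
    { toFun := fun η => ⟨quadDiffMap φ η, quadDiffMap_mem φ η.2⟩
      map_add' := fun _ _ => Subtype.ext (map_add _ _ _)
      map_smul' := fun c η => Subtype.ext (quadDiffMap_smul φ c η) }
  map_one' := by
    ext η
    exact quadDiffMap_one _
  map_mul' φ ψ := by
    ext η
    exact quadDiffMap_mul φ ψ _

/-- The homogeneous ideal of the bicanonical model: the kernel of the map from polynomials in the
elements of `H⁰(C, ω²)` to rational pluri-differentials (the symmetric algebra of the
one-dimensional `F`-vector space of quadratic differentials) that multiplies forms. A polynomial
homogeneous of degree `m` lies in it if and only if it vanishes as a section of `ω^{2m}`, i.e. on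
the image of the curve under the bicanonical map. -/
def bicanonicalIdeal : Ideal (SymmetricAlgebra K (bicanonicalForms K F)) :=
  RingHom.ker (SymmetricAlgebra.lift
    (((SymmetricAlgebra.ι F (QuadDiff K F)).restrictScalars K) ∘ₗ
      (bicanonicalForms K F).subtype))

end Curves

/-! ## Wiman curves -/

section Wiman

open Polynomial

variable (K : Type*) [Field K] (g : ℕ)

/-- The polynomial `Y² - (x^{2g+1} - 1)` over the rational function field `K(x)`. -/
def wimanPolynomial : (RatFunc K)[X] :=
  X ^ 2 - C (algebraMap K[X] (RatFunc K) (X ^ (2 * g + 1) - 1))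

lemma wimanPolynomial_irreducible : Irreducible (wimanPolynomial K g) := by
  have hdeg : (wimanPolynomial K g).natDegree = 2 := natDegree_X_pow_sub_C
  have hd : (X ^ (2 * g + 1) - 1 : K[X]).natDegree = 2 * g + 1 := natDegree_X_pow_sub_C (r := 1)
  have h0 : (X ^ (2 * g + 1) - 1 : K[X]) ≠ 0 := fun h => by simp [h] at hd
  refine irreducible_of_degree_le_three_of_not_isRoot (by rw [hdeg]; decide) fun r hr => ?_
  have h1 : r ^ 2 = algebraMap K[X] (RatFunc K) (X ^ (2 * g + 1) - 1) := by
    have := hr.eq_zero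
    rw [wimanPolynomial, eval_sub, eval_pow, eval_X, eval_C] at this
    exact sub_eq_zero.1 this
  have hr0 : r ≠ 0 := by
    rintro rfl
    rw [zero_pow two_ne_zero] at h1
    exact h0 ((map_eq_zero_iff _ (RatFunc.algebraMap_injective K)).1 h1.symm)
  have h2 := congrArg RatFunc.intDegree h1
  rw [pow_two, RatFunc.intDegree_mul hr0 hr0, RatFunc.intDegree_polynomial, hd] at h2
  push_cast at h2
  omega

/-- The function field `K(x)[y] / (y² - (x^{2g+1} - 1))` of the Wiman curve `W_g`. -/
abbrev WimanField : Type _ := AdjoinRoot (wimanPolynomial K g)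

instance : Fact (Irreducible (wimanPolynomial K g)) := ⟨wimanPolynomial_irreducible K g⟩

/-- The coordinate function `x` on `W_g`. -/
def wimanX : WimanField K g := AdjoinRoot.of (wimanPolynomial K g) RatFunc.X

/-- The coordinate function `y` on `W_g`. -/
def wimanY : WimanField K g := AdjoinRoot.root (wimanPolynomial K g)

lemma wiman_equation : wimanY K g ^ 2 = wimanX K g ^ (2 * g + 1) - 1 := by
  have h := AdjoinRoot.eval₂_root (wimanPolynomial K g)
  rw [wimanPolynomial, eval₂_sub, eval₂_pow, eval₂_X, eval₂_C, sub_eq_zero] at h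
  refine h.trans ?_
  simp only [map_sub, map_pow, map_one, RatFunc.algebraMap_X]
  rfl

/-- The automorphism group of the Wiman curve. -/
abbrev WimanAut : Type _ := WimanField K g ≃ₐ[K] WimanField K g

variable {K g}

/-- `P` is the branch point at infinity `[x : y : z] = [1 : 0 : 0]` in `ℙ(1, g+1, 1)`: the affine
coordinates `z/x` and `y/x^{g+1}` of the chart `x ≠ 0` both vanish at `P`. -/
def IsBranchPointAtInfinity (P : CurvePoint K (WimanField K g)) : Prop :=
  P.localRing.valuation (wimanX K g)⁻¹ < 1 ∧
    P.localRing.valuation (wimanY K g / wimanX K g ^ (g + 1)) < 1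

variable (K g)

/-- The quadratic differential `(dx / y)²`. -/
def wimanSq : QuadDiff K (WimanField K g) :=
  ((wimanY K g)⁻¹ • KaehlerDifferential.D K (WimanField K g) (wimanX K g)) ⊗ₜ[WimanField K g]
    ((wimanY K g)⁻¹ • KaehlerDifferential.D K (WimanField K g) (wimanX K g))

/-- The standard functions `1, x, …, x^{2g-2}, y, yx, …, yx^{g-3}`; multiplied by `(dx / y)²` they
are the bicanonical forms of the standard basis. -/
def standardFunction : Fin (2 * g - 1) ⊕ Fin (g - 2) → WimanField K g
  | Sum.inl i => wimanX K g ^ (i : ℕ)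
  | Sum.inr i => wimanY K g * wimanX K g ^ (i : ℕ)

/-- The exponents of the eigenvalues: `σ` scales `x^i (dx / y)²` by `ζ^{2i+4}` and
`y x^i (dx / y)²` by `ζ^{2i+(2g+1)+4}`. -/
def eigenExponent : Fin (2 * g - 1) ⊕ Fin (g - 2) → ℕ
  | Sum.inl i => 2 * i + 4
  | Sum.inr i => 2 * i + (2 * g + 1) + 4

end Wiman

end

/-! The curve is covered by two smooth affine models, y² = x^(2g+1) - 1 and, with z = 1/x and w =
y/x^(g+1), w² = z - z^(2g+2), because every valuation ring contains x or 1/x. The coordinate ring of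
such a model is integrally closed, so a function regular on the affine part is a(x) + b(x)y with
polynomials a and b. The forms (dx/y)² and (dz/w)² generate the regular quadratic differentials on
their charts, and (dx/y)² = z^(2g-2) (dz/w)². Comparing the two charts bounds the degrees of a and b
and yields the standard basis (`smul_wimanSq_mem_bicanonicalForms_iff`, `exists_bicanonicalBasis`).

Let φ be an automorphism, and let k be the factor by which it changes dx/y. Since φ preserves
bicanonical forms, the squares of φ(x)^i k (i ≤ g-1) are again coefficients of bicanonical forms,
which makes φ(x)^i k a polynomial in x of degree at most g-1. Hence φ(x) is a Möbius transform of x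
(`exists_moebius`). It preserves the branch form Z(X^(2g+1) - Z^(2g+1)) up to a factor, and
comparing coefficients shows that it is a rotation (`moebius_eq_rotation`). So φ is (x, y) ↦ (ax,
by) with a^(2g+1) = b² = 1 (`wimanAut_apply`); these maps are the powers of σ, and they fix the
point at infinity.

A group that is diagonal in a basis and contains an element with distinct eigenvalues has the basis
lines as its only irreducible subrepresentations, and they are pairwise non-isomorphic
(`isMultiplicityFree_of_diagonal`). This applies to Aut, to the cyclic group generated by σ rescaled
to determinant one, and, for g ≥ 3, to all linear automorphisms of the model. In the last case 1, x
and y are among the basis functions; a linear map preserving the ideal preserves the relations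
between ratios of forms, so up to a factor it comes from an automorphism of the curve
(`exists_wimanAut_of_symMap`). Determinant one then leaves finitely many scalars. -/

/-! ### Groups acting diagonally with an element of distinct eigenvalues -/

section DiagonalRepresentations

variable {K G V ι : Type*} [Field K] [Group G] [AddCommGroup V] [Module K V]

/-- A subspace stable under an operator that is diagonal in a basis, with distinct eigenvalues,
is a coordinate subspace. -/
lemma mem_of_repr_ne_zero (B : Module.Basis ι K V) (f : V →ₗ[K] V) (μ : ι → K)
    (hμ : Function.Injective μ) (hf : ∀ i, f (B i) = μ i • B i) (U : Submodule K V)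
    (hU : ∀ v ∈ U, f v ∈ U) {v : V} (hv : v ∈ U) {i : ι} (hi : B.repr v i ≠ 0) : B i ∈ U := by
  classical
  have repr_f : ∀ (w : V) j, B.repr (f w) j = μ j * B.repr w j := by
    intro w j
    have : (Finsupp.lapply j ∘ₗ B.repr.toLinearMap) ∘ₗ f
        = μ j • (Finsupp.lapply j ∘ₗ B.repr.toLinearMap) := by
      refine B.ext fun k => ?_
      simp only [LinearMap.comp_apply, hf, map_smul, LinearMap.smul_apply, LinearEquiv.coe_coe,
        B.repr_self, Finsupp.lapply_apply, smul_eq_mul, Finsupp.single_apply]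
      split_ifs with h
      · rw [h]
      · simp
    simpa using LinearMap.congr_fun this w
  -- induction on the size of the support
  generalize hn : (B.repr v).support.card = n
  induction n using Nat.strong_induction_on generalizing v with
  | _ n ih =>
  by_cases h : ∃ j, j ≠ i ∧ B.repr v j ≠ 0
  · obtain ⟨j, hji, hj⟩ := h
    -- The operator `f - μ j` kills the coordinate `j` and multiplies the coordinate `i` by `μ i - μ
    -- j ≠ 0`, so the support shrinks without losing `i`.
    have hw : f v - μ j • v ∈ U := sub_mem (hU v hv) (U.smul_mem _ hv)
    have hr : ∀ k, B.repr (f v - μ j • v) k = (μ k - μ j) * B.repr v k := by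
      intro k; simp [repr_f, sub_mul]
    refine ih _ ?_ hw ?_ rfl
    · rw [← hn]
      refine Finset.card_lt_card ⟨fun k hk => ?_, fun hs => ?_⟩
      · rw [Finsupp.mem_support_iff, hr] at hk
        exact Finsupp.mem_support_iff.2 (right_ne_zero_of_mul hk)
      · have := hs (Finsupp.mem_support_iff.2 hj)
        rw [Finsupp.mem_support_iff, hr, sub_self, zero_mul] at this
        exact this rfl
    · rw [hr]
      exact mul_ne_zero (sub_ne_zero.2 fun h => hji (hμ h).symm) hi
  · push Not at h
    have hv' : v = B.repr v i • B i := by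
      apply B.repr.injective
      ext k
      rcases eq_or_ne k i with rfl | hk
      · simp
      · simp [h k hk, hk.symm]
    rw [hv'] at hv
    exact (U.smul_mem_iff hi).1 hv

lemma eq_span_basis_mem (B : Module.Basis ι K V) (f : V →ₗ[K] V) (μ : ι → K)
    (hμ : Function.Injective μ) (hf : ∀ i, f (B i) = μ i • B i) (U : Submodule K V)
    (hU : ∀ v ∈ U, f v ∈ U) : U = Submodule.span K (B '' {i | B i ∈ U}) := by
  apply le_antisymm
  · intro v hv
    rw [B.mem_span_image]
    intro i hi
    exact mem_of_repr_ne_zero B f μ hμ hf U hU hv (Finsupp.mem_support_iff.1 hi)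
  · rw [Submodule.span_le]
    rintro _ ⟨i, hi, rfl⟩
    exact hi

/-- The subrepresentation spanned by some members of a basis in which a representation is
diagonal. -/
def coordinateSubrepresentation (ρ : Representation K G V) (B : Module.Basis ι K V)
    (hdiag : ∀ s i, ∃ c : K, ρ s (B i) = c • B i) (J : Set ι) : Subrepresentation ρ where
  toSubmodule := Submodule.span K (B '' J)
  apply_mem_toSubmodule s v hv := by
    have : Submodule.span K (B '' J) ≤ (Submodule.span K (B '' J)).comap (ρ s) := by
      rw [Submodule.span_le]
      rintro _ ⟨i, hi, rfl⟩
      obtain ⟨c, hc⟩ := hdiag s i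
      change ρ s (B i) ∈ Submodule.span K (B '' J)
      rw [hc]
      exact Submodule.smul_mem _ _ (Submodule.subset_span ⟨i, hi, rfl⟩)
    exact this hv

lemma irreducible_of_finrank_eq_one {ρ : Representation K G V}
    (h : Module.finrank K V = 1) : ρ.IsIrreducible := by
  have : IsSimpleModule K V := isSimpleModule_iff_finrank_eq_one.2 h
  have hs : IsSimpleOrder (Submodule K V) := (isSimpleModule_iff _ _).1 this
  refine { exists_pair_ne := ⟨⊥, ⊤, fun h => ?_⟩, eq_bot_or_eq_top := fun U => ?_ }
  · exact bot_ne_top (α := Submodule K V) (congrArg Subrepresentation.toSubmodule h)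
  · exact (hs.eq_bot_or_eq_top U.toSubmodule).imp
      (fun h => Subrepresentation.toSubmodule_injective h)
      (fun h => Subrepresentation.toSubmodule_injective h)

/-- A representation that is diagonal in a basis and contains an element with distinct
eigenvalues is multiplicity free, and the basis is adapted to it. -/
theorem isMultiplicityFree_of_diagonal (ρ : Representation K G V) (B : Module.Basis ι K V)
    (hdiag : ∀ s i, ∃ c : K, ρ s (B i) = c • B i) (s₀ : G) (μ : ι → K)
    (hμ : Function.Injective μ) (hs₀ : ∀ i, ρ s₀ (B i) = μ i • B i) :
    IsMultiplicityFree ρ ∧ IsUnionOfIrreducibleBases ρ B := by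
  classical
  let L := coordinateSubrepresentation ρ B hdiag
  have hspan : ∀ U : Subrepresentation ρ, U = L {i | B i ∈ U} := fun U =>
    Subrepresentation.toSubmodule_injective
      (eq_span_basis_mem B (ρ s₀) μ hμ hs₀ U.toSubmodule (U.apply_mem_toSubmodule s₀))
  have hLmem : ∀ J i, B i ∈ L J ↔ i ∈ J := fun J i => by
    change B i ∈ Submodule.span K (B '' J) ↔ _
    rw [B.mem_span_image, B.repr_self, Finsupp.support_single _ one_ne_zero]
    simp
  have hline : ∀ i, (L {i}).toRepresentation.IsIrreducible := fun i => by
    apply irreducible_of_finrank_eq_one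
    change Module.finrank K (Submodule.span K (B '' {i})) = 1
    rw [Set.image_singleton]
    exact finrank_span_singleton (B.ne_zero i)
  have hirr : ∀ U : Subrepresentation ρ, U.toRepresentation.IsIrreducible →
      ∃ i, U = L {i} := by
    intro U hU
    have hne : ∃ i, B i ∈ U := by
      by_contra hcon
      push Not at hcon
      have hU0 : U.toSubmodule = ⊥ := by
        rw [hspan U]
        change Submodule.span K (B '' _) = ⊥
        simp [hcon]
      obtain ⟨W, W', hW⟩ := hU.exists_pair_ne
      refine hW (Subrepresentation.toSubmodule_injective ?_)
      have : Subsingleton U.toSubmodule := by rw [hU0]; infer_instance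
      exact Subsingleton.elim _ _
    obtain ⟨i, hi⟩ := hne
    refine ⟨i, Subrepresentation.toSubmodule_injective ?_⟩
    have hle : (L {i}).toSubmodule ≤ U.toSubmodule := by
      change Submodule.span K (B '' {i}) ≤ _
      rw [Set.image_singleton, Submodule.span_singleton_le_iff_mem]
      exact hi
    -- The line through `B i`, seen inside `U`: irreducibility leaves only 0, which is excluded, or
    -- all of `U`.
    let W : Subrepresentation U.toRepresentation :=
      { toSubmodule := (L {i}).toSubmodule.comap U.toSubmodule.subtype
        apply_mem_toSubmodule := fun s v hv => (L {i}).apply_mem_toSubmodule s hv }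
    rcases hU.eq_bot_or_eq_top W with h | h
    · exfalso
      have h1 : (⟨B i, hi⟩ : U.toSubmodule) ∈ W.toSubmodule := (hLmem {i} i).2 rfl
      rw [h] at h1
      exact B.ne_zero i (congrArg Subtype.val ((Submodule.mem_bot K).1 h1))
    · refine le_antisymm (fun v hv => ?_) hle
      have h1 : (⟨v, hv⟩ : U.toSubmodule) ∈ W.toSubmodule := by rw [h]; trivial
      exact h1
  -- Complete reducibility: a coordinate subspace is complemented by the span of the remaining basis
  -- vectors.
  refine ⟨⟨⟨fun U => ⟨L {i | B i ∉ U}, ?_⟩⟩, ?_⟩, ?_, ?_⟩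
  · constructor
    · rw [disjoint_iff]
      rw [hspan (U ⊓ _)]
      apply Subrepresentation.toSubmodule_injective
      change Submodule.span K (B '' _) = ⊥
      have : {i | B i ∈ U ⊓ L {i | B i ∉ U}} = ∅ := by
        ext i
        have : B i ∈ U ⊓ L {i | B i ∉ U} ↔ B i ∈ U ∧ B i ∈ L {i | B i ∉ U} := Iff.rfl
        simp [this, hLmem]
      rw [this]; simp
    · rw [codisjoint_iff]
      apply Subrepresentation.toSubmodule_injective
      change _ = (⊤ : Submodule K V)
      rw [eq_top_iff, ← B.span_eq, Submodule.span_le]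
      rintro _ ⟨i, rfl⟩
      by_cases h : B i ∈ U
      · exact (le_sup_left : U.toSubmodule ≤ U.toSubmodule ⊔ (L {i | B i ∉ U}).toSubmodule) h
      · exact (le_sup_right : _ ≤ U.toSubmodule ⊔ (L {i | B i ∉ U}).toSubmodule)
          ((hLmem {i | B i ∉ U} i).2 h)
  · rintro U U' hU hU' ⟨e⟩
    obtain ⟨i, rfl⟩ := hirr U hU
    obtain ⟨j, rfl⟩ := hirr U' hU'
    -- An isomorphism between two of the lines intertwines `s₀`, so the eigenvalues agree, and they
    -- determine the index.
    have hscal : ∀ k, ∀ v ∈ L {k}, ρ s₀ v = μ k • v := by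
      intro k v hv
      change v ∈ Submodule.span K (B '' {k}) at hv
      rw [Set.image_singleton, Submodule.mem_span_singleton] at hv
      obtain ⟨c, rfl⟩ := hv
      rw [map_smul, hs₀, smul_comm]
    let b : (L {i}).toSubmodule := ⟨B i, (hLmem {i} i).2 rfl⟩
    have hb0 : b ≠ 0 := fun h => B.ne_zero i (congrArg Subtype.val h)
    have he : e.toLinearEquiv b ≠ 0 := fun h => hb0 ((LinearEquiv.map_eq_zero_iff _).1 h)
    have h1 : e.toLinearEquiv ((L {i}).toRepresentation s₀ b)
        = (L {j}).toRepresentation s₀ (e.toLinearEquiv b) :=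
      LinearMap.congr_fun (e.isIntertwining' s₀) b
    have h2 : (L {i}).toRepresentation s₀ b = μ i • b := Subtype.ext (hscal i _ b.2)
    have h3 : (L {j}).toRepresentation s₀ (e.toLinearEquiv b) = μ j • e.toLinearEquiv b :=
      Subtype.ext (hscal j _ (e.toLinearEquiv b).2)
    rw [h2, h3, map_smul] at h1
    have : μ i = μ j := smul_left_injective K he h1
    rw [hμ this]
  · intro U hU
    conv_rhs => rw [hspan U]
    change _ = Submodule.span K (B '' _)
    congr 1
    ext v
    constructor
    · rintro ⟨⟨i, rfl⟩, hi⟩; exact ⟨i, hi, rfl⟩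
    · rintro ⟨i, hi, rfl⟩; exact ⟨⟨i, rfl⟩, hi⟩
  · exact fun i => ⟨L {i}, hline i, (hLmem {i} i).2 rfl⟩

end DiagonalRepresentations

/-! ### Integral closedness of the coordinate ring of Y² = Q(X) -/

section HyperellipticCharts

open Polynomial

variable {K F : Type*} [Field K] [Field F] [Algebra K F]

/-- `Y² = Q(X)` is a smooth affine model, with hyperelliptic involution `τ`, of the curve with
function field `F`. -/
structure IsHyperellipticChart (X Y : F) (Q : K[X]) (τ : F ≃ₐ[K] F) : Prop where
  equation : Y ^ 2 = aeval X Q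
  transcendental : Function.Injective (aeval X : K[X] →ₐ[K] F)
  exists_rep : ∀ f : F, ∃ p q r : K[X], r ≠ 0 ∧ f * aeval X r = aeval X p + aeval X q * Y
  map_X : τ X = X
  map_Y : τ Y = -Y
  separable : Q.Separable
  two_ne_zero : (2 : K) ≠ 0

/-- The fraction field of `K[X]` embeds in `F`, `a` is the image of p/r, and `K[X]` is integrally
closed. -/
lemma exists_eq_aeval_of_isIntegralElem {X : F}
    (hX : Function.Injective (aeval X : K[X] →ₐ[K] F)) {a : F} {p r : K[X]} (hr : r ≠ 0)
    (h : a * aeval X r = aeval X p)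
    (ha : (aeval X : K[X] →ₐ[K] F).toRingHom.IsIntegralElem a) : ∃ s : K[X], a = aeval X s := by
  let : Algebra K[X] F := (aeval X : K[X] →ₐ[K] F).toRingHom.toAlgebra
  have hinj : Function.Injective (Algebra.ofId K[X] F) := hX
  let φ : FractionRing K[X] →ₐ[K[X]] F := IsFractionRing.liftAlgHom hinj
  have hφ : ∀ s : K[X], φ (algebraMap _ _ s) = aeval X s := fun s => φ.commutes s
  have hr' : aeval X r ≠ 0 := fun h0 => hr (hX (by rw [h0, map_zero]))
  have hr'' : algebraMap K[X] (FractionRing K[X]) r ≠ 0 := fun h0 =>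
    hr ((map_eq_zero_iff _ (IsFractionRing.injective _ _)).1 h0)
  have hval : φ (algebraMap _ _ p / algebraMap _ _ r) = a := by
    rw [map_div₀, hφ, hφ, ← h, mul_div_cancel_right₀ _ hr']
  have hint : IsIntegral K[X] (φ (algebraMap _ _ p / algebraMap _ _ r)) := by
    rw [hval]; exact ha
  rw [isIntegral_algHom_iff φ φ.toRingHom.injective] at hint
  obtain ⟨s, hs⟩ := IsIntegrallyClosed.isIntegral_iff.1 hint
  exact ⟨s, by rw [← hval, ← hs, hφ]⟩

lemma exists_isCoprime_eq_mul {r : K[X]} (hr : r ≠ 0) (q : K[X]) :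
    ∃ d r' q' : K[X], IsCoprime r' q' ∧ d ≠ 0 ∧ r = d * r' ∧ q = d * q' := by
  classical
  obtain ⟨r', hr'⟩ := EuclideanDomain.gcd_dvd_left r q
  obtain ⟨q', hq'⟩ := EuclideanDomain.gcd_dvd_right r q
  have hab := EuclideanDomain.gcd_eq_gcd_ab r q
  generalize EuclideanDomain.gcd r q = d at *
  have hd : d ≠ 0 := fun h0 => hr (by rw [hr', h0, zero_mul])
  refine ⟨d, r', q', ⟨EuclideanDomain.gcdA r q, EuclideanDomain.gcdB r q,
    mul_left_cancel₀ hd ?_⟩, hd, hr', hq'⟩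
  linear_combination -hab - EuclideanDomain.gcdA r q * hr' - EuclideanDomain.gcdB r q * hq'

/-- After the gcd of `r` and `q` is removed, the square of what remains of `r` is coprime to the `q`
part, hence divides the squarefree `Q`, so it is a unit. This turns polynomiality of q²Q/r² into
polynomiality of q/r. -/
lemma dvd_of_sq_dvd_sq_mul {Q q r : K[X]} (hQ : Squarefree Q) (hr : r ≠ 0)
    (h : r ^ 2 ∣ q ^ 2 * Q) : r ∣ q := by
  obtain ⟨d, r', q', hco, hd, rfl, rfl⟩ := exists_isCoprime_eq_mul hr q
  have h1 : r' ^ 2 ∣ q' ^ 2 * Q := by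
    rw [mul_pow, mul_pow, mul_assoc] at h
    exact (mul_dvd_mul_iff_left (pow_ne_zero 2 hd)).1 h
  have h2 : r' ^ 2 ∣ Q := (hco.pow).dvd_of_dvd_mul_left h1
  have h3 : IsUnit r' := hQ r' (by rwa [← pow_two])
  exact mul_dvd_mul_left d h3.dvd

namespace IsHyperellipticChart

variable {X Y : F} {Q : K[X]} {τ : F ≃ₐ[K] F} (h : IsHyperellipticChart X Y Q τ)
include h

lemma aeval_ne_zero {r : K[X]} (hr : r ≠ 0) : aeval X r ≠ 0 :=
  fun h0 => hr (h.transcendental (by rw [h0, map_zero]))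

lemma Q_ne_zero : Q ≠ 0 := h.separable.ne_zero

lemma Y_ne_zero : Y ≠ 0 := by
  intro h0
  have := h.equation
  rw [h0, zero_pow _root_.two_ne_zero] at this
  exact h.aeval_ne_zero h.Q_ne_zero this.symm

lemma two_ne_zero' : (2 : F) ≠ 0 := by
  have := (map_ne_zero_iff _ (algebraMap K F).injective).2 h.two_ne_zero
  rwa [map_ofNat] at this

lemma map_aeval (p : K[X]) : τ (aeval X p) = aeval X p := by
  rw [← AlgEquiv.coe_toAlgHom, ← aeval_algHom_apply, AlgEquiv.coe_toAlgHom, h.map_X]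

/-- The involution `τ` separates the even part from the odd part; this needs 2 to be invertible. -/
lemma rep_unique {p q : K[X]} (h0 : aeval X p + aeval X q * Y = 0) : p = 0 ∧ q = 0 := by
  have h1 : aeval X p - aeval X q * Y = 0 := by
    have := congrArg τ h0
    simpa [h.map_aeval, h.map_Y, ← sub_eq_add_neg] using this
  have hp : 2 * aeval X p = 0 := by linear_combination h0 + h1
  have hq : 2 * (aeval X q * Y) = 0 := by linear_combination h0 - h1
  refine ⟨?_, ?_⟩
  · by_contra hne
    exact mul_ne_zero h.two_ne_zero' (h.aeval_ne_zero hne) hp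
  · by_contra hne
    exact mul_ne_zero h.two_ne_zero' (mul_ne_zero (h.aeval_ne_zero hne) h.Y_ne_zero) hq

/-- The coordinate ring is integrally closed: half the trace of `f` under `τ` is integral in K(X),
hence a polynomial `s`, and `f - s` is (q/r)Y, whose square q²Q/r² is again integral in K(X).
Squarefreeness of `Q` then makes q/r a polynomial. -/
lemma exists_rep_of_isIntegralElem {f : F}
    (hf : (aeval X : K[X] →ₐ[K] F).toRingHom.IsIntegralElem f) :
    ∃ p q : K[X], f = aeval X p + aeval X q * Y := by
  set φ : K[X] →+* F := (aeval X : K[X] →ₐ[K] F).toRingHom with hφ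
  have hτ : φ.IsIntegralElem (τ f) := by
    obtain ⟨P, hP, hP0⟩ := hf
    refine ⟨P, hP, ?_⟩
    have h1 := hom_eval₂ P φ (τ : F →+* F) f
    rw [hP0, map_zero] at h1
    have h2 : (τ : F →+* F).comp φ = φ := RingHom.ext fun p => h.map_aeval p
    rw [h2] at h1
    exact h1.symm
  obtain ⟨p, q, r, hr, hrep⟩ := h.exists_rep f
  have hrepτ : τ f * aeval X r = aeval X p - aeval X q * Y := by
    have := congrArg τ hrep
    simpa [h.map_aeval, h.map_Y, ← sub_eq_add_neg] using this
  have h2 := h.two_ne_zero'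
  have h2' : aeval X (C (2⁻¹ : K)) = (2⁻¹ : F) := by
    rw [aeval_C, map_inv₀, map_ofNat]
  have ha : φ.IsIntegralElem (φ (C (2⁻¹ : K)) * (f + τ f)) :=
    RingHom.IsIntegralElem.mul _ (φ.isIntegralElem_map) (RingHom.IsIntegralElem.add _ hf hτ)
  obtain ⟨s, hs⟩ := exists_eq_aeval_of_isIntegralElem h.transcendental (p := p) hr (by
    change aeval X (C (2⁻¹ : K)) * _ * _ = _
    rw [h2', mul_assoc, add_mul, hrep, hrepτ]
    field_simp
    ring) ha
  have hs' : (f + τ f) = 2 * aeval X s := by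
    rw [← hs]
    change _ = 2 * (aeval X (C (2⁻¹ : K)) * _)
    rw [h2']
    field_simp
  have hb : φ.IsIntegralElem (f - φ s) := RingHom.IsIntegralElem.sub _ hf φ.isIntegralElem_map
  have hps : aeval X p = aeval X s * aeval X r := by
    apply mul_left_cancel₀ h2
    linear_combination -hrep - hrepτ + hs' * aeval X r
  have hbr : (f - aeval X s) * aeval X r = aeval X q * Y := by
    linear_combination hrep + hps
  have hbr2 : (f - φ s) ^ 2 * aeval X (r ^ 2) = aeval X (q ^ 2 * Q) := by
    rw [map_pow, ← mul_pow, map_mul, map_pow, ← h.equation, ← mul_pow]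
    exact congrArg (· ^ 2) hbr
  have hb2 : φ.IsIntegralElem ((f - φ s) ^ 2) := by
    rw [pow_two]; exact RingHom.IsIntegralElem.mul _ hb hb
  obtain ⟨t, ht⟩ := exists_eq_aeval_of_isIntegralElem h.transcendental (pow_ne_zero 2 hr) hbr2 hb2
  have hdvd : r ^ 2 ∣ q ^ 2 * Q := ⟨t, h.transcendental (by
    rw [map_mul _ (r ^ 2), ← hbr2, ht, mul_comm])⟩
  obtain ⟨q', rfl⟩ := dvd_of_sq_dvd_sq_mul h.separable.squarefree hr hdvd
  refine ⟨s, q', ?_⟩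
  apply mul_right_cancel₀ (h.aeval_ne_zero hr)
  rw [map_mul] at hbr
  linear_combination hbr

omit h in
/-- A function that lies in all valuation rings containing `K[X]` is integral over `K[X]`. -/
lemma _root_.isIntegralElem_of_forall_mem {X f : F}
    (hf : ∀ O : ValuationSubring F, (∀ c, algebraMap K F c ∈ O) → X ∈ O → f ∈ O) :
    (aeval X : K[X] →ₐ[K] F).toRingHom.IsIntegralElem f := by
  let : Algebra K[X] F := (aeval X : K[X] →ₐ[K] F).toRingHom.toAlgebra
  let R : Subring F := (algebraMap K[X] F).range
  have h1 : f ∈ (integralClosure (Subring.closure (R : Set F)) F).toSubring := by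
    -- The integral closure of a subring of a field is the intersection of the valuation rings that
    -- contain it.
    rw [← iInf_valuationSubring_superset, Subring.mem_iInf]
    rintro ⟨V, hV⟩
    refine hf V (fun c => hV ⟨C c, ?_⟩) (hV ⟨Polynomial.X, ?_⟩)
    · exact aeval_C X c
    · exact aeval_X X
  rw [Subring.closure_eq] at h1
  have h2 : IsIntegral R f := h1
  let : Algebra K[X] R := (algebraMap K[X] F).rangeRestrict.toAlgebra
  have : IsScalarTower K[X] R F := IsScalarTower.of_algebraMap_eq fun _ => rfl
  have h3 : Algebra.IsIntegral K[X] R := Algebra.isIntegral_of_surjective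
    (algebraMap K[X] F).rangeRestrict_surjective
  exact isIntegral_trans f h2

lemma exists_rep_of_forall_mem {f : F}
    (hf : ∀ O : ValuationSubring F, (∀ c, algebraMap K F c ∈ O) → X ∈ O → f ∈ O) :
    ∃ p q : K[X], f = aeval X p + aeval X q * Y :=
  h.exists_rep_of_isIntegralElem (isIntegralElem_of_forall_mem hf)

end IsHyperellipticChart

end HyperellipticCharts

/-! ### Places over a point of the affine model and their local rings -/

section LocalRings

open Polynomial

variable {K F : Type*} [Field K] [Field F] [Algebra K F]

lemma aeval_mem_valuationSubring {O : ValuationSubring F} (hK : ∀ c, algebraMap K F c ∈ O) {X : F}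
    (hX : X ∈ O) (p : K[X]) : aeval X p ∈ O := by
  induction p using Polynomial.induction_on' with
  | add p q hp hq => rw [map_add]; exact add_mem hp hq
  | monomial n c => rw [aeval_monomial]; exact mul_mem (hK c) (pow_mem hX n)

/-- The place `O` lies over the point `(α, β)` of the affine plane. -/
structure IsCenteredAt (O : ValuationSubring F) (X Y : F) (α β : K) : Prop where
  algebraMap_mem : ∀ c : K, algebraMap K F c ∈ O
  X_lt : O.valuation (X - algebraMap K F α) < 1
  Y_lt : O.valuation (Y - algebraMap K F β) < 1

namespace IsCenteredAt

variable {O : ValuationSubring F} {X Y : F} {α β : K} (hc : IsCenteredAt O X Y α β)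
include hc

lemma X_mem : X ∈ O := by
  have := add_mem (O.valuation_le_one_iff _ |>.1 hc.X_lt.le) (hc.algebraMap_mem α)
  rwa [sub_add_cancel] at this

lemma Y_mem : Y ∈ O := by
  have := add_mem (O.valuation_le_one_iff _ |>.1 hc.Y_lt.le) (hc.algebraMap_mem β)
  rwa [sub_add_cancel] at this

lemma valuation_aeval_sub_lt (p : K[X]) :
    O.valuation (aeval X p - algebraMap K F (p.eval α)) < 1 := by
  obtain ⟨q, hq⟩ := X_sub_C_dvd_sub_C_eval (a := α) (p := p)
  have : aeval X p - algebraMap K F (p.eval α) = (X - algebraMap K F α) * aeval X q := by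
    have := congrArg (aeval X) hq
    simpa [map_sub, map_mul, aeval_C] using this
  rw [this, map_mul]
  exact mul_lt_one_of_lt_of_le hc.X_lt
    ((O.valuation_le_one_iff _).2 (aeval_mem_valuationSubring hc.algebraMap_mem hc.X_mem q))

/-- Modulo the maximal ideal of `O`, a function on the affine model equals its value at (α, β). -/
lemma valuation_rep_sub_lt (p q : K[X]) :
    O.valuation (aeval X p + aeval X q * Y - algebraMap K F (p.eval α + q.eval α * β)) < 1 := by
  have : aeval X p + aeval X q * Y - algebraMap K F (p.eval α + q.eval α * β)
      = (aeval X p - algebraMap K F (p.eval α)) + ((aeval X q - algebraMap K F (q.eval α)) * Y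
        + algebraMap K F (q.eval α) * (Y - algebraMap K F β)) := by
    rw [map_add, map_mul]; ring
  rw [this]
  refine Valuation.map_add_lt _ (hc.valuation_aeval_sub_lt p) (Valuation.map_add_lt _ ?_ ?_)
  · rw [map_mul]
    exact mul_lt_one_of_lt_of_le (hc.valuation_aeval_sub_lt q)
      ((O.valuation_le_one_iff _).2 hc.Y_mem)
  · rw [map_mul]
    rw [mul_comm]
    exact mul_lt_one_of_lt_of_le hc.Y_lt ((O.valuation_le_one_iff _).2 (hc.algebraMap_mem _))

omit hc in
lemma _root_.ValuationSubring.valuation_algebraMap_eq_one {O : ValuationSubring F}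
    (hK : ∀ c, algebraMap K F c ∈ O) {c : K} (h0 : c ≠ 0) : O.valuation (algebraMap K F c) = 1 := by
  have h1 := (O.valuation_le_one_iff _).2 (hK c)
  have h2 := (O.valuation_le_one_iff _).2 (hK c⁻¹)
  have h3 : O.valuation (algebraMap K F c) * O.valuation (algebraMap K F c⁻¹) = 1 := by
    rw [← map_mul, ← map_mul, mul_inv_cancel₀ h0, map_one, map_one]
  refine le_antisymm h1 ?_
  rw [← h3]
  exact mul_le_of_le_one_right' h2

/-- A nonzero constant is a unit of `O`, so the value at the centre decides whether the function is
one. -/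
lemma valuation_rep_lt_one_iff (p q : K[X]) :
    O.valuation (aeval X p + aeval X q * Y) < 1 ↔ p.eval α + q.eval α * β = 0 := by
  have h1 := hc.valuation_rep_sub_lt p q
  constructor
  · intro h2
    by_contra h0
    have h3 := Valuation.map_sub_lt _ h2 h1
    rw [sub_sub_cancel, ValuationSubring.valuation_algebraMap_eq_one hc.algebraMap_mem h0] at h3
    exact lt_irrefl _ h3
  · intro h0
    rwa [h0, map_zero, sub_zero] at h1

lemma rep_mem (p q : K[X]) : aeval X p + aeval X q * Y ∈ O :=
  add_mem (aeval_mem_valuationSubring hc.algebraMap_mem hc.X_mem p)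
    (mul_mem (aeval_mem_valuationSubring hc.algebraMap_mem hc.X_mem q) hc.Y_mem)

lemma valuation_rep_eq_one_iff (p q : K[X]) :
    O.valuation (aeval X p + aeval X q * Y) = 1 ↔ p.eval α + q.eval α * β ≠ 0 := by
  rw [Ne, ← hc.valuation_rep_lt_one_iff, not_lt]
  exact ⟨fun h => h.ge, le_antisymm ((O.valuation_le_one_iff _).2 (hc.rep_mem p q))⟩

end IsCenteredAt

namespace IsHyperellipticChart

variable {X Y : F} {Q : K[X]} {τ : F ≃ₐ[K] F} (h : IsHyperellipticChart X Y Q τ)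
include h

lemma Y_mem {O : ValuationSubring F} (hK : ∀ c, algebraMap K F c ∈ O) (hX : X ∈ O) : Y ∈ O := by
  have h1 : Y ^ 2 ∈ O := by rw [h.equation]; exact aeval_mem_valuationSubring hK hX Q
  rw [← O.valuation_le_one_iff] at h1 ⊢
  rw [map_pow] at h1
  exact (pow_le_one_iff _root_.two_ne_zero).1 h1

/-- An `f` outside `O` has a denominator r(X) that is not a unit. Over an algebraically closed field
`r` splits, so some X - α is a non-unit. Then Y² - Q(α) = (Y - β)(Y + β) is one as well, which
selects the sign of β. -/
lemma exists_isCenteredAt [IsAlgClosed K] {O : ValuationSubring F}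
    (hK : ∀ c, algebraMap K F c ∈ O) (hX : X ∈ O) (hO : O ≠ ⊤) :
    ∃ α β : K, β ^ 2 = Q.eval α ∧ IsCenteredAt O X Y α β := by
  have hY := h.Y_mem hK hX
  obtain ⟨f, hf⟩ : ∃ f, f ∉ O := by
    by_contra! hcon
    exact hO (by ext f; simp [hcon f])
  obtain ⟨p, q, r, hr, hrep⟩ := h.exists_rep f
  have hr1 : O.valuation (aeval X r) ≠ 1 := by
    intro h1
    apply hf
    have h2 : O.valuation f = O.valuation (f * aeval X r) := by rw [map_mul, h1, mul_one]
    rw [← O.valuation_le_one_iff, h2, hrep, O.valuation_le_one_iff]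
    exact add_mem (aeval_mem_valuationSubring hK hX p)
      (mul_mem (aeval_mem_valuationSubring hK hX q) hY)
  obtain ⟨α, hα⟩ : ∃ α : K, O.valuation (X - algebraMap K F α) ≠ 1 := by
    by_contra! hcon
    apply hr1
    have hs := (IsAlgClosed.splits r).eq_prod_roots
    rw [hs, map_mul, map_mul, aeval_C, ValuationSubring.valuation_algebraMap_eq_one hK
      (leadingCoeff_ne_zero.2 hr), one_mul]
    generalize r.roots = s
    induction s using Multiset.induction_on with
    | empty => simp
    | cons a s ih =>
      rw [Multiset.map_cons, Multiset.prod_cons, map_mul, map_mul, ih, mul_one, map_sub, aeval_X,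
        aeval_C, hcon]
  have hα' : O.valuation (X - algebraMap K F α) < 1 :=
    lt_of_le_of_ne ((O.valuation_le_one_iff _).2 (sub_mem hX (hK α))) hα
  obtain ⟨β, hβ⟩ := IsAlgClosed.exists_pow_nat_eq (Q.eval α) two_pos
  have hprod : O.valuation ((Y - algebraMap K F β) * (Y - algebraMap K F (-β))) < 1 := by
    have hc0 : IsCenteredAt O X X α α := ⟨hK, hα', hα'⟩
    have := hc0.valuation_aeval_sub_lt Q
    rw [← hβ, ← h.equation, map_pow] at this
    rw [map_neg]
    convert this using 2
    ring
  rw [map_mul] at hprod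
  have hle : ∀ b : K, O.valuation (Y - algebraMap K F b) ≤ 1 := fun b =>
    (O.valuation_le_one_iff _).2 (sub_mem hY (hK b))
  by_cases h1 : O.valuation (Y - algebraMap K F β) < 1
  · exact ⟨α, β, hβ, hK, hα', h1⟩
  · refine ⟨α, -β, by rw [neg_sq, hβ], hK, hα', ?_⟩
    have := le_antisymm (hle β) (not_lt.1 h1)
    rwa [this, one_mul] at hprod

/-- A local parameter at a point of a smooth affine model. -/
lemma exists_parameter {α β : K} (hβ : β ^ 2 = Q.eval α) :
    ∃ t : F, t ≠ 0 ∧ (∃ p q : K[X], p.eval α + q.eval α * β = 0 ∧ t = aeval X p + aeval X q * Y) ∧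
      (∀ p q : K[X], p.eval α + q.eval α * β = 0 → ∃ p' q' p₁ q₁ : K[X],
        p₁.eval α + q₁.eval α * β ≠ 0 ∧
        (aeval X p + aeval X q * Y) * (aeval X p₁ + aeval X q₁ * Y)
          = t * (aeval X p' + aeval X q' * Y)) ∧
      ∀ r : K[X], r ≠ 0 → ∃ (n : ℕ) (u u' : K[X]), u.eval α ≠ 0 ∧ u'.eval α ≠ 0 ∧
        aeval X r * aeval X u = t ^ n * aeval X u' := by
  have hroot : ∀ {s : K[X]}, s.eval α = 0 → ∃ s', s = (Polynomial.X - C α) * s' := fun hs =>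
    dvd_iff_isRoot.2 hs
  have hmult : ∀ r : K[X], r ≠ 0 → ∃ (n : ℕ) (u' : K[X]), u'.eval α ≠ 0 ∧
      r = (Polynomial.X - C α) ^ n * u' := fun r hr => by
    obtain ⟨u', h1, h2⟩ := exists_eq_pow_rootMultiplicity_mul_and_not_dvd r hr α
    exact ⟨_, u', fun h0 => h2 (dvd_iff_isRoot.2 h0), h1⟩
  have hX0 : aeval X (Polynomial.X - C α) ≠ 0 := h.aeval_ne_zero (X_sub_C_ne_zero α)
  -- At a branch point the parameter is `Y`: Q = (X - α)Q₁ with Q₁(α) ≠ 0, as `Q` is squarefree, so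
  -- X - α is Y² up to a unit. Elsewhere the parameter is X - α.
  by_cases hβ0 : β = 0
  · have hQ0 : Q.eval α = 0 := by rw [← hβ, hβ0]; simp
    obtain ⟨Q₁, hQ₁⟩ := hroot hQ0
    have hQ₁α : Q₁.eval α ≠ 0 := by
      intro h0
      obtain ⟨Q₂, rfl⟩ := hroot h0
      have := h.separable.squarefree (Polynomial.X - C α) ⟨Q₂, by rw [hQ₁]; ring⟩
      exact not_isUnit_X_sub_C α this
    have hYsq : aeval X (Polynomial.X - C α) * aeval X Q₁ = Y ^ 2 := by
      rw [← map_mul, ← hQ₁, h.equation]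
    refine ⟨Y, h.Y_ne_zero, ⟨0, 1, by simp [hβ0], by simp⟩, fun p q hpq => ?_, fun r hr => ?_⟩
    · rw [hβ0, mul_zero, add_zero] at hpq
      obtain ⟨p₁, rfl⟩ := hroot hpq
      refine ⟨q * Q₁, p₁, Q₁, 0, by simpa using hQ₁α, ?_⟩
      simp only [map_mul, map_zero]
      linear_combination aeval X p₁ * hYsq
    · obtain ⟨n, u', hu', rfl⟩ := hmult r hr
      refine ⟨2 * n, Q₁ ^ n, u', by simpa using fun h => absurd h hQ₁α, hu', ?_⟩
      rw [pow_mul, ← hYsq, mul_pow]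
      simp only [map_mul, map_pow]
      ring
  · refine ⟨aeval X (Polynomial.X - C α), hX0, ⟨Polynomial.X - C α, 0, by simp, by simp⟩, fun p q hpq => ?_, fun r hr => ?_⟩
    · by_cases hq : q.eval α = 0
      · rw [hq, zero_mul, add_zero] at hpq
        obtain ⟨p', rfl⟩ := hroot hpq
        obtain ⟨q', rfl⟩ := hroot hq
        refine ⟨p', q', 1, 0, by simp, ?_⟩
        simp only [map_mul, map_zero, map_one]
        ring
      -- Multiply by the conjugate p - qY. The norm is a polynomial in X that vanishes at α, and the
      -- conjugate takes the value -2q(α)β ≠ 0, so it is a local unit.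
      · have hN : (p ^ 2 - q ^ 2 * Q).eval α = 0 := by
          simp only [eval_sub, eval_mul, eval_pow, ← hβ]
          linear_combination (p.eval α - q.eval α * β) * hpq
        obtain ⟨N, hN'⟩ := hroot hN
        refine ⟨N, 0, p, -q, ?_, ?_⟩
        · rw [eval_neg, eq_neg_of_add_eq_zero_left hpq]
          have : -(q.eval α * β) + -q.eval α * β = -(2 * (q.eval α * β)) := by ring
          rw [this, neg_ne_zero]
          exact mul_ne_zero h.two_ne_zero (mul_ne_zero hq hβ0)
        · have := congrArg (aeval X) hN'
          simp only [map_mul, map_sub, map_pow, map_neg, map_zero] at this ⊢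
          rw [← h.equation] at this
          linear_combination this
    · obtain ⟨n, u', hu', rfl⟩ := hmult r hr
      exact ⟨n, 1, u', by simp, hu', by simp⟩

/-- The local ring at a point of a smooth affine model is the localization of the coordinate
ring. -/
lemma exists_local_rep {O : ValuationSubring F} {α β : K} (hβ : β ^ 2 = Q.eval α)
    (hc : IsCenteredAt O X Y α β) {f : F} (hf : f ∈ O) :
    ∃ p q p₁ q₁ : K[X], p₁.eval α + q₁.eval α * β ≠ 0 ∧
      f * (aeval X p₁ + aeval X q₁ * Y) = aeval X p + aeval X q * Y := by
  obtain ⟨t, ht, ⟨pt, qt, hpqt, htrep⟩, hpar, hpol⟩ := h.exists_parameter hβ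
  have hmul : ∀ p q p' q' : K[X], (aeval X p + aeval X q * Y) * (aeval X p' + aeval X q' * Y)
      = aeval X (p * p' + q * q' * Q) + aeval X (p * q' + q * p') * Y := by
    intro p q p' q'
    simp only [map_add, map_mul, ← h.equation]
    ring
  -- If `f * t ^ n` times a unit is a function on the model and n > 0, that function vanishes at the
  -- centre because `f` lies in `O`. It is therefore divisible by `t` up to a unit, and one power of
  -- `t` cancels.
  have hcancel : ∀ (n : ℕ) (p q p₁ q₁ : K[X]), p₁.eval α + q₁.eval α * β ≠ 0 →
      f * t ^ n * (aeval X p₁ + aeval X q₁ * Y) = aeval X p + aeval X q * Y →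
      ∃ p q p₁ q₁ : K[X], p₁.eval α + q₁.eval α * β ≠ 0 ∧
      f * (aeval X p₁ + aeval X q₁ * Y) = aeval X p + aeval X q * Y := by
    intro n
    induction n with
    | zero => exact fun p q p₁ q₁ h1 h2 => ⟨p, q, p₁, q₁, h1, by simpa using h2⟩
    | succ n ih =>
      intro p q p₁ q₁ h1 h2
      have hval : p.eval α + q.eval α * β = 0 := by
        rw [← hc.valuation_rep_lt_one_iff, ← h2, map_mul, (hc.valuation_rep_eq_one_iff _ _).2 h1,
          mul_one, mul_comm, map_mul, map_pow]
        refine mul_lt_one_of_lt_of_le (pow_lt_one₀ zero_le ?_ n.succ_ne_zero)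
          ((O.valuation_le_one_iff _).2 hf)
        rw [htrep]
        exact (hc.valuation_rep_lt_one_iff pt qt).2 hpqt
      obtain ⟨p', q', p₂, q₂, h3, h4⟩ := hpar p q hval
      refine ih p' q' (p₁ * p₂ + q₁ * q₂ * Q) (p₁ * q₂ + q₁ * p₂) ?_ ?_
      · have : (p₁ * p₂ + q₁ * q₂ * Q).eval α + (p₁ * q₂ + q₁ * p₂).eval α * β
            = (p₁.eval α + q₁.eval α * β) * (p₂.eval α + q₂.eval α * β) := by
          simp only [eval_add, eval_mul, ← hβ]
          ring
        rw [this]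
        exact mul_ne_zero h1 h3
      · rw [← hmul]
        apply mul_left_cancel₀ ht
        rw [← h4, ← h2]
        ring
  obtain ⟨p, q, r, hr, hrep⟩ := h.exists_rep f
  obtain ⟨n, u, u', hu, hu', hr'⟩ := hpol r hr
  refine hcancel n (p * u) (q * u) u' 0 (by simpa using hu') ?_
  simp only [map_mul, map_zero]
  linear_combination aeval X u * hrep - f * hr'

end IsHyperellipticChart

end LocalRings

/-! ### Generators of the regular quadratic differentials on a chart -/

section RegularForms

open Polynomial

variable {K F : Type*} [Field K] [Field F] [Algebra K F]

lemma smul_mem_regularAt {O : ValuationSubring F} {f : F} (hf : f ∈ O) {η : QuadDiff K F}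
    (hη : η ∈ regularAt K F O) : f • η ∈ regularAt K F O := by
  rw [regularAt] at hη ⊢
  induction hη using AddSubgroup.closure_induction with
  | mem x hx =>
    obtain ⟨c, hc, a, ha, b, hb, rfl⟩ := hx
    exact AddSubgroup.subset_closure ⟨f * c, mul_mem hf hc, a, ha, b, hb, by rw [mul_smul]⟩
  | zero => rw [smul_zero]; exact zero_mem _
  | add x y _ _ hx hy => rw [smul_add]; exact add_mem hx hy
  | neg x _ hx => rw [smul_neg]; exact neg_mem hx

lemma smul_D_tmul_smul_D_mem_regularAt {O : ValuationSubring F} {c a d b : F} (hc : c ∈ O)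
    (ha : a ∈ O) (hd : d ∈ O) (hb : b ∈ O) :
    (c • KaehlerDifferential.D K F a) ⊗ₜ[F] (d • KaehlerDifferential.D K F b)
      ∈ regularAt K F O := by
  refine AddSubgroup.subset_closure ⟨d * c, mul_mem hd hc, a, ha, b, hb, ?_⟩
  rw [TensorProduct.tmul_smul, mul_smul]
  rfl

namespace IsHyperellipticChart

variable {X Y : F} {Q : K[X]} {τ : F ≃ₐ[K] F} (h : IsHyperellipticChart X Y Q τ)
include h

lemma derivation_Y {D : Derivation K F F} (hD : D X = Y) : 2 * D Y = aeval X (derivative Q) := by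
  have h1 : D (Y ^ 2) = D (aeval X Q) := by rw [h.equation]
  rw [Derivation.leibniz_pow, Derivation.map_aeval, hD] at h1
  apply mul_right_cancel₀ h.Y_ne_zero
  simp only [smul_eq_mul, nsmul_eq_mul] at h1
  push_cast at h1
  linear_combination h1

/-- The derivation dual to `dX / Y` preserves the local rings of the affine model. -/
lemma derivation_mem [IsAlgClosed K] {D : Derivation K F F} (hD : D X = Y)
    {O : ValuationSubring F} (hK : ∀ c, algebraMap K F c ∈ O) (hX : X ∈ O) (hO : O ≠ ⊤) {f : F}
    (hf : f ∈ O) : D f ∈ O := by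
  have hY := h.Y_mem hK hX
  have hp : ∀ p : K[X], aeval X p ∈ O := aeval_mem_valuationSubring hK hX
  have hDp : ∀ p : K[X], D (aeval X p) ∈ O := fun p => by
    rw [Derivation.map_aeval, hD]; exact mul_mem (hp _) hY
  have hDY : D Y ∈ O := by
    have h1 : D Y = algebraMap K F 2⁻¹ * aeval X (derivative Q) := by
      rw [← h.derivation_Y hD, map_inv₀, map_ofNat, inv_mul_cancel_left₀ h.two_ne_zero']
    rw [h1]
    exact mul_mem (hK _) (hp _)
  have hDr : ∀ p q : K[X], D (aeval X p + aeval X q * Y) ∈ O := fun p q => by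
    rw [map_add, Derivation.leibniz]
    exact add_mem (hDp p) (add_mem (mul_mem (hp q) hDY) (mul_mem hY (hDp q)))
  obtain ⟨α, β, hβ, hc⟩ := h.exists_isCenteredAt hK hX hO
  obtain ⟨p, q, p₁, q₁, h1, h2⟩ := h.exists_local_rep hβ hc hf
  have hv := (hc.valuation_rep_eq_one_iff p₁ q₁).2 h1
  have h3 := congrArg D h2
  rw [Derivation.leibniz] at h3
  simp only [smul_eq_mul] at h3
  -- This is the quotient rule for `f` written as a fraction with unit denominator; dividing by the
  -- unit keeps the result in `O`.
  have h4 : D f * (aeval X p₁ + aeval X q₁ * Y) ∈ O := by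
    have : D f * (aeval X p₁ + aeval X q₁ * Y)
        = D (aeval X p + aeval X q * Y) - f * D (aeval X p₁ + aeval X q₁ * Y) := by
      rw [← h3]; ring
    rw [this]
    exact sub_mem (hDr p q) (mul_mem hf (hDr p₁ q₁))
  rw [← O.valuation_le_one_iff] at h4 ⊢
  rwa [map_mul, hv, mul_one] at h4

/-- `(dX / Y)²` is regular on the affine model. -/
lemma smul_mem_regularAt {O : ValuationSubring F} (hK : ∀ c, algebraMap K F c ∈ O) (hX : X ∈ O)
    {f : F} (hf : f ∈ O) :
    f • ((Y⁻¹ • KaehlerDifferential.D K F X) ⊗ₜ[F] (Y⁻¹ • KaehlerDifferential.D K F X))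
      ∈ regularAt K F O := by
  have hY := h.Y_mem hK hX
  have hp : ∀ p : K[X], aeval X p ∈ O := aeval_mem_valuationSubring hK hX
  have hY0 := h.Y_ne_zero
  apply _root_.smul_mem_regularAt hf
  obtain ⟨u, v, huv⟩ := h.separable
  have hdY : (2 * Y) • KaehlerDifferential.D K F Y
      = aeval X (derivative Q) • KaehlerDifferential.D K F X := by
    have h1 : KaehlerDifferential.D K F (Y ^ 2) = KaehlerDifferential.D K F (aeval X Q) := by
      rw [h.equation]
    rw [Derivation.leibniz_pow, Derivation.map_aeval] at h1
    rw [← h1, mul_smul, pow_one]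
    simp [two_smul]
  -- From uQ + vQ' = 1, Q = Y² and Q' dX = 2Y dY one gets dX/Y = uY dX + 2v dY, which has no
  -- denominator.
  have hω : Y⁻¹ • KaehlerDifferential.D K F X
      = (aeval X u * Y) • KaehlerDifferential.D K F X
        + (2 * aeval X v) • KaehlerDifferential.D K F Y := by
    have h1 : (2 * aeval X v) • KaehlerDifferential.D K F Y
        = (aeval X v * Y⁻¹) • ((2 * Y) • KaehlerDifferential.D K F Y) := by
      rw [smul_smul]; congr 1; field_simp
    rw [h1, hdY, smul_smul, ← add_smul]
    congr 1
    have h2 := congrArg (aeval X) huv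
    simp only [map_add, map_mul, map_one, ← h.equation] at h2
    field_simp
    linear_combination -h2
  have h2 : (2 : F) ∈ O := by simp
  have h3 := mul_mem (hp u) hY
  have h4 := mul_mem h2 (hp v)
  rw [hω, TensorProduct.add_tmul, TensorProduct.tmul_add, TensorProduct.tmul_add]
  exact add_mem (add_mem (smul_D_tmul_smul_D_mem_regularAt h3 hX h3 hX)
    (smul_D_tmul_smul_D_mem_regularAt h3 hX h4 hY))
    (add_mem (smul_D_tmul_smul_D_mem_regularAt h4 hY h3 hX)
    (smul_D_tmul_smul_D_mem_regularAt h4 hY h4 hY))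

/-- Forms that are regular at a point of the affine model are regular multiples of
`(dX / Y)²`. -/
lemma exists_eq_smul_of_mem_regularAt [IsAlgClosed K] {D : Derivation K F F} (hD : D X = Y)
    (hdD : ∀ a, KaehlerDifferential.D K F a = D a • Y⁻¹ • KaehlerDifferential.D K F X)
    {O : ValuationSubring F} (hK : ∀ c, algebraMap K F c ∈ O) (hX : X ∈ O) (hO : O ≠ ⊤)
    {η : QuadDiff K F} (hη : η ∈ regularAt K F O) : ∃ f ∈ O,
    η = f • ((Y⁻¹ • KaehlerDifferential.D K F X) ⊗ₜ[F] (Y⁻¹ • KaehlerDifferential.D K F X)) := by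
  rw [regularAt] at hη
  induction hη using AddSubgroup.closure_induction with
  | mem x hx =>
    obtain ⟨c, hc, a, ha, b, hb, rfl⟩ := hx
    refine ⟨c * (D b * D a), mul_mem hc (mul_mem (h.derivation_mem hD hK hX hO hb)
      (h.derivation_mem hD hK hX hO ha)), ?_⟩
    rw [hdD a, hdD b, TensorProduct.tmul_smul, mul_smul, mul_smul]
    rfl
  | zero => exact ⟨0, zero_mem _, by rw [zero_smul]⟩
  | add x y _ _ hx hy =>
    obtain ⟨f, hf, rfl⟩ := hx
    obtain ⟨f', hf', rfl⟩ := hy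
    exact ⟨f + f', add_mem hf hf', by rw [add_smul]⟩
  | neg x _ hx =>
    obtain ⟨f, hf, rfl⟩ := hx
    exact ⟨-f, neg_mem hf, by rw [neg_smul]⟩

end IsHyperellipticChart

end RegularForms

/-! ### The function field of the Wiman curve and its two charts -/

section WimanCharts

open Polynomial

variable {K : Type*} [Field K] {g : ℕ}

lemma aeval_wimanX (p : K[X]) :
    aeval (wimanX K g) p = AdjoinRoot.of (wimanPolynomial K g) (algebraMap K[X] (RatFunc K) p) := by
  have h : aeval (wimanX K g)
      = (IsScalarTower.toAlgHom K (RatFunc K) (WimanField K g)).comp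
        (IsScalarTower.toAlgHom K K[X] (RatFunc K)) := by
    ext
    simp only [aeval_X, AlgHom.comp_apply, IsScalarTower.toAlgHom_apply, RatFunc.algebraMap_X]
    rfl
  rw [h]
  rfl

lemma aeval_wimanX_injective : Function.Injective (aeval (wimanX K g) : K[X] →ₐ[K] _) := by
  intro p q h
  rw [aeval_wimanX, aeval_wimanX] at h
  exact RatFunc.algebraMap_injective K ((AdjoinRoot.of (wimanPolynomial K g)).injective h)

lemma wimanX_ne_zero : wimanX K g ≠ 0 := by
  intro h
  exact X_ne_zero (aeval_wimanX_injective (K := K) (g := g) (by rw [aeval_X, h, map_zero]))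

lemma wiman_exists_of_add_of_mul (f : WimanField K g) : ∃ a b : RatFunc K,
    f = AdjoinRoot.of (wimanPolynomial K g) a
      + AdjoinRoot.of (wimanPolynomial K g) b * wimanY K g := by
  obtain ⟨P, rfl⟩ := AdjoinRoot.mk_surjective f
  have hmonic : (wimanPolynomial K g).Monic := monic_X_pow_sub_C _ two_ne_zero
  have hdeg : (wimanPolynomial K g).natDegree = 2 := natDegree_X_pow_sub_C
  have h1 : AdjoinRoot.mk (wimanPolynomial K g) P
      = AdjoinRoot.mk (wimanPolynomial K g) (P %ₘ wimanPolynomial K g) := by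
    rw [AdjoinRoot.mk_eq_mk]
    exact ⟨P /ₘ wimanPolynomial K g, by
      linear_combination -modByMonic_add_div P (wimanPolynomial K g)⟩
  have h2 : (P %ₘ wimanPolynomial K g).natDegree ≤ 1 := by
    have := natDegree_modByMonic_lt P hmonic (fun h => by simp [h] at hdeg)
    omega
  refine ⟨(P %ₘ wimanPolynomial K g).coeff 0, (P %ₘ wimanPolynomial K g).coeff 1, ?_⟩
  rw [h1]
  conv_lhs => rw [eq_X_add_C_of_natDegree_le_one h2]
  simp only [map_add, map_mul, AdjoinRoot.mk_C, AdjoinRoot.mk_X]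
  rw [add_comm]
  rfl

lemma ratFunc_of_mul_denom (a : RatFunc K) : AdjoinRoot.of (wimanPolynomial K g) a
    * aeval (wimanX K g) a.denom = aeval (wimanX K g) a.num := by
  rw [aeval_wimanX, aeval_wimanX, ← map_mul]
  congr 1
  conv_lhs => rw [← RatFunc.num_div_denom a]
  rw [RatFunc.num_div_denom]
  have h := RatFunc.num_div_denom a
  have hd : algebraMap K[X] (RatFunc K) a.denom ≠ 0 := RatFunc.algebraMap_ne_zero a.denom_ne_zero
  rw [div_eq_iff hd] at h
  exact h.symm

lemma wiman_exists_rep (f : WimanField K g) : ∃ p q r : K[X], r ≠ 0 ∧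
    f * aeval (wimanX K g) r
      = aeval (wimanX K g) p + aeval (wimanX K g) q * wimanY K g := by
  obtain ⟨a, b, rfl⟩ := wiman_exists_of_add_of_mul f
  refine ⟨a.num * b.denom, b.num * a.denom, a.denom * b.denom,
    mul_ne_zero a.denom_ne_zero b.denom_ne_zero, ?_⟩
  simp only [map_mul]
  linear_combination aeval (wimanX K g) b.denom * ratFunc_of_mul_denom (g := g) a
    + aeval (wimanX K g) a.denom * wimanY K g * ratFunc_of_mul_denom (g := g) b

/-- Homomorphisms out of the function field of the Wiman curve. -/
lemma exists_wimanHom {L : Type*} [Field L] [Algebra K L] (u v : L)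
    (hu : Function.Injective (aeval u : K[X] →ₐ[K] L)) (h : v ^ 2 = u ^ (2 * g + 1) - 1) :
    ∃ ψ : WimanField K g →ₐ[K] L, ψ (wimanX K g) = u ∧ ψ (wimanY K g) = v := by
  have hle : nonZeroDivisors K[X] ≤ (nonZeroDivisors L).comap (aeval u : K[X] →ₐ[K] L) := by
    intro p hp
    rw [Submonoid.mem_comap, mem_nonZeroDivisors_iff_ne_zero]
    exact fun h0 => nonZeroDivisors.ne_zero hp (hu (by
      rw [map_zero]; exact h0))
  let i : RatFunc K →ₐ[K] L := RatFunc.liftAlgHom (aeval u) hle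
  have hi : ∀ p : K[X], i (algebraMap _ _ p) = aeval u p := fun p => by
    have := RatFunc.liftAlgHom_apply_div (aeval u) hle p 1
    simpa using this
  have h0 : (wimanPolynomial K g).eval₂ (i : RatFunc K →+* L) v = 0 := by
    rw [wimanPolynomial, eval₂_sub, eval₂_X_pow, eval₂_C]
    change v ^ 2 - i (algebraMap _ _ _) = 0
    rw [hi, h]
    simp
  refine ⟨AdjoinRoot.liftAlgHom _ i v h0, ?_, ?_⟩
  · rw [wimanX, AdjoinRoot.liftAlgHom_of, ← RatFunc.algebraMap_X, hi, aeval_X]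
  · exact AdjoinRoot.lift_root h0

lemma wimanHom_apply_aeval {L : Type*} [Field L] [Algebra K L] (ψ : WimanField K g →ₐ[K] L)
    (p : K[X]) : ψ (aeval (wimanX K g) p) = aeval (ψ (wimanX K g)) p := by
  rw [aeval_algHom_apply]

lemma wimanHom_ext {L : Type*} [Field L] [Algebra K L] {ψ ψ' : WimanField K g →ₐ[K] L}
    (hx : ψ (wimanX K g) = ψ' (wimanX K g)) (hy : ψ (wimanY K g) = ψ' (wimanY K g)) : ψ = ψ' := by
  refine AlgHom.ext fun f => ?_
  obtain ⟨p, q, r, hr, hrep⟩ := wiman_exists_rep f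
  have h1 := congrArg ψ hrep
  have h2 := congrArg ψ' hrep
  simp only [map_mul, map_add, wimanHom_apply_aeval, hx, hy] at h1 h2
  have h3 : aeval (ψ' (wimanX K g)) r ≠ 0 := by
    rw [← wimanHom_apply_aeval, _root_.map_ne_zero]
    exact fun h0 => hr (aeval_wimanX_injective (by rw [h0, map_zero]))
  exact mul_right_cancel₀ h3 (h1.trans h2.symm)

lemma wimanAut_ext {φ φ' : WimanAut K g}
    (hx : φ (wimanX K g) = φ' (wimanX K g)) (hy : φ (wimanY K g) = φ' (wimanY K g)) : φ = φ' := by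
  have : (φ : WimanField K g →ₐ[K] WimanField K g) = φ' := wimanHom_ext hx hy
  ext f
  exact AlgHom.congr_fun this f

lemma wimanHom_surjective {ψ : WimanField K g →ₐ[K] WimanField K g}
    (hx : wimanX K g ∈ ψ.fieldRange) (hy : wimanY K g ∈ ψ.fieldRange) :
    Function.Surjective ψ := by
  intro f
  obtain ⟨p, q, r, hr, hrep⟩ := wiman_exists_rep f
  have h3 : aeval (wimanX K g) r ≠ 0 := fun h0 =>
    hr (aeval_wimanX_injective (by rw [h0, map_zero]))
  have hp : ∀ p : K[X], aeval (wimanX K g) p ∈ ψ.fieldRange := fun p => by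
    induction p using Polynomial.induction_on' with
    | add p q hp hq => rw [map_add]; exact add_mem hp hq
    | monomial n c =>
      rw [aeval_monomial]; exact mul_mem (ψ.fieldRange.algebraMap_mem c) (pow_mem hx n)
  have : f ∈ ψ.fieldRange := by
    rw [eq_div_of_mul_eq h3 hrep]
    exact div_mem (add_mem (hp p) (mul_mem (hp q) hy)) (hp r)
  exact this

lemma wimanX_transcendental : Transcendental K (wimanX K g) :=
  transcendental_iff_injective.2 aeval_wimanX_injective

lemma wimanX_inv_transcendental : Transcendental K (wimanX K g)⁻¹ := fun h =>
  wimanX_transcendental (K := K) (g := g) (by simpa using h.inv)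

/-- The automorphisms `(x, y) ↦ (a x, b y)`. -/
lemma exists_wimanAut {a b : K} (ha : a ^ (2 * g + 1) = 1) (hb : b ^ 2 = 1) :
    ∃ φ : WimanAut K g, φ (wimanX K g) = a • wimanX K g ∧ φ (wimanY K g) = b • wimanY K g := by
  have ha0 : a ≠ 0 := by rintro rfl; simp at ha
  have hb0 : b ≠ 0 := by rintro rfl; simp at hb
  have hinj : Function.Injective (aeval (a • wimanX K g) : K[X] →ₐ[K] _) := by
    rw [← transcendental_iff_injective]
    intro h
    apply wimanX_transcendental (K := K) (g := g)
    have := h.smul a⁻¹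
    rwa [inv_smul_smul₀ ha0] at this
  obtain ⟨ψ, h1, h2⟩ := exists_wimanHom (g := g) (a • wimanX K g) (b • wimanY K g) hinj (by
    rw [_root_.smul_pow, _root_.smul_pow, ha, hb, one_smul, one_smul, wiman_equation])
  have hsurj : Function.Surjective ψ := wimanHom_surjective
    ⟨a⁻¹ • wimanX K g, by change ψ _ = _; rw [map_smul, h1, inv_smul_smul₀ ha0]⟩
    ⟨b⁻¹ • wimanY K g, by change ψ _ = _; rw [map_smul, h2, inv_smul_smul₀ hb0]⟩
  exact ⟨AlgEquiv.ofBijective ψ ⟨ψ.toRingHom.injective, hsurj⟩, h1, h2⟩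

variable (K g) in
lemma exists_wimanInvolution : ∃ τ : WimanAut K g,
    τ (wimanX K g) = wimanX K g ∧ τ (wimanY K g) = -wimanY K g := by
  obtain ⟨τ, h1, h2⟩ := exists_wimanAut (K := K) (g := g) (a := 1) (b := -1) (by simp) (by simp)
  exact ⟨τ, by simpa using h1, by simpa using h2⟩

section Charts

variable {τ : WimanAut K g} (hx : τ (wimanX K g) = wimanX K g)
  (hy : τ (wimanY K g) = -wimanY K g) (h2 : (2 : K) ≠ 0) (hn : ((2 * g + 1 : ℕ) : K) ≠ 0)
include hx hy h2 hn

/-- The affine chart of the Wiman curve. -/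
lemma wiman_affineChart :
    IsHyperellipticChart (wimanX K g) (wimanY K g) (X ^ (2 * g + 1) - 1) τ where
  equation := by rw [wiman_equation]; simp
  transcendental := aeval_wimanX_injective
  exists_rep := wiman_exists_rep
  map_X := hx
  map_Y := hy
  separable := by
    have := separable_X_pow_sub_C (n := 2 * g + 1) (1 : K) hn one_ne_zero
    rwa [C_1] at this
  two_ne_zero := h2

omit hx hy h2 hn in
lemma separable_X_sub_X_pow (n : ℕ) (hn : (n : K) ≠ 0) : (X - X ^ (n + 1) : K[X]).Separable := by
  obtain ⟨m, rfl⟩ : ∃ m, n = m + 1 := Nat.exists_eq_succ_of_ne_zero (by rintro rfl; simp at hn)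
  have hC : (C ((m + 1 : ℕ) : K) : K[X]) * C ((m + 1 : ℕ) : K)⁻¹ = 1 := by
    rw [← C_mul, mul_inv_cancel₀ hn, C_1]
  -- With n = m + 1, the power e = X^n is idempotent modulo X - X^(n+1), and the derivative 1 -
  -- (n+1)e has inverse 1 - ((n+1)/n)e there. The first Bézout coefficient absorbs e - e².
  refine ⟨C ((m + 1 : ℕ) : K)⁻¹ * (m + 2 : K[X]) ^ 2 * X ^ m,
    1 - C ((m + 1 : ℕ) : K)⁻¹ * (m + 2 : K[X]) * X ^ (m + 1), ?_⟩
  have hd : derivative (X - X ^ (m + 1 + 1) : K[X]) = 1 - (m + 2 : K[X]) * X ^ (m + 1) := by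
    rw [derivative_sub, derivative_X, derivative_X_pow]
    simp only [Nat.add_sub_cancel, map_natCast]
    push_cast
    ring
  rw [hd]
  rw [map_natCast] at hC
  push_cast at hC
  push_cast
  linear_combination (m + 2 : K[X]) * X ^ (m + 1) * hC

/-- The chart of the Wiman curve at infinity. -/
lemma wiman_chartAtInfinity :
    IsHyperellipticChart (wimanX K g)⁻¹ (wimanY K g / wimanX K g ^ (g + 1))
      (X - X ^ (2 * g + 1 + 1)) τ where
  equation := by
    have h0 := wimanX_ne_zero (K := K) (g := g)
    rw [div_pow, wiman_equation]
    simp only [map_sub, map_pow, aeval_X, inv_pow]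
    field_simp
    ring
  transcendental := transcendental_iff_injective.1 wimanX_inv_transcendental
  exists_rep f := by
    obtain ⟨p, q, r, hr, hrep⟩ := wiman_exists_rep f
    have h0 := wimanX_ne_zero (K := K) (g := g)
    let : Invertible (wimanX K g) := invertibleOfNonzero h0
    -- Reversing coefficients turns a polynomial in x into x^N times a polynomial in 1/x.
    have hrefl : ∀ (N : ℕ) (p : K[X]), p.natDegree ≤ N →
        aeval (wimanX K g) p = aeval (wimanX K g)⁻¹ (reflect N p) * wimanX K g ^ N := by
      intro N p hp
      have := eval₂_reflect_mul_pow (algebraMap K (WimanField K g)) (wimanX K g) N p hp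
      rw [invOf_eq_inv] at this
      exact this.symm
    obtain ⟨N, hN1, hN2, hN3⟩ : ∃ N, p.natDegree ≤ N ∧ q.natDegree ≤ N ∧ r.natDegree ≤ N :=
      ⟨p.natDegree + q.natDegree + r.natDegree, by omega, by omega, by omega⟩
    -- The factor z^(g+1) appears because z^(g+1) y = w.
    refine ⟨X ^ (g + 1) * reflect N p, reflect N q, X ^ (g + 1) * reflect N r,
      mul_ne_zero (pow_ne_zero _ X_ne_zero) (by rwa [Ne, reflect_eq_zero_iff]), ?_⟩
    rw [hrefl N p hN1, hrefl N q hN2, hrefl N r hN3] at hrep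
    simp only [map_mul, map_pow, aeval_X]
    have h3 : f * aeval (wimanX K g)⁻¹ (reflect N r) = aeval (wimanX K g)⁻¹ (reflect N p)
        + aeval (wimanX K g)⁻¹ (reflect N q) * wimanY K g := by
      apply mul_right_cancel₀ (pow_ne_zero N h0)
      linear_combination hrep
    rw [mul_left_comm, h3, inv_pow]
    generalize aeval (wimanX K g)⁻¹ (reflect N p) = P
    generalize aeval (wimanX K g)⁻¹ (reflect N q) = R
    field_simp
  map_X := by rw [map_inv₀, hx]
  map_Y := by rw [map_div₀, map_pow, hx, hy, neg_div]
  separable := separable_X_sub_X_pow _ hn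
  two_ne_zero := h2

end Charts

end WimanCharts

/-! ### Differentials of the function field -/

section WimanDifferentials

open Polynomial

variable {K : Type*} [Field K] {g : ℕ}

/-- As 2 ≠ 0, y is a root of a separable quadratic, and y generates the field over K(x).
Separability is what makes dx a generator of the differentials. -/
lemma wimanField_isSeparable (h2 : (2 : K) ≠ 0) :
    Algebra.IsSeparable (RatFunc K) (WimanField K g) := by
  have h2' : (2 : RatFunc K) ≠ 0 := by
    have := (map_ne_zero_iff _ (algebraMap K (RatFunc K)).injective).2 h2
    rwa [map_ofNat] at this
  have hQ : algebraMap K[X] (RatFunc K) (X ^ (2 * g + 1) - 1) ≠ 0 := by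
    refine RatFunc.algebraMap_ne_zero fun h => ?_
    have : (X ^ (2 * g + 1) - 1 : K[X]).natDegree = 2 * g + 1 := natDegree_X_pow_sub_C (r := 1)
    rw [h] at this
    simp at this
  have hsep : (wimanPolynomial K g).Separable :=
    separable_X_pow_sub_C (n := 2) _ (by exact_mod_cast h2') hQ
  have hroot : IsSeparable (RatFunc K) (wimanY K g) := by
    refine Separable.of_dvd hsep (minpoly.dvd _ _ ?_)
    have := AdjoinRoot.eval₂_root (wimanPolynomial K g)
    exact this
  refine ⟨fun f => ?_⟩
  obtain ⟨a, b, rfl⟩ := wiman_exists_of_add_of_mul f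
  have hab : ∀ a : RatFunc K, IsSeparable (RatFunc K) (AdjoinRoot.of (wimanPolynomial K g) a) :=
    fun a => isSeparable_algebraMap (K := WimanField K g) a
  exact Field.isSeparable_add (hab a) (Field.isSeparable_mul (hab b) hroot)

/-- The module of differentials of the Wiman curve is free with generator `dx`. -/
lemma exists_kaehlerEquiv (h2 : (2 : K) ≠ 0) :
    ∃ e : (Ω[WimanField K g⁄K]) ≃ₗ[WimanField K g] WimanField K g,
      e (KaehlerDifferential.D K _ (wimanX K g)) = 1 := by
  have := wimanField_isSeparable (g := g) h2
  have : FiniteDimensional (RatFunc K) (WimanField K g) :=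
    (AdjoinRoot.powerBasis (wimanPolynomial_irreducible K g).ne_zero).finite
  have h1 : Algebra.FormallyEtale K[X] (RatFunc K) :=
    Algebra.FormallyEtale.of_isLocalization (nonZeroDivisors K[X])
  have h3 : Algebra.FormallyEtale (RatFunc K) (WimanField K g) :=
    (Algebra.FormallyEtale.iff_isSeparable _ _).2 inferInstance
  -- A localization followed by a separable extension is formally étale over `K[X]`, so the
  -- differentials are the base change of the free module K[X] dX.
  have h4 : Algebra.FormallyEtale K[X] (WimanField K g) :=
    Algebra.FormallyEtale.comp K[X] (RatFunc K) (WimanField K g)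
  let e1 := KaehlerDifferential.tensorKaehlerEquivOfFormallyEtale K K[X] (WimanField K g)
  let e2 := TensorProduct.AlgebraTensorModule.congr
    (LinearEquiv.refl (WimanField K g) (WimanField K g)) (KaehlerDifferential.polynomialEquiv K)
  let e3 := TensorProduct.AlgebraTensorModule.rid K[X] (WimanField K g) (WimanField K g)
  refine ⟨e1.symm ≪≫ₗ e2 ≪≫ₗ e3, ?_⟩
  have hX : wimanX K g = algebraMap K[X] (WimanField K g) X := by
    rw [IsScalarTower.algebraMap_apply K[X] (RatFunc K) (WimanField K g), RatFunc.algebraMap_X]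
    rfl
  rw [hX]
  simp only [LinearEquiv.trans_apply, e1,
    KaehlerDifferential.tensorKaehlerEquivOfFormallyEtale_symm_D_algebraMap]
  simp [e2, e3]

/-- The derivation dual to `dx / y`. -/
lemma exists_wimanDerivation (h2 : (2 : K) ≠ 0) (hy : wimanY K g ≠ 0) :
    ∃ D : Derivation K (WimanField K g) (WimanField K g), D (wimanX K g) = wimanY K g ∧
      ∀ a, KaehlerDifferential.D K (WimanField K g) a
        = D a • (wimanY K g)⁻¹ • KaehlerDifferential.D K (WimanField K g) (wimanX K g) := by
  obtain ⟨e, he⟩ := exists_kaehlerEquiv (g := g) h2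
  refine ⟨wimanY K g • (e : _ →ₗ[WimanField K g] _).compDer (KaehlerDifferential.D K _), ?_, ?_⟩
  · simp [he]
  · intro a
    apply e.injective
    simp [he]
    field_simp

/-- Trivializes the quadratic differentials by (dx/y)², so that forms can be handled as functions.
-/
lemma exists_quadDiffEquiv (h2 : (2 : K) ≠ 0) (hy : wimanY K g ≠ 0) :
    ∃ e : QuadDiff K (WimanField K g) ≃ₗ[WimanField K g] WimanField K g,
      e (wimanSq K g) = 1 := by
  obtain ⟨e, he⟩ := exists_kaehlerEquiv (g := g) h2
  let e' := (TensorProduct.congr e e) ≪≫ₗ (TensorProduct.lid (WimanField K g) (WimanField K g))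
  have he' : e' (wimanSq K g) = (wimanY K g)⁻¹ * (wimanY K g)⁻¹ := by
    simp [e', wimanSq, he]
  refine ⟨e' ≪≫ₗ LinearEquiv.smulOfNeZero _ _ (wimanY K g ^ 2) (pow_ne_zero 2 hy), ?_⟩
  rw [LinearEquiv.trans_apply, he', LinearEquiv.smulOfNeZero_apply, smul_eq_mul]
  field_simp

end WimanDifferentials

/-! ### Determination of the bicanonical forms -/

section BicanonicalForms

open Polynomial

variable {K : Type*} [Field K] {g : ℕ}

lemma aeval_inv_reflect {F : Type*} [Field F] [Algebra K F] {x : F} (hx : x ≠ 0) {N : ℕ}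
    {p : K[X]} (hp : p.natDegree ≤ N) :
    aeval x⁻¹ (reflect N p) * x ^ N = aeval x p := by
  let : Invertible x := invertibleOfNonzero hx
  have := eval₂_reflect_mul_pow (algebraMap K F) x N p hp
  rwa [invOf_eq_inv] at this

/-- From dz = -dx/x² and w = y/x^(g+1) one gets dz/w = -x^(g-1) dx/y, and the sign disappears on
squaring. -/
lemma wimanSq_eq_chartAtInfinity (hg : 1 ≤ g) (hy0 : wimanY K g ≠ 0) (f : WimanField K g) :
    f • wimanSq K g = (f * (wimanX K g)⁻¹ ^ (2 * g - 2)) •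
      (((wimanY K g / wimanX K g ^ (g + 1))⁻¹ • KaehlerDifferential.D K _ (wimanX K g)⁻¹)
        ⊗ₜ[WimanField K g] ((wimanY K g / wimanX K g ^ (g + 1))⁻¹ •
          KaehlerDifferential.D K _ (wimanX K g)⁻¹)) := by
  have hx0 := wimanX_ne_zero (K := K) (g := g)
  obtain ⟨m, rfl⟩ : ∃ m, g = m + 1 := ⟨g - 1, by omega⟩
  have h1 : (wimanY K (m + 1) / wimanX K (m + 1) ^ (m + 1 + 1))⁻¹ •
      KaehlerDifferential.D K _ (wimanX K (m + 1))⁻¹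
      = (-wimanX K (m + 1) ^ m) • (wimanY K (m + 1))⁻¹ •
        KaehlerDifferential.D K _ (wimanX K (m + 1)) := by
    rw [Derivation.leibniz_inv, smul_smul, smul_smul]
    congr 1
    field_simp
    ring
  rw [h1, ← TensorProduct.smul_tmul', TensorProduct.tmul_smul, smul_smul, smul_smul, wimanSq]
  congr 1
  have h2 : 2 * (m + 1) - 2 = m + m := by omega
  rw [h2, inv_pow, pow_add]
  field_simp

lemma mem_degreeLT_of_X_pow_mul_eq {m k l N : ℕ} {s t : K[X]} (h : X ^ m * s = X ^ k * t)
    (ht : t.natDegree ≤ N) (hkl : k + N < m + l) : s ∈ degreeLT K l := by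
  rw [mem_degreeLT]
  rcases eq_or_ne s 0 with rfl | hs
  · simp
  have ht0 : t ≠ 0 := by
    rintro rfl
    rw [mul_zero] at h
    exact mul_ne_zero (pow_ne_zero m X_ne_zero) hs h
  have h1 := congrArg natDegree h
  rw [natDegree_X_pow_mul _ hs, natDegree_X_pow_mul _ ht0] at h1
  rw [← natDegree_lt_iff_degree_lt hs]
  omega

/-- The bicanonical forms of the Wiman curve. -/
theorem smul_wimanSq_mem_bicanonicalForms_iff [IsAlgClosed K] (hg : 1 ≤ g) (h2 : (2 : K) ≠ 0)
    (hn : ((2 * g + 1 : ℕ) : K) ≠ 0) (f : WimanField K g) :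
    f • wimanSq K g ∈ bicanonicalForms K (WimanField K g) ↔
      ∃ p ∈ degreeLT K (2 * g - 1), ∃ q ∈ degreeLT K (g - 2),
        f = aeval (wimanX K g) p + aeval (wimanX K g) q * wimanY K g := by
  obtain ⟨τ, hτx, hτy⟩ := exists_wimanInvolution K g
  have hA := wiman_affineChart hτx hτy h2 hn
  have hI := wiman_chartAtInfinity hτx hτy h2 hn
  have hy0 : wimanY K g ≠ 0 := hA.Y_ne_zero
  have hx0 := wimanX_ne_zero (K := K) (g := g)
  constructor
  · intro hf
    obtain ⟨e, he⟩ := exists_quadDiffEquiv (g := g) h2 hy0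
    obtain ⟨D, hDx, hdD⟩ := exists_wimanDerivation (g := g) h2 hy0
    have hcancel : ∀ a b : WimanField K g, a • wimanSq K g = b • wimanSq K g → a = b :=
      fun a b hab => by simpa [he] using congrArg e hab
    -- regularity on the affine part
    obtain ⟨p, q, hpq⟩ := hA.exists_rep_of_forall_mem (f := f) (fun O hK hX => by
      -- The integrality criterion also ranges over the trivial valuation ring, which is not a point
      -- of the curve; membership in it is automatic.
      by_cases hO : O = ⊤
      · rw [hO]; trivial
      obtain ⟨f', hf', hff'⟩ := hA.exists_eq_smul_of_mem_regularAt hDx hdD hK hX hO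
        (hf ⟨O, hK, hO⟩)
      rwa [hcancel f f' hff'])
    -- regularity at infinity
    obtain ⟨P, R, hPR⟩ := hI.exists_rep_of_forall_mem
      (f := f * (wimanX K g)⁻¹ ^ (2 * g - 2)) (fun O hK hX => by
      by_cases hO : O = ⊤
      · rw [hO]; trivial
      -- The derivation dual to dz/w = -x^(g-1) dx/y is -z^(g-1) times the one dual to dx/y.
      let D' : Derivation K (WimanField K g) (WimanField K g) :=
        (-(wimanX K g)⁻¹ ^ (g - 1)) • D
      have hpow : wimanX K g ^ (g + 1) = wimanX K g ^ (g - 1) * wimanX K g ^ 2 := by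
        rw [← pow_add]; congr 1; omega
      have hD' : D' (wimanX K g)⁻¹ = wimanY K g / wimanX K g ^ (g + 1) := by
        simp only [D', Derivation.smul_apply, Derivation.leibniz_inv, hDx, smul_eq_mul, hpow,
          inv_pow]
        field_simp
      have hdD' : ∀ a, KaehlerDifferential.D K (WimanField K g) a
          = D' a • (wimanY K g / wimanX K g ^ (g + 1))⁻¹ •
            KaehlerDifferential.D K (WimanField K g) (wimanX K g)⁻¹ := by
        intro a
        rw [hdD a, Derivation.leibniz_inv]
        simp only [D', Derivation.smul_apply, smul_smul, smul_eq_mul, hpow, inv_pow]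
        congr 1
        field_simp
      have hf' := hf ⟨O, hK, hO⟩
      rw [wimanSq_eq_chartAtInfinity hg hy0] at hf'
      obtain ⟨f', hf'O, hff'⟩ := hI.exists_eq_smul_of_mem_regularAt hD' hdD' hK hX hO hf'
      have h1 : f' = (f' * wimanX K g ^ (2 * g - 2)) * (wimanX K g)⁻¹ ^ (2 * g - 2) := by
        rw [inv_pow]; field_simp
      rw [h1, ← wimanSq_eq_chartAtInfinity hg hy0, ← wimanSq_eq_chartAtInfinity hg hy0] at hff'
      rwa [hcancel _ _ hff', ← h1])
    obtain ⟨N, hP, hR⟩ : ∃ N, P.natDegree ≤ N ∧ R.natDegree ≤ N :=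
      ⟨P.natDegree + R.natDegree, by omega, by omega⟩
    have hP' := aeval_inv_reflect hx0 (N := N) (p := reflect N P) ((natDegree_reflect_le).trans
      (by simpa using hP))
    have hR' := aeval_inv_reflect hx0 (N := N) (p := reflect N R) ((natDegree_reflect_le).trans
      (by simpa using hR))
    rw [reflect_reflect] at hP' hR'
    -- Regularity at infinity gives f = P(z) x^(2g-2) + R(z) x^(g-3) y. Multiplying by x³ keeps the
    -- second exponent from being negative when g < 3, and x^N clears the powers of z. Comparison
    -- with p + qy yields deg p ≤ 2g-2 and deg q ≤ g-3, with q = 0 when g < 3.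
    have huniq := hA.rep_unique (p := X ^ (N + 3) * p - X ^ (2 * g + 1) * reflect N P)
      (q := X ^ (N + 3) * q - X ^ g * reflect N R) (by
        have h3 : f = (aeval (wimanX K g)⁻¹ P + aeval (wimanX K g)⁻¹ R *
            (wimanY K g / wimanX K g ^ (g + 1))) * wimanX K g ^ (2 * g - 2) := by
          rw [← hPR, inv_pow]; field_simp
        have h4 : f * wimanX K g ^ 3 = aeval (wimanX K g)⁻¹ P * wimanX K g ^ (2 * g + 1)
            + aeval (wimanX K g)⁻¹ R * wimanX K g ^ g * wimanY K g := by
          have h5 : wimanX K g ^ (2 * g - 2) * wimanX K g ^ 3 = wimanX K g ^ (2 * g + 1) := by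
            rw [← pow_add]; congr 1; omega
          have h6 : wimanX K g ^ (2 * g + 1) = wimanX K g ^ g * wimanX K g ^ (g + 1) := by
            rw [← pow_add]; congr 1; omega
          rw [h3, mul_assoc, h5, h6]
          field_simp
        simp only [map_sub, map_mul, map_pow, aeval_X]
        rw [← hP', ← hR']
        rw [hpq] at h4
        rw [pow_add]
        linear_combination wimanX K g ^ N * h4)
    have hrefl : ∀ t : K[X], t.natDegree ≤ N → (reflect N t).natDegree ≤ N := fun t ht =>
      natDegree_reflect_le.trans (by simpa using ht)
    exact ⟨p, mem_degreeLT_of_X_pow_mul_eq (sub_eq_zero.1 huniq.1) (hrefl P hP) (by omega),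
      q, mem_degreeLT_of_X_pow_mul_eq (sub_eq_zero.1 huniq.2) (hrefl R hR) (by omega), hpq⟩
  · rintro ⟨p, hp, q, hq, rfl⟩ P
    -- A valuation ring contains x or 1/x, so every point lies on one of the two charts.
    rcases P.localRing.mem_or_inv_mem (wimanX K g) with hX | hX
    · refine hA.smul_mem_regularAt P.algebraMap_mem hX ?_
      exact add_mem (aeval_mem_valuationSubring P.algebraMap_mem hX p)
        (mul_mem (aeval_mem_valuationSubring P.algebraMap_mem hX q)
          (hA.Y_mem P.algebraMap_mem hX))
    · rw [wimanSq_eq_chartAtInfinity hg hy0]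
      refine hI.smul_mem_regularAt P.algebraMap_mem hX ?_
      have hw := hI.Y_mem P.algebraMap_mem hX
      rw [mem_degreeLT] at hp hq
      rw [add_mul]
      refine add_mem ?_ ?_
      · have hp' : p.natDegree ≤ 2 * g - 2 := by
          rcases eq_or_ne p 0 with rfl | hp0
          · simp
          · have := (natDegree_lt_iff_degree_lt hp0).2 hp
            omega
        rw [← aeval_inv_reflect hx0 hp', inv_pow, mul_assoc, mul_inv_cancel₀ (pow_ne_zero _ hx0),
          mul_one]
        exact aeval_mem_valuationSubring P.algebraMap_mem hX _
      · rcases eq_or_ne q 0 with rfl | hq0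
        · simp
        · have hq1 := (natDegree_lt_iff_degree_lt hq0).2 hq
          have hq' : q.natDegree ≤ g - 3 := by omega
          have h5 : wimanX K g ^ (2 * g - 2) = wimanX K g ^ (g - 3) * wimanX K g ^ (g + 1) := by
            rw [← pow_add]; congr 1; omega
          have h6 : aeval (wimanX K g) q * wimanY K g * (wimanX K g)⁻¹ ^ (2 * g - 2)
              = aeval (wimanX K g)⁻¹ (reflect (g - 3) q)
                * (wimanY K g / wimanX K g ^ (g + 1)) := by
            rw [← aeval_inv_reflect hx0 hq', inv_pow, h5]
            field_simp
          rw [h6]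
          exact mul_mem (aeval_mem_valuationSubring P.algebraMap_mem hX _) hw

/-- The standard basis of the space of bicanonical forms. -/
theorem exists_bicanonicalBasis [IsAlgClosed K] (hg : 1 ≤ g) (h2 : (2 : K) ≠ 0)
    (hn : ((2 * g + 1 : ℕ) : K) ≠ 0) :
    ∃ B : Module.Basis (Fin (2 * g - 1) ⊕ Fin (g - 2)) K (bicanonicalForms K (WimanField K g)),
      ∀ j, (B j : QuadDiff K (WimanField K g)) = standardFunction K g j • wimanSq K g := by
  obtain ⟨τ, hτx, hτy⟩ := exists_wimanInvolution K g
  have hA := wiman_affineChart hτx hτy h2 hn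
  have hy0 : wimanY K g ≠ 0 := hA.Y_ne_zero
  obtain ⟨e, he⟩ := exists_quadDiffEquiv (g := g) h2 hy0
  let f : (degreeLT K (2 * g - 1) × degreeLT K (g - 2)) →ₗ[K] WimanField K g :=
    LinearMap.coprod ((aeval (wimanX K g)).toLinearMap ∘ₗ (degreeLT K (2 * g - 1)).subtype)
      (LinearMap.mulRight K (wimanY K g) ∘ₗ (aeval (wimanX K g)).toLinearMap ∘ₗ
        (degreeLT K (g - 2)).subtype)
  have hf : ∀ p, f p = aeval (wimanX K g) (p.1 : K[X]) + aeval (wimanX K g) (p.2 : K[X])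
      * wimanY K g := fun p => rfl
  let F : (degreeLT K (2 * g - 1) × degreeLT K (g - 2)) →ₗ[K] bicanonicalForms K (WimanField K g) :=
    LinearMap.codRestrict _ ((LinearMap.toSpanSingleton (WimanField K g) _
      (wimanSq K g)).restrictScalars K ∘ₗ f) (fun p => by
        exact (smul_wimanSq_mem_bicanonicalForms_iff hg h2 hn _).2
          ⟨p.1, p.1.2, p.2, p.2.2, hf p⟩)
  have hF : ∀ p, (F p : QuadDiff K (WimanField K g)) = f p • wimanSq K g := fun p => rfl
  have hinj : Function.Injective F := by
    rw [injective_iff_map_eq_zero]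
    intro p hp
    have h1 := congrArg (fun v : bicanonicalForms K (WimanField K g) => e v) hp
    simp only [hF, map_smul, he, ZeroMemClass.coe_zero, map_zero, smul_eq_mul, mul_one, hf] at h1
    obtain ⟨h3, h4⟩ := hA.rep_unique h1
    exact Prod.ext (Subtype.ext h3) (Subtype.ext h4)
  have hsurj : Function.Surjective F := by
    rintro ⟨η, hη⟩
    have h1 : η = e η • wimanSq K g := by
      apply e.injective; rw [map_smul, he, smul_eq_mul, mul_one]
    have hη' := hη
    rw [h1, smul_wimanSq_mem_bicanonicalForms_iff hg h2 hn] at hη'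
    obtain ⟨p, hp, q, hq, hpq⟩ := hη'
    refine ⟨(⟨p, hp⟩, ⟨q, hq⟩), Subtype.ext ?_⟩
    rw [hF, hf]
    change _ = η
    rw [h1, hpq]
  have hbij : Function.Bijective F := ⟨hinj, hsurj⟩
  refine ⟨((degreeLT.basis K _).prod (degreeLT.basis K _)).map
    (LinearEquiv.ofBijective F hbij), ?_⟩
  rintro (i | i)
  · rw [Module.Basis.map_apply, LinearEquiv.ofBijective_apply, hF, hf]
    simp [standardFunction]
  · rw [Module.Basis.map_apply, LinearEquiv.ofBijective_apply, hF, hf]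
    simp [standardFunction, mul_comm]

end BicanonicalForms

/-! ### Möbius transformations preserving the branch points -/

section MoebiusPolynomials

open Polynomial

variable {K : Type*} [Field K]

/-- Put N = 2g+1 in K. Comparing k = 1 with k = 2g gives b^(2g) = b + 2; then k = 2g+1 gives (b+1)²
= l = N(b+1), so b + 1 = N. Now k = 2 gives (N-1)(N-2) = 2, so N = 3 in K. Finally 24 times the
fourth binomial coefficient contains the factor 2g - 2 = N - 3 = 0, so 24l = 0, whereas 24 = 8N is
nonzero. The index k = 4 requires g ≥ 2. -/
lemma false_of_choose_mul_eq {g : ℕ} (hg : 2 ≤ g) (h2 : (2 : K) ≠ 0)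
    (hn : ((2 * g + 1 : ℕ) : K) ≠ 0) {b l : K} (hl : l ≠ 0)
    (h : ∀ k, 1 ≤ k → k ≤ 2 * g + 1 →
      ((2 * g + 1).choose k : K) * (b ^ k - (-1) ^ k) = l) : False := by
  have k1 := h 1 le_rfl (by omega)
  have k2 := h 2 (by omega) (by omega)
  have k4 := h 4 (by omega) (by omega)
  have kn1 := h (2 * g) (by omega) (by omega)
  have kn := h (2 * g + 1) (by omega) le_rfl
  have c2 : (2 : K) * ((2 * g + 1).choose 2 : K) = ((2 * g + 1 : ℕ) : K) * (2 * g + 1 - 1 : ℕ) := by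
    have := Nat.descFactorial_eq_factorial_mul_choose (2 * g + 1) 2
    have h' : (2 * g + 1) * (2 * g + 1 - 1) = 2 * (2 * g + 1).choose 2 := by
      simpa [Nat.descFactorial, Nat.factorial, mul_comm] using this
    have h3 := congrArg (fun m : ℕ => (m : K)) h'.symm
    simpa only [Nat.cast_mul, Nat.cast_ofNat] using h3
  have c4 : (24 : K) * ((2 * g + 1).choose 4 : K)
      = ((2 * g + 1 : ℕ) : K) * (2 * g : ℕ) * (2 * g - 1 : ℕ) * (2 * g - 2 : ℕ) := by
    have := Nat.descFactorial_eq_factorial_mul_choose (2 * g + 1) 4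
    have h' : (2 * g + 1) * (2 * g) * (2 * g - 1) * (2 * g - 2) = 24 * (2 * g + 1).choose 4 := by
      have h24 : Nat.factorial 4 = 24 := rfl
      rw [← h24, ← this]
      simp only [Nat.descFactorial]
      have e1 : 2 * g + 1 - 3 = 2 * g - 2 := by omega
      have e2 : 2 * g + 1 - 2 = 2 * g - 1 := by omega
      have e3 : 2 * g + 1 - 1 = 2 * g := by omega
      rw [e1, e2, e3]
      simp only [Nat.sub_zero]
      ring
    have h3 := congrArg (fun m : ℕ => (m : K)) h'.symm
    simpa only [Nat.cast_mul, Nat.cast_ofNat] using h3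
  have hn' : ((2 * g + 1).choose (2 * g) : K) = ((2 * g + 1 : ℕ) : K) := by
    rw [Nat.choose_succ_self_right]
  rw [Nat.choose_one_right] at k1
  rw [hn'] at kn1
  rw [Nat.choose_self] at kn
  have e1 : ((2 * g + 1 - 1 : ℕ) : K) = ((2 * g + 1 : ℕ) : K) - 1 := by
    rw [Nat.cast_sub (by omega)]; simp
  have e2 : ((2 * g - 2 : ℕ) : K) = ((2 * g + 1 : ℕ) : K) - 3 := by
    rw [Nat.cast_sub (by omega)]; push_cast; ring
  rw [e1] at c2
  rw [e2] at c4
  rw [pow_mul (-1 : K) 2 g] at kn1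
  rw [pow_succ (-1 : K), pow_mul (-1 : K) 2 g, pow_succ b] at kn
  simp only [Nat.cast_one, even_two, Even.neg_pow, one_pow, one_mul, pow_one] at k1 k2 kn1 kn
  generalize ((2 * g + 1 : ℕ) : K) = N at *
  have hb : b + 1 ≠ 0 := by
    intro h0
    apply hl
    rw [← k1]
    linear_combination N * h0
  have f1 : b ^ (2 * g) = b + 2 := by
    apply mul_left_cancel₀ hn
    linear_combination kn1 - k1
  rw [f1] at kn
  have f2 : b + 1 = N := by
    apply mul_right_cancel₀ hb
    linear_combination kn - k1
  have f3 : N = 3 := by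
    have : N * (b + 1) * (N - 3) * N = 0 := by
      have hb' : b = N - 1 := by linear_combination f2
      rw [hb'] at k1 k2 ⊢
      linear_combination 2 * k2 - 2 * k1 - ((N - 1) ^ 2 - 1) * c2
    rcases mul_eq_zero.1 this with h' | h'
    · rcases mul_eq_zero.1 h' with h'' | h''
      · exact absurd h'' (mul_ne_zero hn hb)
      · linear_combination h''
    · exact absurd h' hn
  rw [f3] at c4
  have f4 : (24 : K) * l = 0 := by
    rw [← k4]
    linear_combination (b ^ 4 - (-1) ^ 4) * c4
  have f5 : (24 : K) ≠ 0 := by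
    have : (24 : K) = 2 * 2 * 2 * N := by rw [f3]; norm_num
    rw [this]
    exact mul_ne_zero (mul_ne_zero (mul_ne_zero h2 h2) h2) hn
  exact mul_ne_zero f5 hl f4

/-- This is the case where infinity is moved. Evaluating at δ shows δ^(2g+1) = 1, so X - δ can be
divided out, leaving a geometric sum on the right. Its coefficients, rescaled by powers of δ, are
the relations of `false_of_choose_mul_eq`. -/
lemma false_of_moebius {g : ℕ} (hg : 2 ≤ g) (h2 : (2 : K) ≠ 0)
    (hn : ((2 * g + 1 : ℕ) : K) ≠ 0) {b δ l : K} (hl : l ≠ 0)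
    (h : (X - C δ) * ((X + C b) ^ (2 * g + 1) - (X - C δ) ^ (2 * g + 1))
      = C l * (X ^ (2 * g + 1) - 1)) : False := by
  have hδ : δ ^ (2 * g + 1) = 1 := by
    have := congrArg (eval δ) h
    simp only [eval_mul, eval_sub, eval_X, eval_C, sub_self, zero_mul, eval_pow, eval_one] at this
    have := (mul_eq_zero.1 this.symm).resolve_left hl
    linear_combination this
  have hδ0 : δ ≠ 0 := by rintro rfl; simp at hδ
  have h1 : (X + C b) ^ (2 * g + 1) - (X - C δ) ^ (2 * g + 1)
      = C l * ∑ i ∈ Finset.range (2 * g + 1), X ^ i * (C δ) ^ (2 * g + 1 - 1 - i) := by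
    apply mul_left_cancel₀ (X_sub_C_ne_zero δ)
    rw [h, mul_left_comm, mul_comm (X - C δ), geom_sum₂_mul, ← C_pow, hδ, C_1]
  have hcoeff : ∀ k, 1 ≤ k → k ≤ 2 * g + 1 →
      ((2 * g + 1).choose k : K) * (b ^ k - (-δ) ^ k) = l * δ ^ (k - 1) := by
    intro k hk1 hk2
    have h3 := congrArg (fun p => coeff p (2 * g + 1 - k)) h1
    have h4 : ∀ i, (X ^ i * C δ ^ (2 * g + 1 - 1 - i) : K[X]).coeff (2 * g + 1 - k)
        = if i = 2 * g + 1 - k then δ ^ (2 * g + 1 - 1 - i) else 0 := by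
      intro i
      rw [← C_pow, coeff_mul_C, coeff_X_pow]
      simp only [eq_comm]
      split_ifs <;> simp
    simp only [coeff_sub, coeff_C_mul, finsetSum_coeff, h4, Finset.sum_ite_eq',
      Finset.mem_range] at h3
    rw [if_pos (by omega), sub_eq_add_neg X, ← C_neg, coeff_X_add_C_pow, coeff_X_add_C_pow,
      Nat.choose_symm hk2] at h3
    have e1 : 2 * g + 1 - (2 * g + 1 - k) = k := by omega
    have e2 : 2 * g + 1 - 1 - (2 * g + 1 - k) = k - 1 := by omega
    rw [e1, e2] at h3
    linear_combination h3
  refine false_of_choose_mul_eq hg h2 hn (b := b / δ) (l := l / δ) (div_ne_zero hl hδ0) ?_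
  intro k hk1 hk2
  have h5 := hcoeff k hk1 hk2
  obtain ⟨m, rfl⟩ : ∃ m, k = m + 1 := ⟨k - 1, by omega⟩
  rw [Nat.add_sub_cancel] at h5
  rw [neg_pow] at h5
  apply mul_right_cancel₀ (pow_ne_zero (m + 1) hδ0)
  have h6 : (b / δ) ^ (m + 1) * δ ^ (m + 1) = b ^ (m + 1) := by
    rw [← mul_pow, div_mul_cancel₀ _ hδ0]
  have h7 : l / δ * δ ^ (m + 1) = l * δ ^ m := by
    rw [pow_succ]; field_simp
  rw [h7]
  linear_combination h5 + ((2 * g + 1).choose (m + 1) : K) * h6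

/-- A Möbius transformation that permutes the branch points of the Wiman curve is a rotation. -/
lemma moebius_eq_rotation {g : ℕ} (hg : 2 ≤ g) (h2 : (2 : K) ≠ 0)
    (hn : ((2 * g + 1 : ℕ) : K) ≠ 0) {a b c d l : K} (hl : l ≠ 0)
    (h : (C c * X + C d) * ((C a * X + C b) ^ (2 * g + 1) - (C c * X + C d) ^ (2 * g + 1))
      = C l * (X ^ (2 * g + 1) - 1)) :
    c = 0 ∧ b = 0 ∧ d ≠ 0 ∧ a ^ (2 * g + 1) = d ^ (2 * g + 1) ∧ l = d ^ (2 * g + 2) := by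
  by_cases hc : c = 0
  · subst hc
    simp only [C_0, zero_mul, zero_add] at h
    have hd : d ≠ 0 := by
      rintro rfl
      simp only [C_0, zero_mul] at h
      have := congrArg (eval 0) h
      simp at this
      exact hl this
    have ha : a ≠ 0 := by
      rintro rfl
      simp only [C_0, zero_mul, zero_add, ← C_pow, ← C_sub, ← C_mul] at h
      have : coeff _ (2 * g + 1) = coeff _ (2 * g + 1) := congrArg (fun p => coeff p (2 * g + 1)) h
      rw [coeff_C_of_ne_zero (by omega)] at this
      simp [coeff_one] at this
      exact hl this.symm
    have hP : C a * X + C b = C a * (X + C (b / a)) := by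
      rw [mul_add, ← C_mul, mul_div_cancel₀ _ ha]
    rw [hP, mul_pow, ← C_pow, ← C_pow] at h
    have hco : ∀ k, 1 ≤ k → d * (a ^ (2 * g + 1) * ((b / a) ^ (2 * g + 1 - k) *
        ((2 * g + 1).choose k : K))) = l * (if k = 2 * g + 1 then 1 else 0) := by
      intro k hk
      have := congrArg (fun p => coeff p k) h
      have hk0 : k ≠ 0 := by omega
      simpa only [coeff_C_mul, coeff_sub, coeff_X_add_C_pow, coeff_C, if_neg hk0, sub_zero,
        coeff_X_pow, coeff_one, if_neg hk0.symm] using this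
    -- For c = 0 the right side has no term of degree 2g, so (2g+1) a^(2g) b d = 0 and b vanishes;
    -- the leading and constant terms give the other relations.
    have hn1 := hco (2 * g) (by omega)
    have hn0 := hco (2 * g + 1) (by omega)
    rw [if_neg (by omega), Nat.choose_succ_self_right] at hn1
    rw [if_pos rfl] at hn0
    simp only [Nat.sub_self, pow_zero, Nat.choose_self, Nat.cast_one, mul_one] at hn0
    have e : 2 * g + 1 - 2 * g = 1 := by omega
    rw [e, pow_one, mul_zero] at hn1
    have hb : b = 0 := by
      have h6 : d * (a ^ (2 * g + 1)) ≠ 0 := mul_ne_zero hd (pow_ne_zero _ ha)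
      have h7 : (d * (a ^ (2 * g + 1))) * ((b / a) * ((2 * g + 1 : ℕ) : K)) = 0 := by
        rw [← hn1]; ring
      have h8 := (mul_eq_zero.1 ((mul_eq_zero.1 h7).resolve_left h6)).resolve_right hn
      simpa [ha] using h8
    have h0 := congrArg (eval 0) h
    rw [hb] at h0
    simp at h0
    refine ⟨rfl, hb, hd, ?_, ?_⟩
    · apply mul_left_cancel₀ hd
      rw [hn0]
      linear_combination -h0
    · rw [pow_succ]; linear_combination -h0
  · exfalso
    have hlin : ∀ a b : K, (C a * X + C b).natDegree ≤ 1 := fun a b => natDegree_linear_le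
    have hpow : ∀ a b : K, ((C a * X + C b) ^ (2 * g + 1)).coeff ((2 * g + 1) * 1)
        = a ^ (2 * g + 1) := fun a b => by
      rw [coeff_pow_of_natDegree_le (hlin a b)]; simp
    have hdeg : ∀ a b : K, ((C a * X + C b) ^ (2 * g + 1)).natDegree ≤ (2 * g + 1) * 1 :=
      fun a b => natDegree_pow_le_of_le _ (hlin a b)
    -- The right side has no term of degree 2g+2, so a^(2g+1) = c^(2g+1); both linear forms can then
    -- be made monic with one common factor.
    have htop := congrArg (fun p => coeff p (1 + (2 * g + 1) * 1)) h
    simp only [coeff_mul_add_eq_of_natDegree_le (hlin c d)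
      ((natDegree_sub_le_of_le (hdeg a b) (hdeg c d)).trans (max_self _).le), coeff_sub, hpow] at htop
    have hac : a ^ (2 * g + 1) = c ^ (2 * g + 1) := by
      have h1 : 1 + (2 * g + 1) ≠ 2 * g + 1 := by omega
      have h2 : 1 + (2 * g + 1) ≠ 0 := by omega
      simp only [coeff_C_mul, coeff_sub, coeff_X_pow, coeff_one, if_neg h1, if_neg h2,
        sub_zero, mul_zero, coeff_add, coeff_X_one, mul_one,
        coeff_C_of_ne_zero one_ne_zero, add_zero] at htop
      exact sub_eq_zero.1 ((mul_eq_zero.1 htop).resolve_left hc)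
    have ha : a ≠ 0 := by
      rintro rfl
      rw [zero_pow (by omega)] at hac
      exact pow_ne_zero _ hc hac.symm
    have hP : C a * X + C b = C a * (X + C (b / a)) := by
      rw [mul_add, ← C_mul, mul_div_cancel₀ _ ha]
    have hR : C c * X + C d = C c * (X - C (-(d / c))) := by
      rw [mul_sub, ← C_mul, mul_neg, mul_div_cancel₀ _ hc, C_neg, sub_neg_eq_add]
    rw [hP, hR, mul_pow, mul_pow, ← C_pow, ← C_pow, hac] at h
    refine false_of_moebius hg h2 hn (b := b / a) (δ := -(d / c)) (l := l / (c * c ^ (2 * g + 1)))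
      (div_ne_zero hl (mul_ne_zero hc (pow_ne_zero _ hc))) ?_
    have hC : (C (c * c ^ (2 * g + 1)) : K[X]) ≠ 0 :=
      C_ne_zero.2 (mul_ne_zero hc (pow_ne_zero _ hc))
    apply mul_left_cancel₀ hC
    rw [← mul_assoc _ (C (l / _)), ← C_mul, mul_div_cancel₀ _ (C_ne_zero.1 hC), ← h, C_mul]
    ring

end MoebiusPolynomials

/-! ### The point at infinity and the automorphisms of the curve -/

section WimanAutomorphisms

open Polynomial

variable {K : Type*} [Field K] {g : ℕ}

section PointAtInfinity

lemma isBranchPointAtInfinity_iff {P : CurvePoint K (WimanField K g)} :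
    IsBranchPointAtInfinity P ↔ IsCenteredAt P.localRing (wimanX K g)⁻¹
      (wimanY K g / wimanX K g ^ (g + 1)) (0 : K) (0 : K) :=
  ⟨fun h => ⟨P.algebraMap_mem, by simpa using h.1, by simpa using h.2⟩,
    fun h => ⟨by simpa using h.X_lt, by simpa using h.Y_lt⟩⟩

/-- Elements of `O` are fractions of functions on the model whose denominators do not vanish at the
centre, and such fractions lie in every place with that centre. By symmetry, a place is determined
by its centre. -/
lemma IsHyperellipticChart.le_of_isCenteredAt {F : Type*} [Field F] [Algebra K F] {X Y : F}
    {Q : K[X]} {τ : F ≃ₐ[K] F} (h : IsHyperellipticChart X Y Q τ) {α β : K}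
    (hβ : β ^ 2 = Q.eval α) {O O' : ValuationSubring F} (hO : IsCenteredAt O X Y α β)
    (hO' : IsCenteredAt O' X Y α β) : O ≤ O' := by
  intro f hf
  obtain ⟨p, q, p₁, q₁, h1, h2⟩ := h.exists_local_rep hβ hO hf
  have h3 := hO'.rep_mem p q
  rw [← h2, ← O'.valuation_le_one_iff, map_mul, (hO'.valuation_rep_eq_one_iff p₁ q₁).2 h1,
    mul_one, O'.valuation_le_one_iff] at h3
  exact h3

/-- A smooth affine model `w² = z Q(z)` has a place over the origin. -/
lemma IsHyperellipticChart.exists_isCenteredAt_zero {F : Type*} [Field F] [Algebra K F] {z w : F}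
    {Q : K[X]} {τ : F ≃ₐ[K] F} (h : IsHyperellipticChart z w (X * Q) τ) :
    ∃ O : ValuationSubring F, O ≠ ⊤ ∧ IsCenteredAt O z w (0 : K) (0 : K) := by
  have hz0 : z ≠ 0 := by
    have := h.aeval_ne_zero X_ne_zero
    rwa [aeval_X] at this
  obtain ⟨O, hK, hz, hx⟩ : ∃ O : ValuationSubring F,
      (∀ c, algebraMap K _ c ∈ O) ∧ z ∈ O ∧ z⁻¹ ∉ O := by
    -- Otherwise 1/z lies in every valuation ring over K[z], hence equals p(z) + q(z)w. Then zp(z) =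
    -- 1, which is absurd at z = 0.
    by_contra! hcon
    obtain ⟨p, q, hpq⟩ := h.exists_rep_of_forall_mem hcon
    have h1 := (h.rep_unique (p := X * p - 1) (q := X * q) (by
      simp only [map_sub, map_mul, aeval_X, map_one]
      have := congrArg (fun t => z * t) hpq
      simp only [mul_inv_cancel₀ hz0] at this
      linear_combination -this)).1
    have := congrArg (eval 0) h1
    simp at this
  have hz1 : O.valuation z < 1 := by
    rw [← O.valuation_le_one_iff, not_le, map_inv₀] at hx
    have := inv_lt_one_of_one_lt₀ hx
    rwa [inv_inv] at this
  have hw1 : O.valuation w < 1 := by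
    have h3 := congrArg O.valuation h.equation
    rw [map_mul, aeval_X, map_pow, map_mul] at h3
    have h5 := mul_lt_one_of_lt_of_le hz1 ((O.valuation_le_one_iff _).2
      (aeval_mem_valuationSubring hK hz Q))
    rw [← h3] at h5
    exact (pow_lt_one_iff _root_.two_ne_zero).1 h5
  exact ⟨O, fun hO => hx (hO ▸ ValuationSubring.mem_top _), hK, by simpa using hz1,
    by simpa using hw1⟩

lemma curvePoint_ext {F : Type*} [Field F] [Algebra K F] {P P' : CurvePoint K F}
    (h : P.localRing = P'.localRing) : P = P' := by
  cases P
  cases P'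
  cases h
  rfl

theorem existsUnique_branchPointAtInfinity (h2 : (2 : K) ≠ 0)
    (hn : ((2 * g + 1 : ℕ) : K) ≠ 0) :
    ∃! P : CurvePoint K (WimanField K g), IsBranchPointAtInfinity P := by
  obtain ⟨τ, hτx, hτy⟩ := exists_wimanInvolution K g
  have hI := wiman_chartAtInfinity hτx hτy h2 hn
  have hQ : (X - X ^ (2 * g + 1 + 1) : K[X]) = X * (1 - X ^ (2 * g + 1)) := by ring
  rw [hQ] at hI
  obtain ⟨O, hO, hc⟩ := hI.exists_isCenteredAt_zero
  have h0 : (0 : K) ^ 2 = eval 0 (X * (1 - X ^ (2 * g + 1))) := by simp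
  refine ⟨⟨O, hc.algebraMap_mem, hO⟩, isBranchPointAtInfinity_iff.2 hc, fun P hP => ?_⟩
  have hP' := isBranchPointAtInfinity_iff.1 hP
  exact curvePoint_ext (le_antisymm (hI.le_of_isCenteredAt h0 hP' hc)
    (hI.le_of_isCenteredAt h0 hc hP'))

end PointAtInfinity

/-- Since u² is integral over K[x], so is u = a + by. The part of u² free of y is a² + b²(x^(2g+1) -
1), whose summands have degrees of different parity and cannot cancel. The bound 2g-2 then forces b
= 0. This is how coefficients of holomorphic forms are recovered from those of quadratic ones. -/
lemma exists_wiman_polynomial_of_sq {g : ℕ} (hA : ∃ τ : WimanAut K g, IsHyperellipticChart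
      (wimanX K g) (wimanY K g) (X ^ (2 * g + 1) - 1 : K[X]) τ) {u : WimanField K g}
    (h : ∃ p ∈ degreeLT K (2 * g - 1), ∃ q ∈ degreeLT K (g - 2),
        u ^ 2 = aeval (wimanX K g) p + aeval (wimanX K g) q * wimanY K g) :
    ∃ s : K[X], s.natDegree ≤ g - 1 ∧ u = aeval (wimanX K g) s := by
  obtain ⟨τ, hA⟩ := hA
  obtain ⟨p, hp, q, -, hpq⟩ := h
  have hint : (aeval (wimanX K g) : K[X] →ₐ[K] _).toRingHom.IsIntegralElem u := by
    apply isIntegralElem_of_forall_mem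
    intro O hK hX
    have h1 : u ^ 2 ∈ O := by
      rw [hpq]
      exact add_mem (aeval_mem_valuationSubring hK hX p)
        (mul_mem (aeval_mem_valuationSubring hK hX q) (hA.Y_mem hK hX))
    rw [← O.valuation_le_one_iff] at h1 ⊢
    rw [map_pow] at h1
    exact (pow_le_one_iff two_ne_zero).1 h1
  obtain ⟨a, b, rfl⟩ := hA.exists_rep_of_isIntegralElem hint
  have hunique := (hA.rep_unique (p := a ^ 2 + b ^ 2 * (X ^ (2 * g + 1) - 1) - p)
    (q := 2 * a * b - q) (by
      have h3 := hA.equation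
      rw [map_sub, map_add, map_mul _ (b ^ 2), ← h3]
      simp only [map_sub, map_mul, map_pow, map_ofNat]
      linear_combination hpq)).1
  have hp' : p = a ^ 2 + b ^ 2 * (X ^ (2 * g + 1) - 1) := (sub_eq_zero.1 hunique).symm
  have hQd : (X ^ (2 * g + 1) - 1 : K[X]).natDegree = 2 * g + 1 := natDegree_X_pow_sub_C (r := 1)
  have hQ0 : (X ^ (2 * g + 1) - 1 : K[X]) ≠ 0 := hA.Q_ne_zero
  have hpd : p.natDegree ≤ 2 * g - 2 := by
    rcases eq_or_ne p 0 with h0 | h0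
    · simp [h0]
    · have := (natDegree_lt_iff_degree_lt h0).2 (mem_degreeLT.1 hp)
      omega
  have hb : b = 0 := by
    by_contra hb
    have hd1 : (b ^ 2 * (X ^ (2 * g + 1) - 1)).natDegree = 2 * b.natDegree + (2 * g + 1) := by
      rw [natDegree_mul (pow_ne_zero 2 hb) hQ0, natDegree_pow, hQd]
    have hd2 : (a ^ 2).natDegree = 2 * a.natDegree := natDegree_pow a 2
    rcases lt_or_ge (a ^ 2).natDegree (b ^ 2 * (X ^ (2 * g + 1) - 1)).natDegree with hlt | hge
    · have := natDegree_add_eq_right_of_natDegree_lt hlt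
      rw [← hp'] at this
      omega
    · have hlt : (b ^ 2 * (X ^ (2 * g + 1) - 1)).natDegree < (a ^ 2).natDegree := by omega
      have := natDegree_add_eq_left_of_natDegree_lt hlt
      rw [← hp'] at this
      omega
  refine ⟨a, ?_, by rw [hb]; simp⟩
  rw [hb, zero_pow two_ne_zero, zero_mul, add_zero] at hp'
  rw [hp', natDegree_pow] at hpd
  omega

lemma smul_wimanSq (f : WimanField K g) :
    f • wimanSq K g = (f * ((wimanY K g)⁻¹ * (wimanY K g)⁻¹)) •
      (KaehlerDifferential.D K _ (wimanX K g) ⊗ₜ[WimanField K g]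
        KaehlerDifferential.D K _ (wimanX K g)) := by
  rw [wimanSq, ← TensorProduct.smul_tmul', TensorProduct.tmul_smul, smul_smul, smul_smul, mul_assoc]

/-- Every automorphism of the Wiman curve acts on `x` by a Möbius transformation. -/
lemma exists_moebius [IsAlgClosed K] (hg : 2 ≤ g) (h2 : (2 : K) ≠ 0)
    (hn : ((2 * g + 1 : ℕ) : K) ≠ 0) (φ : WimanAut K g) :
    ∃ P R : K[X], P.natDegree ≤ 1 ∧ R.natDegree ≤ 1 ∧ R ≠ 0 ∧
      φ (wimanX K g) * aeval (wimanX K g) R = aeval (wimanX K g) P := by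
  obtain ⟨τ, hτx, hτy⟩ := exists_wimanInvolution K g
  have hA := wiman_affineChart hτx hτy h2 hn
  have hy0 : wimanY K g ≠ 0 := hA.Y_ne_zero
  obtain ⟨e, he⟩ := exists_quadDiffEquiv (g := g) h2 hy0
  obtain ⟨D, hDx, hdD⟩ := exists_wimanDerivation (g := g) h2 hy0
  -- `k` is the ratio of the image of dx/y under `φ` to dx/y itself.
  set k : WimanField K g := (φ (wimanY K g))⁻¹ * D (φ (wimanX K g)) with hk
  have hφ : ∀ f : WimanField K g, quadDiffMap φ (f • wimanSq K g)
      = (φ f * k ^ 2) • wimanSq K g := by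
    intro f
    rw [smul_wimanSq, quadDiffMap_apply, hdD (φ (wimanX K g)), wimanSq, ← TensorProduct.smul_tmul',
      TensorProduct.tmul_smul, smul_smul, smul_smul, map_mul, map_mul, map_inv₀]
    congr 1
    rw [hk]
    ring
  have hk0 : k ≠ 0 := by
    intro h0
    have h3 := hφ 1
    rw [h0, zero_pow two_ne_zero, mul_zero, zero_smul, one_smul] at h3
    have h4 := congrArg (quadDiffMap φ⁻¹) h3
    rw [← quadDiffMap_mul, inv_mul_cancel, quadDiffMap_one, map_zero] at h4
    have h5 := congrArg e h4
    rw [he, map_zero] at h5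
    exact one_ne_zero h5
  -- The form x^(2i) (dx/y)² is bicanonical, and its image has the square (φ(x)^i k)² as
  -- coefficient.
  have hpoly : ∀ i, i ≤ g - 1 → ∃ s : K[X], s.natDegree ≤ g - 1 ∧
      φ (wimanX K g) ^ i * k = aeval (wimanX K g) s := by
    intro i hi
    apply exists_wiman_polynomial_of_sq ⟨τ, hA⟩
    have h3 : (wimanX K g ^ (2 * i)) • wimanSq K g ∈ bicanonicalForms K (WimanField K g) := by
      rw [smul_wimanSq_mem_bicanonicalForms_iff (by omega) h2 hn]
      refine ⟨X ^ (2 * i), ?_, 0, zero_mem _, by simp⟩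
      rw [mem_degreeLT, degree_X_pow]
      exact_mod_cast (by omega : 2 * i < 2 * g - 1)
    have h4 := quadDiffMap_mem φ h3
    rw [hφ, smul_wimanSq_mem_bicanonicalForms_iff (by omega) h2 hn] at h4
    convert h4 using 7
    rw [map_pow]
    ring
  obtain ⟨s₀, hs₀d, hs₀⟩ := hpoly 0 (by omega)
  obtain ⟨s₁, hs₁d, hs₁⟩ := hpoly 1 (by omega)
  obtain ⟨s, hsd, hs⟩ := hpoly (g - 1) le_rfl
  rw [pow_zero, one_mul] at hs₀
  rw [pow_one] at hs₁
  have hs₀0 : s₀ ≠ 0 := by rintro rfl; exact hk0 (by rw [hs₀, map_zero])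
  obtain ⟨d, R, P, hco, hd, rfl, rfl⟩ := exists_isCoprime_eq_mul hs₀0 s₁
  have hR0 : R ≠ 0 := right_ne_zero_of_mul hs₀0
  have hPR : φ (wimanX K g) * aeval (wimanX K g) R = aeval (wimanX K g) P := by
    apply mul_left_cancel₀ (hA.aeval_ne_zero hd)
    rw [hs₀, map_mul, map_mul] at hs₁
    linear_combination hs₁
  have hφx0 : φ (wimanX K g) ≠ 0 := by
    rw [Ne, map_eq_zero_iff _ φ.injective]; exact wimanX_ne_zero
  have hs0 : s ≠ 0 := by
    rintro rfl
    rw [map_zero] at hs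
    exact mul_ne_zero (pow_ne_zero _ hφx0) hk0 hs
  have hrel : P ^ (g - 1) * (d * R) = R ^ (g - 1) * s := by
    apply hA.transcendental
    rw [map_mul, map_mul _ (R ^ (g - 1)), map_pow, map_pow, ← hs₀, ← hs, ← hPR]
    ring
  have h5 : R ^ (g - 1) ∣ d * R := (hco.pow).dvd_of_dvd_mul_left ⟨s, hrel⟩
  have h6 : P ^ (g - 1) ∣ s := (hco.symm.pow).dvd_of_dvd_mul_left ⟨d * R, hrel.symm⟩
  -- With φ(x) = P/R in lowest terms, P^(g-1) and R^(g-1) divide nonzero polynomials of degree at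
  -- most g-1. As g-1 > 0, both degrees are at most 1.
  have hdeg : ∀ {A B : K[X]}, A ^ (g - 1) ∣ B → B ≠ 0 → B.natDegree ≤ g - 1 → A.natDegree ≤ 1 := by
    intro A B hAB hB hBd
    have h7 := natDegree_le_of_dvd hAB hB
    rw [natDegree_pow] at h7
    have h8 : (g - 1) * A.natDegree ≤ (g - 1) * 1 := by omega
    exact Nat.le_of_mul_le_mul_left h8 (by omega)
  exact ⟨P, R, hdeg h6 hs0 hsd, hdeg h5 hs₀0 hs₀d, hR0, hPR⟩

/-- The automorphisms of the Wiman curve. -/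
theorem wimanAut_apply [IsAlgClosed K] (hg : 2 ≤ g) (h2 : (2 : K) ≠ 0)
    (hn : ((2 * g + 1 : ℕ) : K) ≠ 0) (φ : WimanAut K g) :
    ∃ a b : K, a ^ (2 * g + 1) = 1 ∧ b ^ 2 = 1 ∧ φ (wimanX K g) = a • wimanX K g ∧
      φ (wimanY K g) = b • wimanY K g := by
  obtain ⟨τ, hτx, hτy⟩ := exists_wimanInvolution K g
  have hA := wiman_affineChart hτx hτy h2 hn
  have hy0 : wimanY K g ≠ 0 := hA.Y_ne_zero
  obtain ⟨P, R, hPd, hRd, hR0, hPR⟩ := exists_moebius hg h2 hn φ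
  obtain ⟨p, q, r, hr0, hrep⟩ := hA.exists_rep (φ (wimanY K g))
  have hR0' := hA.aeval_ne_zero hR0
  have hr0' := hA.aeval_ne_zero hr0
  have hφy0 : φ (wimanY K g) ≠ 0 := by rwa [Ne, map_eq_zero_iff _ φ.injective]
  have heq : φ (wimanY K g) ^ 2 = φ (wimanX K g) ^ (2 * g + 1) - 1 := by
    rw [← map_pow, wiman_equation, map_sub, map_pow, map_one]
  have heq' : (aeval (wimanX K g) p + aeval (wimanX K g) q * wimanY K g) ^ 2
      * aeval (wimanX K g) R ^ (2 * g + 1)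
      = aeval (wimanX K g) r ^ 2 * (aeval (wimanX K g) P ^ (2 * g + 1)
        - aeval (wimanX K g) R ^ (2 * g + 1)) := by
    rw [← hrep, ← hPR, mul_pow, heq, mul_pow]
    ring
  have huniq := hA.rep_unique
    (p := (p ^ 2 + q ^ 2 * (X ^ (2 * g + 1) - 1)) * R ^ (2 * g + 1)
      - r ^ 2 * (P ^ (2 * g + 1) - R ^ (2 * g + 1)))
    (q := 2 * p * q * R ^ (2 * g + 1)) (by
      have h3 := hA.equation
      rw [map_sub, map_mul, map_add, map_mul _ (q ^ 2), ← h3]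
      simp only [map_sub, map_mul, map_pow, map_ofNat]
      linear_combination heq')
  have h2X : (2 : K[X]) ≠ 0 := by
    have := C_ne_zero.2 h2
    rwa [map_ofNat] at this
  -- Squaring φ(y) gives pq = 0. If q vanished, φ(x) and φ(y) would both lie in K(x), so `τ` would
  -- fix the image of `φ`, which is the whole field.
  have hp : p = 0 := by
    by_contra hp
    have hq : q = 0 := by
      have := (mul_eq_zero.1 huniq.2).resolve_right (pow_ne_zero _ hR0)
      exact (mul_eq_zero.1 this).resolve_left (mul_ne_zero h2X hp)
    rw [hq, map_zero, zero_mul, add_zero] at hrep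
    have h3 : τ * φ = φ := by
      refine wimanAut_ext ?_ ?_
      · change τ (φ _) = _
        rw [eq_div_of_mul_eq hR0' hPR, map_div₀, hA.map_aeval, hA.map_aeval]
      · change τ (φ _) = _
        rw [eq_div_of_mul_eq hr0' hrep, map_div₀, hA.map_aeval, hA.map_aeval]
    rw [mul_eq_right] at h3
    rw [h3] at hτy
    have h4 : 2 * wimanY K g = 0 := by
      have h5 : wimanY K g = -wimanY K g := hτy
      linear_combination h5
    exact mul_ne_zero hA.two_ne_zero' hy0 h4
  subst hp
  rw [map_zero, zero_add] at hrep
  have hpoly : (q * R ^ (g + 1)) ^ 2 * (X ^ (2 * g + 1) - 1)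
      = r ^ 2 * (R * (P ^ (2 * g + 1) - R ^ (2 * g + 1))) := by
    linear_combination R * huniq.1
  -- Here φ(y) = (q/r)y, and r divides qR^(g+1) because x^(2g+1) - 1 is squarefree; so φ(y) = c
  -- y/R^(g+1) with `c` a polynomial.
  obtain ⟨c, hc⟩ := dvd_of_sq_dvd_sq_mul hA.separable.squarefree hr0 ⟨_, hpoly⟩
  have hc0 : c ≠ 0 := by
    rintro rfl
    rw [mul_zero] at hc
    have hq := (mul_eq_zero.1 hc).resolve_right (pow_ne_zero _ hR0)
    rw [hq, map_zero, zero_mul] at hrep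
    exact mul_ne_zero hφy0 hr0' hrep
  have hpoly2 : c ^ 2 * (X ^ (2 * g + 1) - 1) = R * (P ^ (2 * g + 1) - R ^ (2 * g + 1)) := by
    apply mul_left_cancel₀ (pow_ne_zero 2 hr0)
    rw [← hpoly, hc]
    ring
  -- Degrees give 2 deg c + 2g + 1 ≤ 2g + 2.
  have hcd : c.natDegree = 0 := by
    have h3 := congrArg natDegree hpoly2
    have hQd : (X ^ (2 * g + 1) - 1 : K[X]).natDegree = 2 * g + 1 := natDegree_X_pow_sub_C (r := 1)
    rw [natDegree_mul (pow_ne_zero 2 hc0) hA.Q_ne_zero, natDegree_pow, hQd] at h3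
    have h4 : (R * (P ^ (2 * g + 1) - R ^ (2 * g + 1))).natDegree ≤ 1 + (2 * g + 1) * 1 :=
      natDegree_mul_le_of_le hRd ((natDegree_sub_le_of_le (natDegree_pow_le_of_le _ hPd)
        (natDegree_pow_le_of_le _ hRd)).trans (max_self _).le)
    omega
  obtain ⟨c, rfl⟩ : ∃ c' : K, c = C c' := ⟨_, eq_C_of_natDegree_eq_zero hcd⟩
  have hc0' : c ≠ 0 := C_ne_zero.1 hc0
  obtain ⟨a, b, rfl⟩ : ∃ a b : K, P = C a * X + C b :=
    ⟨_, _, eq_X_add_C_of_natDegree_le_one hPd⟩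
  obtain ⟨c', d, rfl⟩ : ∃ a b : K, R = C a * X + C b :=
    ⟨_, _, eq_X_add_C_of_natDegree_le_one hRd⟩
  rw [← C_pow] at hpoly2
  obtain ⟨rfl, rfl, hd, had, hcd⟩ := moebius_eq_rotation hg h2 hn (pow_ne_zero 2 hc0') hpoly2.symm
  simp only [C_0, zero_mul, zero_add, add_zero, aeval_C, map_mul, aeval_X] at hPR hc
  have hdF : algebraMap K (WimanField K g) d ≠ 0 := by simpa using hd
  refine ⟨a / d, c / d ^ (g + 1), ?_, ?_, ?_, ?_⟩
  · rw [div_pow, had, div_self (pow_ne_zero _ hd)]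
  · rw [div_pow, hcd, ← pow_mul, mul_comm (g + 1) 2, mul_add_one, div_self (pow_ne_zero _ hd)]
  · rw [Algebra.smul_def, map_div₀]
    field_simp
    linear_combination hPR
  · rw [Algebra.smul_def, map_div₀, map_pow]
    have h3 := congrArg (aeval (wimanX K g)) hc
    simp only [map_mul, map_pow, aeval_C] at h3
    field_simp
    apply mul_left_cancel₀ hr0'
    linear_combination algebraMap K (WimanField K g) d ^ (g + 1) * hrep + wimanY K g * h3

end WimanAutomorphisms

/-! ### Diagonal elements of SL(V) and stabilizers of Hilbert points -/

section SpecialLinear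

variable {K V ι : Type*} [Field K] [AddCommGroup V] [Module K V]

lemma det_eq_prod_of_diagonal [Fintype ι] (B : Module.Basis ι K V) (f : V →ₗ[K] V) (c : ι → K)
    (hf : ∀ i, f (B i) = c i • B i) : LinearMap.det f = ∏ i, c i := by
  classical
  rw [← LinearMap.det_toMatrix B, ← Matrix.det_diagonal]
  congr 1
  ext i j
  rw [LinearMap.toMatrix_apply, hf, map_smul, B.repr_self, Finsupp.smul_single, smul_eq_mul,
    mul_one, Matrix.diagonal_apply, Finsupp.single_apply]
  simp only [eq_comm]
  split_ifs with h
  · rw [h]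
  · rfl

/-- The elements of `SL(V)` that are diagonal in the basis `B`, with `N`-th roots of unity as
eigenvalues. -/
def diagonalRoots (B : Module.Basis ι K V) (N : ℕ) : Subgroup (SpecialLinearGroup K V) where
  carrier := {s | ∀ i, ∃ c : K, c ^ N = 1 ∧ (s : V ≃ₗ[K] V) (B i) = c • B i}
  one_mem' i := ⟨1, one_pow N, by rw [one_smul]; rfl⟩
  mul_mem' {s t} hs ht i := by
    obtain ⟨c, hc1, hc⟩ := hs i
    obtain ⟨d, hd1, hd⟩ := ht i
    refine ⟨d * c, by rw [mul_pow, hc1, hd1, one_mul], ?_⟩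
    change (s : V ≃ₗ[K] V) ((t : V ≃ₗ[K] V) (B i)) = _
    rw [hd, map_smul, hc, mul_smul]
  inv_mem' {s} hs i := by
    obtain ⟨c, hc1, hc⟩ := hs i
    have hc0 : c ≠ 0 := by
      rintro rfl
      rw [zero_smul, LinearEquiv.map_eq_zero_iff] at hc
      exact B.ne_zero i hc
    refine ⟨c⁻¹, by rw [inv_pow, hc1, inv_one], ?_⟩
    change (s : V ≃ₗ[K] V).symm (B i) = _
    rw [LinearEquiv.symm_apply_eq, map_smul, hc, smul_smul, inv_mul_cancel₀ hc0, one_smul]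

/-- An element is determined by its eigenvalues on `B`, and each of these is one of finitely many
roots of unity. -/
lemma finite_of_le_diagonalRoots [Finite ι] (B : Module.Basis ι K V) {N : ℕ} (hN : 0 < N)
    {G : Subgroup (SpecialLinearGroup K V)} (hG : G ≤ diagonalRoots B N) : Finite G := by
  classical
  have hG' : ∀ s : G, ∀ i, ∃ c : K, c ^ N = 1 ∧
      ((s : SpecialLinearGroup K V) : V ≃ₗ[K] V) (B i) = c • B i := fun s i => hG s.2 i
  choose c hc1 hc using hG'
  let f : G → ι → {x : K // x ∈ Polynomial.nthRootsFinset N (1 : K)} := fun s i =>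
    ⟨c s i, (Polynomial.mem_nthRootsFinset hN 1).2 (hc1 s i)⟩
  refine Finite.of_injective f fun s t hst => ?_
  have h1 : ∀ i, c s i = c t i := fun i => congrArg Subtype.val (congrFun hst i)
  apply Subtype.ext
  apply Subtype.ext
  apply LinearEquiv.toLinearMap_injective
  refine B.ext fun i => ?_
  have h2 := hc s i
  rw [h1, ← hc t i] at h2
  exact h2

/-- A finite group of diagonal matrices containing one with distinct eigenvalues. -/
lemma isMultiplicityFree_slRepresentation (B : Module.Basis ι K V) {N : ℕ}
    {G : Subgroup (SpecialLinearGroup K V)} (hG : G ≤ diagonalRoots B N)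
    {s : SpecialLinearGroup K V} (hs : s ∈ G) {μ : ι → K} (hμ : Function.Injective μ)
    (hsB : ∀ i, (s : V ≃ₗ[K] V) (B i) = μ i • B i) :
    IsMultiplicityFree (slRepresentation G) ∧
      IsUnionOfIrreducibleBases (slRepresentation G) B :=
  isMultiplicityFree_of_diagonal (slRepresentation G) B
    (fun t i => (hG t.2 i).imp fun _ h => h.2) ⟨s, hs⟩ μ hμ hsB

lemma symMap_mem_range_pow (s : V →ₗ[K] V) (m : ℕ) {p : SymmetricAlgebra K V}
    (hp : p ∈ LinearMap.range (SymmetricAlgebra.ι K V) ^ m) :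
    symMap s p ∈ LinearMap.range (SymmetricAlgebra.ι K V) ^ m := by
  have h1 : (LinearMap.range (SymmetricAlgebra.ι K V)).map (symMap s).toLinearMap
      ≤ LinearMap.range (SymmetricAlgebra.ι K V) := by
    rintro _ ⟨_, ⟨v, rfl⟩, rfl⟩
    exact ⟨s v, by simp [symMap]⟩
  have h2 := Submodule.mem_map_of_mem (f := (symMap s).toLinearMap) hp
  rw [Submodule.map_pow] at h2
  exact pow_le_pow_left' h1 m h2

lemma linearAut_le_slStabilizer_hilbertPoint (I : Ideal (SymmetricAlgebra K V)) (m : ℕ) :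
    linearAut I ≤ slStabilizer (hilbertPoint I m) := by
  intro s hs p
  have h1 : symMap ((s : V ≃ₗ[K] V) : V →ₗ[K] V) p ∈ LinearMap.range (SymmetricAlgebra.ι K V) ^ m
      ↔ p ∈ LinearMap.range (SymmetricAlgebra.ι K V) ^ m := by
    refine ⟨fun h => ?_, symMap_mem_range_pow _ m⟩
    have h2 := symMap_mem_range_pow ((s : V ≃ₗ[K] V).symm : V →ₗ[K] V) m h
    have h3 : ((s : V ≃ₗ[K] V).symm : V →ₗ[K] V) * ((s : V ≃ₗ[K] V) : V →ₗ[K] V) = 1 := by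
      ext v
      exact (s : V ≃ₗ[K] V).symm_apply_apply v
    rwa [← AlgHom.comp_apply, ← symMap_mul, h3, symMap_one] at h2
  exact and_congr (hs p) h1

/-- The cyclic group generated by `s` serves for every `m`: it is finite and preserves the ideal,
hence each graded piece. -/
lemma basisDeterminesStability_of_diagonal [Finite ι] (B : Module.Basis ι K V) {N : ℕ} (hN : 0 < N)
    {I : Ideal (SymmetricAlgebra K V)} {s : SpecialLinearGroup K V} (hs : s ∈ linearAut I)
    (hsN : s ∈ diagonalRoots B N) {μ : ι → K} (hμ : Function.Injective μ)
    (hsB : ∀ i, (s : V ≃ₗ[K] V) (B i) = μ i • B i) (m : ℕ) :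
    BasisDeterminesStability B (hilbertPoint I m) := by
  have hle : Subgroup.zpowers s ≤ diagonalRoots B N := by rwa [Subgroup.zpowers_le]
  refine ⟨Subgroup.zpowers s, ?_, finite_of_le_diagonalRoots B hN hle,
    isMultiplicityFree_slRepresentation B hle (Subgroup.mem_zpowers s) hμ hsB⟩
  rw [Subgroup.zpowers_le]
  exact linearAut_le_slStabilizer_hilbertPoint I m hs

/-- An element of `SL(V)` with prescribed ratios of eigenvalues. -/
lemma exists_diagonal_specialLinear [IsAlgClosed K] [Fintype ι] [Nonempty ι]
    (B : Module.Basis ι K V) (μ : ι → K) (hμ : ∀ i, μ i ≠ 0) :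
    ∃ (s : SpecialLinearGroup K V) (c : K), c ≠ 0 ∧
      ∀ i, (s : V ≃ₗ[K] V) (B i) = (c * μ i) • B i := by
  have hprod : ∏ i, μ i ≠ 0 := Finset.prod_ne_zero_iff.2 fun i _ => hμ i
  -- Scaling by `c` multiplies the determinant by c^(dim V), so a root of that order normalizes it
  -- to one.
  obtain ⟨c, hc⟩ := IsAlgClosed.exists_pow_nat_eq (∏ i, μ i)⁻¹ (Fintype.card_pos (α := ι))
  have hc0 : c ≠ 0 := by
    rintro rfl
    rw [zero_pow Fintype.card_ne_zero] at hc
    exact inv_ne_zero hprod hc.symm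
  let w : ι → Kˣ := fun i => Units.mk0 (c * μ i) (mul_ne_zero hc0 (hμ i))
  let s : V ≃ₗ[K] V := B.equiv (B.unitsSMul w) (Equiv.refl ι)
  have hs : ∀ i, s (B i) = (c * μ i) • B i := fun i => by
    rw [Module.Basis.equiv_apply, Equiv.refl_apply, Module.Basis.unitsSMul_apply]
    rfl
  have hdet : s.det = 1 := by
    apply Units.ext
    rw [LinearEquiv.coe_det, det_eq_prod_of_diagonal B _ _ hs, Finset.prod_mul_distrib,
      Finset.prod_const, Finset.card_univ, hc, inv_mul_cancel₀ hprod, Units.val_one]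
  exact ⟨⟨s, hdet⟩, c, hc0, hs⟩

/-- If the ratios of the eigenvalues are roots of unity, so are the eigenvalues. -/
lemma mem_diagonalRoots_of_ratio [Fintype ι] (B : Module.Basis ι K V) {n : ℕ}
    {s : SpecialLinearGroup K V} {c : K} {μ : ι → K} (hμ : ∀ i, μ i ^ n = 1)
    (hs : ∀ i, (s : V ≃ₗ[K] V) (B i) = (c * μ i) • B i) :
    s ∈ diagonalRoots B (n * Fintype.card ι) := by
  intro i
  refine ⟨c * μ i, ?_, hs i⟩
  have h1 : ∏ i, (c * μ i) = 1 := by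
    rw [← det_eq_prod_of_diagonal B ((s : V ≃ₗ[K] V) : V →ₗ[K] V) _ hs]
    exact SpecialLinearGroup.det_eq_one s
  -- The n-th power of the determinant is c^(n dim V), because the `μ i` contribute nothing; so `c`
  -- is a root of unity.
  have h2 : ∏ i, (c * μ i) ^ n = c ^ (n * Fintype.card ι) := by
    simp_rw [mul_pow, hμ, mul_one]
    rw [Finset.prod_const, Finset.card_univ, pow_mul]
  rw [Finset.prod_pow, h1, one_pow] at h2
  rw [mul_pow, ← h2, pow_mul (μ i), hμ, one_pow, one_mul]

end SpecialLinear

/-! ### The ideal of the bicanonical model and linear maps preserving it -/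

section BicanonicalModel

open Polynomial

section Kernel

variable {K F : Type*} [Field K] [Field F] [Algebra K F]

lemma symMap_ι {V : Type*} [AddCommGroup V] [Module K V] (s : V →ₗ[K] V) (v : V) :
    symMap s (SymmetricAlgebra.ι K V v) = SymmetricAlgebra.ι K V (s v) := by
  simp [symMap]

/-- In a generator of the quadratic differentials, pluri-differentials become polynomials. -/
lemma exists_bicanonicalIdeal_eq_ker (e : QuadDiff K F ≃ₗ[F] F) :
    ∃ Ψ : SymmetricAlgebra K (bicanonicalForms K F) →ₐ[K] F[X],
      (∀ v : bicanonicalForms K F, Ψ (SymmetricAlgebra.ι K _ v) = C (e v) * X) ∧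
      ∀ p, p ∈ bicanonicalIdeal K F ↔ Ψ p = 0 := by
  let b : Module.Basis Unit F (QuadDiff K F) := (Module.Basis.singleton Unit F).map e.symm
  -- The symmetric algebra of a line is a polynomial ring in one variable, which records the degree.
  let E : SymmetricAlgebra F (QuadDiff K F) ≃ₐ[F] F[X] :=
    (SymmetricAlgebra.equivMvPolynomial b).trans (MvPolynomial.uniqueAlgEquiv F Unit)
  have hE : ∀ q, E (SymmetricAlgebra.ι F _ q) = C (e q) * X := by
    intro q
    have hq : q = e q • b () := by
      apply e.injective
      simp [b]
    conv_lhs => rw [hq]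
    rw [map_smul, map_smul, AlgEquiv.trans_apply, SymmetricAlgebra.equivMvPolynomial_ι_apply]
    simp [smul_eq_C_mul]
  let Φ := SymmetricAlgebra.lift (((SymmetricAlgebra.ι F (QuadDiff K F)).restrictScalars K) ∘ₗ
      (bicanonicalForms K F).subtype)
  refine ⟨(E.toAlgHom.restrictScalars K).comp Φ, fun v => ?_, fun p => ?_⟩
  · rw [AlgHom.comp_apply]
    simp only [Φ, SymmetricAlgebra.lift_ι_apply]
    exact hE v
  · rw [bicanonicalIdeal, RingHom.mem_ker, AlgHom.comp_apply]
    exact (map_eq_zero_iff E E.injective).symm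

/-- Linear maps induced by automorphisms of the curve preserve the ideal of the bicanonical
model. -/
lemma symMap_mem_bicanonicalIdeal_iff (e : QuadDiff K F ≃ₗ[F] F) (φ : F ≃ₐ[K] F) {h : F}
    (hh : h ≠ 0) {s : bicanonicalForms K F →ₗ[K] bicanonicalForms K F}
    (hs : ∀ v, e (s v) = h * φ (e v)) (p : SymmetricAlgebra K (bicanonicalForms K F)) :
    symMap s p ∈ bicanonicalIdeal K F ↔ p ∈ bicanonicalIdeal K F := by
  obtain ⟨Ψ, hΨ, hker⟩ := exists_bicanonicalIdeal_eq_ker e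
  -- On pluri-differentials `s` becomes: apply `φ` to the coefficients and replace X by hX. This is
  -- injective as `h` is nonzero.
  let θ : F[X] →ₐ[K] F[X] :=
    ((aeval (C h * X) : F[X] →ₐ[F] F[X]).restrictScalars K).comp (mapAlgHom (φ : F →ₐ[K] F))
  have hθ : Ψ.comp (symMap s) = θ.comp Ψ := by
    apply SymmetricAlgebra.algHom_ext
    refine LinearMap.ext fun v => ?_
    change Ψ (symMap s (SymmetricAlgebra.ι K _ v))
      = aeval (C h * X) ((Ψ (SymmetricAlgebra.ι K _ v)).map (φ : F →+* F))
    rw [symMap_ι, hΨ, hΨ, hs, Polynomial.map_mul, map_C, map_X]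
    simp only [map_mul, aeval_C, aeval_X, Polynomial.algebraMap_eq]
    change _ = C (φ (e v)) * _
    ring
  have hθ0 : ∀ P, θ P = 0 ↔ P = 0 := by
    intro P
    refine ⟨fun hP => ?_, fun hP => by rw [hP, map_zero]⟩
    ext n
    have h1 : θ P = (P.map (φ : F →+* F)).comp (C h * X) := rfl
    have h2 := congrArg (fun q => coeff q n) (h1.symm.trans hP)
    simp only [comp_C_mul_X_coeff, coeff_map, coeff_zero] at h2
    have h3 := (mul_eq_zero.1 h2).resolve_right (pow_ne_zero n hh)
    exact (map_eq_zero_iff _ φ.injective).1 h3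
  rw [hker, hker, ← AlgHom.comp_apply, hθ, AlgHom.comp_apply, hθ0]

section Relations

variable {V : Type*} [AddCommGroup V] [Module K V]
  {Ψ Ψ' : SymmetricAlgebra K V →ₐ[K] F[X]} {ε ε' : V → F}
  (hΨ : ∀ v, Ψ (SymmetricAlgebra.ι K V v) = C (ε v) * X)
  (hΨ' : ∀ v, Ψ' (SymmetricAlgebra.ι K V v) = C (ε' v) * X)
  (h : ∀ p, Ψ' p = 0 ↔ Ψ p = 0)

lemma C_mul_X_pow_eq_zero_iff {a : F} {n : ℕ} : C a * X ^ n = 0 ↔ a = 0 := by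
  rw [C_mul_X_pow_eq_monomial, monomial_eq_zero_iff]

include hΨ in
lemma map_smul_pow_mul_pow (a : K) (i k : ℕ) {v₀ v₁ : V} (h0 : ε v₀ ≠ 0) :
    Ψ (a • (SymmetricAlgebra.ι K V v₀ ^ k * SymmetricAlgebra.ι K V v₁ ^ i))
      = C (ε v₀ ^ (k + i) * a • (ε v₁ / ε v₀) ^ i) * X ^ (k + i) := by
  have h1 : ε v₀ ^ (k + i) * a • (ε v₁ / ε v₀) ^ i
      = algebraMap K F a * (ε v₀ ^ k * ε v₁ ^ i) := by
    rw [Algebra.smul_def, div_pow, pow_add]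
    field_simp
  rw [h1, map_smul, map_mul, map_pow, map_pow, hΨ, hΨ, Algebra.smul_def,
    IsScalarTower.algebraMap_apply K F F[X], Polynomial.algebraMap_eq, C_mul, C_mul, C_pow, C_pow]
  ring

-- Homogenizing with `v₀` makes algebraic relations of the ratio of `v₁` to `v₀` visible as elements
-- of the kernel.
include hΨ in
lemma map_homogenization (p : K[X]) {v₀ v₁ : V} (h0 : ε v₀ ≠ 0) :
    Ψ (∑ i ∈ Finset.range (p.natDegree + 1),
      p.coeff i • (SymmetricAlgebra.ι K V v₀ ^ (p.natDegree - i) * SymmetricAlgebra.ι K V v₁ ^ i))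
      = C (ε v₀ ^ p.natDegree * aeval (ε v₁ / ε v₀) p) * X ^ p.natDegree := by
  rw [aeval_eq_sum_range, Finset.mul_sum, map_sum, map_sum, Finset.sum_mul]
  refine Finset.sum_congr rfl fun i hi => ?_
  rw [map_smul_pow_mul_pow hΨ _ _ _ h0, Nat.sub_add_cancel (by rw [Finset.mem_range] at hi; omega)]

include hΨ hΨ' h

lemma aeval_div_eq_zero_iff (p : K[X]) {v₀ v₁ : V} (h0 : ε v₀ ≠ 0) (h0' : ε' v₀ ≠ 0) :
    aeval (ε' v₁ / ε' v₀) p = 0 ↔ aeval (ε v₁ / ε v₀) p = 0 := by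
  have h1 := h (∑ i ∈ Finset.range (p.natDegree + 1), p.coeff i •
    (SymmetricAlgebra.ι K V v₀ ^ (p.natDegree - i) * SymmetricAlgebra.ι K V v₁ ^ i))
  rw [map_homogenization hΨ p h0, map_homogenization hΨ' p h0', C_mul_X_pow_eq_zero_iff,
    C_mul_X_pow_eq_zero_iff, mul_eq_zero, mul_eq_zero, or_iff_right (pow_ne_zero _ h0),
    or_iff_right (pow_ne_zero _ h0')] at h1
  exact h1

/-- The curve equation, homogenized by `v₀` to degree m + 2, is a membership in the common kernel,
so it passes from `ε` to `ε'`. -/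
lemma sq_div_eq (m : ℕ) {v₀ v₁ v₂ : V} (h0 : ε v₀ ≠ 0) (h0' : ε' v₀ ≠ 0)
    (heq : (ε v₂ / ε v₀) ^ 2 = (ε v₁ / ε v₀) ^ (m + 2) - 1) :
    (ε' v₂ / ε' v₀) ^ 2 = (ε' v₁ / ε' v₀) ^ (m + 2) - 1 := by
  have key : ∀ {Ψ : SymmetricAlgebra K V →ₐ[K] F[X]} {ε : V → F},
      (∀ v, Ψ (SymmetricAlgebra.ι K V v) = C (ε v) * X) → ε v₀ ≠ 0 →
      (Ψ (SymmetricAlgebra.ι K V v₂ ^ 2 * SymmetricAlgebra.ι K V v₀ ^ m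
        - SymmetricAlgebra.ι K V v₁ ^ (m + 2) + SymmetricAlgebra.ι K V v₀ ^ (m + 2)) = 0
      ↔ (ε v₂ / ε v₀) ^ 2 = (ε v₁ / ε v₀) ^ (m + 2) - 1) := by
    intro Ψ ε hΨ h0
    have h1 : Ψ (SymmetricAlgebra.ι K V v₂ ^ 2 * SymmetricAlgebra.ι K V v₀ ^ m
        - SymmetricAlgebra.ι K V v₁ ^ (m + 2) + SymmetricAlgebra.ι K V v₀ ^ (m + 2))
        = C (ε v₂ ^ 2 * ε v₀ ^ m - ε v₁ ^ (m + 2) + ε v₀ ^ (m + 2)) * X ^ (m + 2) := by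
      simp only [map_add, map_sub, map_mul, map_pow, hΨ]
      ring
    rw [h1, C_mul_X_pow_eq_zero_iff, div_pow, div_pow, ← sub_eq_zero (b := _ - (1 : F))]
    have h2 : ε v₂ ^ 2 / ε v₀ ^ 2 - (ε v₁ ^ (m + 2) / ε v₀ ^ (m + 2) - 1)
        = (ε v₂ ^ 2 * ε v₀ ^ m - ε v₁ ^ (m + 2) + ε v₀ ^ (m + 2)) / ε v₀ ^ (m + 2) := by
      rw [pow_add _ m]
      field_simp
      ring
    rw [h2, div_eq_zero_iff, or_iff_left (pow_ne_zero _ h0)]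
  rw [← key hΨ' h0', h, key hΨ h0]
  exact heq

/-- The relation becomes the form v v₀^i - w v₁^i; through it the images of 1, x and y determine
those of all basis forms. -/
lemma eq_mul_div_pow (i : ℕ) {v₀ v₁ v w : V} (h0 : ε v₀ ≠ 0) (h0' : ε' v₀ ≠ 0)
    (heq : ε v = ε w * (ε v₁ / ε v₀) ^ i) : ε' v = ε' w * (ε' v₁ / ε' v₀) ^ i := by
  have key : ∀ {Ψ : SymmetricAlgebra K V →ₐ[K] F[X]} {ε : V → F},
      (∀ v, Ψ (SymmetricAlgebra.ι K V v) = C (ε v) * X) → ε v₀ ≠ 0 →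
      (Ψ (SymmetricAlgebra.ι K V v * SymmetricAlgebra.ι K V v₀ ^ i
        - SymmetricAlgebra.ι K V w * SymmetricAlgebra.ι K V v₁ ^ i) = 0
      ↔ ε v = ε w * (ε v₁ / ε v₀) ^ i) := by
    intro Ψ ε hΨ h0
    have h1 : Ψ (SymmetricAlgebra.ι K V v * SymmetricAlgebra.ι K V v₀ ^ i
        - SymmetricAlgebra.ι K V w * SymmetricAlgebra.ι K V v₁ ^ i)
        = C (ε v * ε v₀ ^ i - ε w * ε v₁ ^ i) * X ^ (i + 1) := by
      simp only [map_sub, map_mul, map_pow, hΨ]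
      ring
    rw [h1, C_mul_X_pow_eq_zero_iff, div_pow, ← mul_div_assoc, eq_div_iff (pow_ne_zero _ h0),
      sub_eq_zero]
  rw [← key hΨ' h0', h, key hΨ h0]
  exact heq

end Relations

/-- A factor that preserves a nonzero finite dimensional space of functions is constant. -/
lemma exists_algebraMap_eq_of_mul_mem [IsAlgClosed K] {V : Type*} [AddCommGroup V] [Module K V]
    [Module.Finite K V] [Nontrivial V] (ε : V →ₗ[K] F) (hε : Function.Injective ε) (A : F)
    (h : ∀ v, A * ε v ∈ LinearMap.range ε) : ∃ c : K, algebraMap K F c = A := by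
  have hAint : IsIntegral K A := by
    -- Multiplication by `A` preserves a nonzero finite-dimensional space, so `A` is integral over
    -- K, and K is algebraically closed.
    refine isIntegral_of_smul_mem_submodule (LinearMap.range ε) ?_ ?_ A ?_
    · intro h0
      obtain ⟨v, hv⟩ := exists_ne (0 : V)
      have h3 : ε v ∈ LinearMap.range ε := ⟨_, rfl⟩
      rw [h0, Submodule.mem_bot, map_eq_zero_iff ε hε] at h3
      exact hv h3
    · rw [← Module.Finite.iff_fg]
      infer_instance
    · rintro _ ⟨v, rfl⟩
      exact h v
  exact hAint.mem_range_algebraMap_of_minpoly_splits (IsAlgClosed.splits _)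

end Kernel

end BicanonicalModel

/-! ### Linear automorphisms of the model come from automorphisms of the curve -/

section LinearAutomorphisms

open Polynomial

variable {K : Type*} [Field K] {g : ℕ}

/-- A linear automorphism of the bicanonical model of the Wiman curve is induced, up to a factor,
by an automorphism of the curve. -/
lemma exists_wimanAut_of_symMap {V : Type*} [AddCommGroup V] [Module K V] (hg : 3 ≤ g)
    (B : Module.Basis (Fin (2 * g - 1) ⊕ Fin (g - 2)) K V)
    (ε : V →ₗ[K] WimanField K g) (hεinj : Function.Injective ε)
    (hεB : ∀ j, ε (B j) = standardFunction K g j) (S : V ≃ₗ[K] V)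
    {Ψ : SymmetricAlgebra K V →ₐ[K] (WimanField K g)[X]}
    (hΨ : ∀ v, Ψ (SymmetricAlgebra.ι K V v) = C (ε v) * X)
    (h : ∀ p, Ψ (symMap (S : V →ₗ[K] V) p) = 0 ↔ Ψ p = 0) :
    ∃ (A : WimanField K g) (φ : WimanAut K g), A ≠ 0 ∧
      ∀ j, ε (S (B j)) = A * φ (standardFunction K g j) := by
  -- The indices of 1, x and y; the last one exists only for g ≥ 3.
  let j₀ : Fin (2 * g - 1) ⊕ Fin (g - 2) := Sum.inl ⟨0, by omega⟩
  let j₁ : Fin (2 * g - 1) ⊕ Fin (g - 2) := Sum.inl ⟨1, by omega⟩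
  let j₂ : Fin (2 * g - 1) ⊕ Fin (g - 2) := Sum.inr ⟨0, by omega⟩
  have f₀ : ε (B j₀) = 1 := (hεB j₀).trans (pow_zero _)
  have f₁ : ε (B j₁) = wimanX K g := (hεB j₁).trans (pow_one _)
  have f₂ : ε (B j₂) = wimanY K g :=
    (hεB j₂).trans ((congrArg _ (pow_zero _)).trans (mul_one _))
  have hB : ∀ i, ε (B (Sum.inl i)) = wimanX K g ^ (i : ℕ) := fun i => hεB _
  have hB' : ∀ i, ε (B (Sum.inr i)) = wimanY K g * wimanX K g ^ (i : ℕ) := fun i => hεB _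
  have hΨ' : ∀ v, Ψ.comp (symMap (S : V →ₗ[K] V)) (SymmetricAlgebra.ι K V v)
      = C (ε (S v)) * X := fun v => by
    rw [AlgHom.comp_apply, symMap_ι, hΨ]
    rfl
  have hiff : ∀ p, Ψ.comp (symMap (S : V →ₗ[K] V)) p = 0 ↔ Ψ p = 0 := h
  have h0 : ε (B j₀) ≠ 0 := by rw [f₀]; exact one_ne_zero
  have h0' : ε (S (B j₀)) ≠ 0 := by
    rw [Ne, map_eq_zero_iff _ hεinj, LinearEquiv.map_eq_zero_iff]
    exact B.ne_zero _
  clear_value j₀ j₁ j₂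
  obtain ⟨A, hA⟩ : ∃ A, A = ε (S (B j₀)) := ⟨_, rfl⟩
  have hA0 : A ≠ 0 := by rwa [hA]
  have hinj : Function.Injective (aeval (ε (S (B j₁)) / A) : K[X] →ₐ[K] WimanField K g) := by
    rw [injective_iff_map_eq_zero]
    intro p hp
    rw [hA, aeval_div_eq_zero_iff hΨ hΨ' hiff p h0 h0', f₀, f₁, div_one] at hp
    exact aeval_wimanX_injective (by rw [hp, map_zero])
  have heq : (ε (S (B j₂)) / A) ^ 2 = (ε (S (B j₁)) / A) ^ (2 * g + 1) - 1 := by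
    have h3 := sq_div_eq hΨ hΨ' hiff (2 * g - 1) (v₀ := B j₀) (v₁ := B j₁) (v₂ := B j₂) h0 h0'
    have h4 : 2 * g - 1 + 2 = 2 * g + 1 := by omega
    rw [f₀, f₁, f₂, div_one, div_one, h4, ← hA] at h3
    exact h3 (wiman_equation K g)
  obtain ⟨ψ, hψx, hψy⟩ := exists_wimanHom (g := g) _ _ hinj heq
  have hSψB : ∀ j, ε (S (B j)) = A * ψ (standardFunction K g j) := by
    rintro (i | i)
    · have h3 := eq_mul_div_pow hΨ hΨ' hiff i (v₁ := B j₁) (v := B (Sum.inl i)) (w := B j₀) h0 h0'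
        (by rw [f₀, f₁, div_one, one_mul, hB])
      rw [h3, ← hA, ← hψx, ← map_pow]
      rfl
    · have h3 := eq_mul_div_pow hΨ hΨ' hiff i (v₁ := B j₁) (v := B (Sum.inr i)) (w := B j₂) h0 h0'
        (by rw [f₀, f₁, f₂, div_one, hB'])
      rw [h3, ← hA, ← hψx, ← map_pow]
      change _ = A * ψ (wimanY K g * wimanX K g ^ (i : ℕ))
      rw [map_mul, hψy, ← mul_assoc, mul_div_cancel₀ _ hA0]
  have hSψ : ∀ v, ε (S v) = A * ψ (ε v) := by
    have h3 : ε ∘ₗ (S : V →ₗ[K] V) = (LinearMap.mulLeft K A ∘ₗ ψ.toLinearMap) ∘ₗ ε :=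
      B.ext fun j => (hSψB j).trans (by rw [← hεB]; rfl)
    exact LinearMap.congr_fun h3
  -- As `S` is onto, every quotient of a form by `A` lies in the range of `ψ`. Dividing by the
  -- quotient 1/A of the form 1 removes `A`, so x and y lie in the range.
  have hmem : ∀ v, ε v / A ∈ ψ.fieldRange := fun v => by
    refine ⟨ε (S.symm v), ?_⟩
    have h3 := hSψ (S.symm v)
    rw [LinearEquiv.apply_symm_apply] at h3
    rw [h3]
    exact (mul_div_cancel_left₀ _ hA0).symm
  have hquot : ∀ j, ε (B j) ∈ ψ.fieldRange := fun j => by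
    have h3 := div_mem (hmem (B j)) (hmem (B j₀))
    rwa [f₀, div_div_div_cancel_right₀ hA0, div_one] at h3
  have hsurj : Function.Surjective ψ := wimanHom_surjective (f₁ ▸ hquot j₁) (f₂ ▸ hquot j₂)
  exact ⟨A, AlgEquiv.ofBijective ψ ⟨ψ.toRingHom.injective, hsurj⟩, hA0, hSψB⟩

/-- The monomials in `a` and `b` by which an automorphism `x ↦ a x`, `y ↦ b y` scales the standard
functions. -/
def standardCharacter (g : ℕ) (a b : K) : Fin (2 * g - 1) ⊕ Fin (g - 2) → K
  | Sum.inl i => a ^ (i : ℕ)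
  | Sum.inr i => b * a ^ (i : ℕ)

lemma standardCharacter_pow {a b : K} (ha : a ^ (2 * g + 1) = 1) (hb : b ^ 2 = 1)
    (j : Fin (2 * g - 1) ⊕ Fin (g - 2)) : standardCharacter g a b j ^ (4 * g + 2) = 1 := by
  have h4 : 4 * g + 2 = (2 * g + 1) * 2 := by ring
  have ha1 : ∀ i : ℕ, (a ^ i) ^ (4 * g + 2) = 1 := fun i => by
    rw [← pow_mul, mul_comm, pow_mul, h4, pow_mul a, ha, one_pow, one_pow]
  rcases j with i | i
  · exact ha1 i
  · change (b * a ^ (i : ℕ)) ^ _ = 1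
    rw [mul_pow, ha1, mul_one, h4, mul_comm, pow_mul, hb, one_pow]

lemma apply_standardFunction {φ : WimanAut K g} {a b : K} (hx : φ (wimanX K g) = a • wimanX K g)
    (hy : φ (wimanY K g) = b • wimanY K g) (j : Fin (2 * g - 1) ⊕ Fin (g - 2)) :
    φ (standardFunction K g j) = standardCharacter g a b j • standardFunction K g j := by
  rcases j with i | i
  · change φ (wimanX K g ^ (i : ℕ)) = a ^ (i : ℕ) • wimanX K g ^ (i : ℕ)
    rw [map_pow, hx, _root_.smul_pow]
  · change φ (wimanY K g * wimanX K g ^ (i : ℕ))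
      = (b * a ^ (i : ℕ)) • (wimanY K g * wimanX K g ^ (i : ℕ))
    rw [map_mul, map_pow, hx, hy, _root_.smul_pow, smul_mul_smul_comm]

/-- A linear automorphism of the bicanonical model of the Wiman curve is diagonal. -/
lemma exists_smul_of_symMap [IsAlgClosed K] {V : Type*} [AddCommGroup V] [Module K V]
    (hg : 3 ≤ g) (h2 : (2 : K) ≠ 0) (hn : ((2 * g + 1 : ℕ) : K) ≠ 0)
    (B : Module.Basis (Fin (2 * g - 1) ⊕ Fin (g - 2)) K V)
    (ε : V →ₗ[K] WimanField K g) (hεinj : Function.Injective ε)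
    (hεB : ∀ j, ε (B j) = standardFunction K g j) (S : V ≃ₗ[K] V)
    {Ψ : SymmetricAlgebra K V →ₐ[K] (WimanField K g)[X]}
    (hΨ : ∀ v, Ψ (SymmetricAlgebra.ι K V v) = C (ε v) * X)
    (h : ∀ p, Ψ (symMap (S : V →ₗ[K] V) p) = 0 ↔ Ψ p = 0) :
    ∃ (c : K) (μ : Fin (2 * g - 1) ⊕ Fin (g - 2) → K), (∀ j, μ j ^ (4 * g + 2) = 1) ∧
      ∀ j, S (B j) = (c * μ j) • B j := by
  obtain ⟨A, φ, hA0, hφ⟩ := exists_wimanAut_of_symMap hg B ε hεinj hεB S hΨ h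
  obtain ⟨a, b, ha, hb, hφx, hφy⟩ := wimanAut_apply (by omega) h2 hn φ
  have hφf := apply_standardFunction hφx hφy
  have hμ1 := standardCharacter_pow ha hb
  generalize standardCharacter g a b = μ at hφf hμ1
  have hμ0 : ∀ j, μ j ≠ 0 := fun j h0 => by
    have h3 := hμ1 j
    rw [h0, zero_pow (by omega)] at h3
    exact zero_ne_one h3
  have : Module.Finite K V := Module.Finite.of_basis B
  have : Nontrivial V := ⟨B (Sum.inl ⟨0, by omega⟩), 0, B.ne_zero _⟩
  -- `φ` only rescales each standard function, so A times that function is a multiple of the image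
  -- of `S (B j)`. Thus `A` preserves the space and must be constant.
  have hmem : ∀ v, A * ε v ∈ LinearMap.range ε := by
    intro v
    induction B.mem_span v using Submodule.span_induction with
    | mem v hv =>
      obtain ⟨j, rfl⟩ := hv
      refine ⟨(μ j)⁻¹ • S (B j), ?_⟩
      rw [map_smul, hφ, hφf, mul_smul_comm, inv_smul_smul₀ (hμ0 j), hεB]
    | zero => rw [map_zero, mul_zero]; exact zero_mem _
    | add v w _ _ hv hw => rw [map_add, mul_add]; exact add_mem hv hw
    | smul c v _ hv => rw [map_smul, mul_smul_comm]; exact Submodule.smul_mem _ c hv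
  obtain ⟨c, hc⟩ := exists_algebraMap_eq_of_mul_mem ε hεinj A hmem
  refine ⟨c, μ, hμ1, fun j => hεinj ?_⟩
  rw [hφ, hφf, map_smul, hεB, ← hc, mul_smul, Algebra.smul_def c, mul_smul_comm]

/-- The linear automorphisms of the bicanonical model of the Wiman curve are diagonal. -/
theorem exists_of_mem_linearAut [IsAlgClosed K] (hg : 3 ≤ g) (h2 : (2 : K) ≠ 0)
    (hn : ((2 * g + 1 : ℕ) : K) ≠ 0)
    (B : Module.Basis (Fin (2 * g - 1) ⊕ Fin (g - 2)) K (bicanonicalForms K (WimanField K g)))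
    (hB : ∀ j, (B j : QuadDiff K (WimanField K g)) = standardFunction K g j • wimanSq K g)
    {s : SpecialLinearGroup K (bicanonicalForms K (WimanField K g))}
    (hs : s ∈ linearAut (bicanonicalIdeal K (WimanField K g))) :
    ∃ (c : K) (μ : Fin (2 * g - 1) ⊕ Fin (g - 2) → K), (∀ j, μ j ^ (4 * g + 2) = 1) ∧
      ∀ j, s.1 (B j) = (c * μ j) • B j := by
  obtain ⟨τ, hτx, hτy⟩ := exists_wimanInvolution K g
  have hy0 : wimanY K g ≠ 0 := (wiman_affineChart hτx hτy h2 hn).Y_ne_zero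
  obtain ⟨e, he⟩ := exists_quadDiffEquiv (g := g) h2 hy0
  obtain ⟨Ψ, hΨ, hker⟩ := exists_bicanonicalIdeal_eq_ker e
  refine exists_smul_of_symMap hg h2 hn B
    ((e.toLinearMap.restrictScalars K) ∘ₗ (bicanonicalForms K (WimanField K g)).subtype)
    (fun v w h => Subtype.ext (e.injective h)) (fun j => ?_) s.1 hΨ fun p => ?_
  · change e (B j) = _
    rw [hB, map_smul, he, smul_eq_mul, mul_one]
  · rw [← hker, ← hker]
    exact hs p

end LinearAutomorphisms

/-! ### The generator σ and its eigenvalues -/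

section Generator

variable {K : Type*} [Field K] {g : ℕ}

lemma AlgEquiv.pow_apply_eq_smul {F : Type*} [Field F] [Algebra K F] {σ : F ≃ₐ[K] F} {c : K} {f : F}
    (h : σ f = c • f) (k : ℕ) : (σ ^ k) f = c ^ k • f := by
  induction k with
  | zero => rw [pow_zero, pow_zero, one_smul]; rfl
  | succ k ih =>
    rw [pow_succ', AlgEquiv.mul_apply, ih, map_smul, h, smul_smul, pow_succ]

/-- An automorphism that scales the affine coordinates fixes the branch point at infinity. -/
lemma IsBranchPointAtInfinity.smul {P : CurvePoint K (WimanField K g)}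
    (hP : IsBranchPointAtInfinity P) {φ : WimanAut K g} {a b : K} (ha : a ≠ 0) (hb : b ≠ 0)
    (hx : φ (wimanX K g) = a • wimanX K g) (hy : φ (wimanY K g) = b • wimanY K g)
    {P' : CurvePoint K (WimanField K g)} (hP' : P'.localRing = φ • P.localRing) :
    IsBranchPointAtInfinity P' := by
  have key : ∀ (c : K) (f : WimanField K g), φ f = c • f → c ≠ 0 → P.localRing.valuation f < 1 →
      P'.localRing.valuation f < 1 := by
    intro c f hf hc hlt
    rw [← ValuationSubring.mem_nonunits_iff, ValuationSubring.mem_nonunits_iff_or] at hlt ⊢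
    -- A nonzero function is a non-unit exactly when its inverse is outside the ring, and `φ`
    -- multiplies that inverse by a constant, which is a unit of both rings.
    refine hlt.imp_right fun hnot hmem => hnot ?_
    have hc' : algebraMap K (WimanField K g) c ≠ 0 := by simpa using hc
    have h1 : f⁻¹ = algebraMap K (WimanField K g) c * φ f⁻¹ := by
      rw [map_inv₀, hf, Algebra.smul_def, mul_inv, mul_inv_cancel_left₀ hc']
    have h2 : φ • f⁻¹ ∈ φ • P.localRing := by
      rw [← hP']
      have h3 := mul_mem (P'.algebraMap_mem c⁻¹) hmem
      rwa [h1, map_inv₀, inv_mul_cancel_left₀ hc'] at h3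
    exact ValuationSubring.smul_mem_pointwise_smul_iff.1 h2
  refine ⟨key a⁻¹ _ ?_ (inv_ne_zero ha) hP.1, ?_⟩
  · rw [map_inv₀, hx, Algebra.smul_def, Algebra.smul_def, mul_inv, map_inv₀]
  · have hdiv : φ (wimanY K g / wimanX K g ^ (g + 1))
        = (b / a ^ (g + 1)) • (wimanY K g / wimanX K g ^ (g + 1)) := by
      rw [map_div₀, map_pow, hx, hy, Algebra.smul_def, Algebra.smul_def, Algebra.smul_def, mul_pow,
        map_div₀, map_pow, mul_div_mul_comm]
    refine key _ _ hdiv (div_ne_zero hb (pow_ne_zero _ ha)) hP.2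

/-- Every automorphism of the Wiman curve fixes the branch point at infinity. -/
theorem smul_localRing_eq [IsAlgClosed K] (hg : 2 ≤ g) (h2 : (2 : K) ≠ 0)
    (hn : ((2 * g + 1 : ℕ) : K) ≠ 0) {P : CurvePoint K (WimanField K g)}
    (hP : IsBranchPointAtInfinity P) (φ : WimanAut K g) : φ • P.localRing = P.localRing := by
  obtain ⟨a, b, ha, hb, hx, hy⟩ := wimanAut_apply hg h2 hn φ
  have ha0 : a ≠ 0 := by rintro rfl; simp at ha
  have hb0 : b ≠ 0 := by rintro rfl; simp at hb
  let P' : CurvePoint K (WimanField K g) :=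
    { localRing := φ • P.localRing
      algebraMap_mem := fun c => by
        have h := ValuationSubring.smul_mem_pointwise_smul φ _ _ (P.algebraMap_mem c)
        rwa [AlgEquiv.smul_def, φ.commutes] at h
      ne_top := fun h => P.ne_top <| by
        rw [eq_top_iff]
        intro f _
        rw [← ValuationSubring.smul_mem_pointwise_smul_iff (g := φ), h]
        trivial }
  exact congrArg CurvePoint.localRing
    ((existsUnique_branchPointAtInfinity h2 hn).unique (hP.smul ha0 hb0 hx hy (P' := P') rfl) hP)

/-- The automorphism group of the Wiman curve is cyclic of order `4g+2`. -/
theorem orderOf_eq_and_forall_mem_zpowers [IsAlgClosed K] (hg : 2 ≤ g) (h2 : (2 : K) ≠ 0)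
    (hn : ((2 * g + 1 : ℕ) : K) ≠ 0) {ζ : K} (hζ : IsPrimitiveRoot ζ (4 * g + 2))
    {σ : WimanAut K g} (hx : σ (wimanX K g) = ζ ^ 2 • wimanX K g)
    (hy : σ (wimanY K g) = ζ ^ (2 * g + 1) • wimanY K g) :
    orderOf σ = 4 * g + 2 ∧ ∀ φ : WimanAut K g, ∃ k : ℕ, φ = σ ^ k := by
  have hyz : wimanY K g ≠ 0 := by
    obtain ⟨τ, hτx, hτy⟩ := exists_wimanInvolution K g
    exact (wiman_affineChart hτx hτy h2 hn).Y_ne_zero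
  have hcancel : ∀ {c : K} {f : WimanField K g}, f ≠ 0 → c • f = f → c = 1 := by
    intro c f hf h
    exact smul_left_injective K hf (h.trans (one_smul K f).symm)
  have hpow : ∀ k : ℕ, σ ^ k = 1 ↔ 4 * g + 2 ∣ k := by
    intro k
    have hxk := AlgEquiv.pow_apply_eq_smul hx k
    have hyk := AlgEquiv.pow_apply_eq_smul hy k
    rw [← pow_mul] at hxk hyk
    constructor
    · intro h
      rw [h] at hxk hyk
      have h3 := (hζ.pow_eq_one_iff_dvd _).1 (hcancel wimanX_ne_zero hxk.symm)
      have h4 := (hζ.pow_eq_one_iff_dvd _).1 (hcancel hyz hyk.symm)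
      -- Since 2g + 1 and 2 are coprime, divisibility for the exponents of x and y gives it for `k`.
      have h5 : k = (2 * g + 1) * k - g * (2 * k) := by
        rw [← mul_assoc, ← Nat.sub_mul, show 2 * g + 1 - g * 2 = 1 by omega, one_mul]
      rw [h5]
      exact Nat.dvd_sub h4 (h3.mul_left g)
    · intro h
      rw [(hζ.pow_eq_one_iff_dvd _).2 (h.mul_left _), one_smul] at hxk hyk
      exact wimanAut_ext hxk hyk
  refine ⟨?_, fun φ => ?_⟩
  · refine Nat.dvd_antisymm ?_ ?_
    · exact orderOf_dvd_of_pow_eq_one ((hpow _).2 dvd_rfl)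
    · exact (hpow _).1 (pow_orderOf_eq_one σ)
  · obtain ⟨a, b, ha, hb, hφx, hφy⟩ := wimanAut_apply hg h2 hn φ
    -- The root of unity ξ = a^(g+1) b satisfies ξ² = a and ξ^(2g+1) = b; writing ξ = ζ^k identifies
    -- the automorphism with `σ ^ k`.
    have h1 : (a ^ (g + 1) * b) ^ 2 = a := by
      linear_combination a * b ^ 2 * ha + a * hb
    have h3 : (a ^ (g + 1) * b) ^ (2 * g + 1) = b := by
      rw [mul_pow, ← pow_mul, mul_comm (g + 1), pow_mul, ha, one_pow, one_mul, pow_succ, pow_mul,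
        hb, one_pow, one_mul]
    obtain ⟨k, -, hk⟩ := hζ.eq_pow_of_pow_eq_one (ξ := a ^ (g + 1) * b) (by
      rw [show 4 * g + 2 = 2 * (2 * g + 1) by ring, pow_mul, h1, ha])
    refine ⟨k, wimanAut_ext ?_ ?_⟩
    · rw [hφx, AlgEquiv.pow_apply_eq_smul hx, ← pow_mul, mul_comm 2, pow_mul, hk, h1]
    · rw [hφy, AlgEquiv.pow_apply_eq_smul hy, ← pow_mul, mul_comm (2 * g + 1), pow_mul, hk, h3]

/-- The pullback of `f (dx/y)²` under an automorphism that scales the affine coordinates. -/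
lemma quadDiffMap_smul_wimanSq {φ : WimanAut K g} {a b : K} (hb : b ^ 2 = 1)
    (hx : φ (wimanX K g) = a • wimanX K g) (hy : φ (wimanY K g) = b • wimanY K g)
    (f : WimanField K g) :
    quadDiffMap φ (f • wimanSq K g) = a ^ 2 • φ f • wimanSq K g := by
  have hinv : φ ((wimanY K g)⁻¹ * (wimanY K g)⁻¹) = (wimanY K g)⁻¹ * (wimanY K g)⁻¹ := by
    rw [← mul_inv, map_inv₀, map_mul, hy, smul_mul_smul_comm, ← pow_two, hb, one_smul]
  rw [smul_wimanSq, smul_wimanSq, quadDiffMap_apply, map_mul, hinv, hx, Derivation.map_smul,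
    ← TensorProduct.smul_tmul', TensorProduct.tmul_smul, smul_smul, ← pow_two a, smul_comm]

/-- Exponents from the forms without y are even, those from the forms with y are odd. -/
lemma eigenExponent_injective (g : ℕ) : Function.Injective (eigenExponent g) := by
  rintro (i | i) (j | j) h <;> simp only [eigenExponent] at h
  · exact congrArg Sum.inl (Fin.ext (by omega))
  · omega
  · omega
  · exact congrArg Sum.inr (Fin.ext (by omega))

/-- The largest even exponent is 4g and the largest odd one is 4g - 1. Below the order of ζ,
distinct exponents give distinct eigenvalues. -/
lemma eigenExponent_lt (j : Fin (2 * g - 1) ⊕ Fin (g - 2)) : eigenExponent g j < 4 * g + 2 := by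
  rcases j with i | i <;> simp only [eigenExponent] <;> omega

/-- The factor ζ⁴ comes from (dx)², since `σ` fixes y²; the rest is the character on the function.
-/
lemma pow_eigenExponent (ζ : K) (j : Fin (2 * g - 1) ⊕ Fin (g - 2)) :
    ζ ^ eigenExponent g j = ζ ^ 4 * standardCharacter g (ζ ^ 2) (ζ ^ (2 * g + 1)) j := by
  rcases j with i | i <;> simp only [eigenExponent, standardCharacter] <;> ring

/-- The standard basis consists of eigenvectors of the generator. -/
lemma bicanonicalRepresentation_apply {ζ : K} (hζ : ζ ^ (4 * g + 2) = 1) {σ : WimanAut K g}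
    (hx : σ (wimanX K g) = ζ ^ 2 • wimanX K g)
    (hy : σ (wimanY K g) = ζ ^ (2 * g + 1) • wimanY K g)
    {η : bicanonicalForms K (WimanField K g)} {j : Fin (2 * g - 1) ⊕ Fin (g - 2)}
    (hη : (η : QuadDiff K (WimanField K g)) = standardFunction K g j • wimanSq K g) :
    bicanonicalRepresentation K (WimanField K g) σ η = ζ ^ eigenExponent g j • η := by
  apply Subtype.ext
  change quadDiffMap σ η = ζ ^ eigenExponent g j • (η : QuadDiff K (WimanField K g))
  rw [hη, quadDiffMap_smul_wimanSq (by rw [← pow_mul, ← hζ]; ring) hx hy,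
    apply_standardFunction hx hy, pow_eigenExponent, smul_assoc, smul_smul, ← pow_mul]

end Generator

/-! ### A determinant-one lift of σ preserving the ideal -/

section Stability

variable {K : Type*} [Field K] {g : ℕ}

/-- A multiple of the generator of the automorphism group acts on the bicanonical model with
determinant one. -/
lemma exists_mem_linearAut [IsAlgClosed K] (hg : 1 ≤ g) (h2 : (2 : K) ≠ 0)
    (hn : ((2 * g + 1 : ℕ) : K) ≠ 0) {ζ : K} (hζ0 : ζ ≠ 0) {σ : WimanAut K g}
    (hx : σ (wimanX K g) = ζ ^ 2 • wimanX K g)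
    (hy : σ (wimanY K g) = ζ ^ (2 * g + 1) • wimanY K g)
    (B : Module.Basis (Fin (2 * g - 1) ⊕ Fin (g - 2)) K (bicanonicalForms K (WimanField K g)))
    (hB : ∀ j, (B j : QuadDiff K (WimanField K g)) = standardFunction K g j • wimanSq K g) :
    ∃ s ∈ linearAut (bicanonicalIdeal K (WimanField K g)), ∃ c : K, c ≠ 0 ∧
      ∀ j, s.1 (B j) = (c * ζ ^ eigenExponent g j) • B j := by
  have : Nonempty (Fin (2 * g - 1) ⊕ Fin (g - 2)) := ⟨Sum.inl ⟨0, by omega⟩⟩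
  obtain ⟨s, c, hc, hs⟩ := exists_diagonal_specialLinear B (fun j => ζ ^ eigenExponent g j)
    fun j => pow_ne_zero _ hζ0
  refine ⟨s, fun p => ?_, c, hc, hs⟩
  obtain ⟨τ, hτx, hτy⟩ := exists_wimanInvolution K g
  have hy0 : wimanY K g ≠ 0 := (wiman_affineChart hτx hτy h2 hn).Y_ne_zero
  obtain ⟨e, he⟩ := exists_quadDiffEquiv (g := g) h2 hy0
  -- In terms of functions, `s` acts as c ζ⁴ times `σ`, which is the shape required by
  -- `symMap_mem_bicanonicalIdeal_iff`.
  have hcF : algebraMap K (WimanField K g) (c * ζ ^ 4) ≠ 0 := by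
    rw [Ne, map_eq_zero]
    exact mul_ne_zero hc (pow_ne_zero _ hζ0)
  refine symMap_mem_bicanonicalIdeal_iff e σ hcF (fun v => ?_) p
  have hsmul : ∀ (a : K) (η : QuadDiff K (WimanField K g)), e (a • η) = a • e η := fun a η => by
    rw [← algebraMap_smul (WimanField K g) a η, map_smul, algebraMap_smul]
  have heB : ∀ j, e (B j) = standardFunction K g j := fun j => by
    rw [hB, map_smul, he, smul_eq_mul, mul_one]
  induction B.mem_span v using Submodule.span_induction with
  | mem v hv =>
    obtain ⟨j, rfl⟩ := hv
    have h3 : ((s.1 (B j) : bicanonicalForms K (WimanField K g)) : QuadDiff K (WimanField K g))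
        = (c * ζ ^ eigenExponent g j) • (B j : QuadDiff K (WimanField K g)) :=
      congrArg Subtype.val (hs j)
    refine (congrArg e h3).trans ?_
    rw [hsmul, heB, apply_standardFunction hx hy, pow_eigenExponent, ← mul_assoc, mul_smul,
      ← Algebra.smul_def]
  | zero => simp only [map_zero, Submodule.coe_zero, mul_zero]
  | add v w _ _ hv hw => simp only [map_add, Submodule.coe_add, mul_add, hv, hw]
  | smul a v _ hv =>
    simp only [map_smul, Submodule.coe_smul, hsmul, hv, mul_smul_comm]

end Stability

/-! ### The main theorem -/

theorem mainTheorem7 {K : Type*} [Field K] [IsAlgClosed K] (g : ℕ) (hg : 2 ≤ g)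
    (ζ : K) (hζ : IsPrimitiveRoot ζ (4 * g + 2)) :
    -- the automorphism group fixes the branch point at infinity
    (∃! P : CurvePoint K (WimanField K g), IsBranchPointAtInfinity P) ∧
    (∀ P : CurvePoint K (WimanField K g), IsBranchPointAtInfinity P →
      ∀ φ : WimanAut K g, φ • P.localRing = P.localRing) ∧
    -- the generator `σ` of the automorphism group
    ∃ σ : WimanAut K g,
      σ (wimanX K g) = ζ ^ 2 • wimanX K g ∧
      σ (wimanY K g) = ζ ^ (2 * g + 1) • wimanY K g ∧
      orderOf σ = 4 * g + 2 ∧ (∀ φ : WimanAut K g, φ ∈ Subgroup.zpowers σ) ∧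
      -- the standard basis of bicanonical forms
      ∃ B : Module.Basis (Fin (2 * g - 1) ⊕ Fin (g - 2)) K (bicanonicalForms K (WimanField K g)),
        (∀ j, (B j : QuadDiff K (WimanField K g)) = standardFunction K g j • wimanSq K g) ∧
        -- its elements are eigenvectors of `σ`, with distinct powers of `ζ` as eigenvalues
        (∀ j, bicanonicalRepresentation K (WimanField K g) σ (B j)
          = ζ ^ eigenExponent g j • B j) ∧
        (Function.Injective fun j => ζ ^ eigenExponent g j) ∧
        -- bicanonical forms are a multiplicity free representation, and `B` is adapted to it
        IsMultiplicityFree (bicanonicalRepresentation K (WimanField K g)) ∧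
        IsUnionOfIrreducibleBases (bicanonicalRepresentation K (WimanField K g)) B ∧
        -- the bicanonical model (an embedding for `g ≥ 3`) is multiplicity free
        (3 ≤ g → Finite (linearAut (bicanonicalIdeal K (WimanField K g))) ∧
          IsMultiplicityFree
            (slRepresentation (linearAut (bicanonicalIdeal K (WimanField K g)))) ∧
          IsUnionOfIrreducibleBases
            (slRepresentation (linearAut (bicanonicalIdeal K (WimanField K g)))) B) ∧
        -- the basis and its torus determine stability for all Hilbert points of the model
        ∀ m : ℕ,
          BasisDeterminesStability B (hilbertPoint (bicanonicalIdeal K (WimanField K g)) m) ∧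
          TorusDeterminesStability (diagonalTorus B)
            (hilbertPoint (bicanonicalIdeal K (WimanField K g)) m) := by
  -- A primitive root of order 4g + 2 exists only if the characteristic does not divide 4g + 2;
  -- hence 2 and 2g + 1 are both invertible.
  have h42 : ((4 * g + 2 : ℕ) : K) ≠ 0 := hζ.neZero'.out
  have h42' : ((4 * g + 2 : ℕ) : K) = 2 * ((2 * g + 1 : ℕ) : K) := by push_cast; ring
  rw [h42'] at h42
  have h2 := left_ne_zero_of_mul h42
  have hn := right_ne_zero_of_mul h42
  have hζ0 : ζ ≠ 0 := hζ.ne_zero (by omega)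
  obtain ⟨σ, hx, hy⟩ := exists_wimanAut (g := g) (a := ζ ^ 2) (b := ζ ^ (2 * g + 1))
    (by rw [← pow_mul, ← hζ.pow_eq_one]; ring) (by rw [← pow_mul, ← hζ.pow_eq_one]; ring)
  obtain ⟨hord, hgen⟩ := orderOf_eq_and_forall_mem_zpowers hg h2 hn hζ hx hy
  obtain ⟨B, hB⟩ := exists_bicanonicalBasis (by omega) h2 hn
  have hσB := fun j => bicanonicalRepresentation_apply hζ.pow_eq_one hx hy (hB j)
  have hinj : Function.Injective fun j => ζ ^ eigenExponent g j := fun i j hij =>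
    eigenExponent_injective g (hζ.pow_inj (eigenExponent_lt i) (eigenExponent_lt j) hij)
  have hdiag : ∀ φ j, ∃ c : K,
      bicanonicalRepresentation K (WimanField K g) φ (B j) = c • B j := by
    intro φ j
    obtain ⟨k, rfl⟩ := hgen φ
    refine ⟨(ζ ^ eigenExponent g j) ^ k, ?_⟩
    rw [map_pow]
    induction k with
    | zero => rw [pow_zero, pow_zero, one_smul]; rfl
    | succ k ih => rw [pow_succ', Module.End.mul_apply, ih, map_smul, hσB, smul_smul, pow_succ]
  obtain ⟨hmf, hub⟩ := isMultiplicityFree_of_diagonal _ B hdiag σ _ hinj hσB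
  obtain ⟨s, hs, c, hc, hsB⟩ := exists_mem_linearAut (by omega) h2 hn hζ0 hx hy B hB
  have hroots : ∀ j, (ζ ^ eigenExponent g j) ^ (4 * g + 2) = 1 := fun j => by
    rw [← pow_mul, mul_comm, pow_mul, hζ.pow_eq_one, one_pow]
  have hμ : Function.Injective fun j => c * ζ ^ eigenExponent g j :=
    (mul_right_injective₀ hc).comp hinj
  have hN : 0 < (4 * g + 2) * Fintype.card (Fin (2 * g - 1) ⊕ Fin (g - 2)) := by
    have : Nonempty (Fin (2 * g - 1) ⊕ Fin (g - 2)) := ⟨Sum.inl ⟨0, by omega⟩⟩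
    exact Nat.mul_pos (by omega) Fintype.card_pos
  -- Only the cyclic group generated by `s` is used here, so g = 2, where the model is not an
  -- embedding, is included.
  have hdet : ∀ m, BasisDeterminesStability B
      (hilbertPoint (bicanonicalIdeal K (WimanField K g)) m) :=
    basisDeterminesStability_of_diagonal B hN hs (mem_diagonalRoots_of_ratio B hroots hsB) hμ hsB
  refine ⟨existsUnique_branchPointAtInfinity h2 hn, fun P hP φ => smul_localRing_eq hg h2 hn hP φ,
    σ, hx, hy, hord, fun φ => ?_, B, hB, hσB, hinj, hmf, hub, fun hg3 => ?_,
    fun m => ⟨hdet m, _, B, rfl, hdet m⟩⟩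
  · obtain ⟨k, rfl⟩ := hgen φ
    exact Subgroup.npow_mem_zpowers σ k
  -- All linear automorphisms are diagonal with eigenvalues of bounded order, which gives
  -- finiteness; `s` supplies the distinct eigenvalues.
  · have hle : linearAut (bicanonicalIdeal K (WimanField K g))
        ≤ diagonalRoots B ((4 * g + 2) * Fintype.card (Fin (2 * g - 1) ⊕ Fin (g - 2))) := by
      intro t ht
      obtain ⟨d, μ, hμ1, ht⟩ := exists_of_mem_linearAut hg3 h2 hn B hB ht
      exact mem_diagonalRoots_of_ratio B hμ1 ht
    exact ⟨finite_of_le_diagonalRoots B hN hle, isMultiplicityFree_slRepresentation B hle hs hμ hsB⟩
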